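/- **Theorem (Completeness of the $\mathrm{LO_v}$-calculus, with soundness).** *Circuits.* Let $\mathbf{LO_v}$ be the PROP (strict symmetric monoidal category with objects $n\in\mathbb N$ and tensor $\oplus$) freely generated by the vacuum source $s:0\to1$, the vacuum detector $d:1\to0$, the phase shifters $P_\varphi:1\to1$, the wave plates $W_\theta:1\to1$, the beam splitters $B_\theta:2\to2$ ($\varphi,\theta\in\mathbb R$) and the polarising beam splitter $K:2\to2$. An $\mathrm{LO_v}$-circuit is a morphism $D:n\to m$ of this PROP. Write $I$ for the wire, $\sigma$ for the swap of two wires, $\varepsilon$ for the empty circuit, $f\,;g$ for "first $f$, then $g$", and $N:=W_{\pi/2}\,;P_{-\pi/2}$ (negation). *Semantics.* Let $M_n=\{V,H\}\times\{0,\dots,n-1\}$ have elements $c_p$. The single-photon semantics $[\![D]\!]:\mathbb C^{M_n}\to\mathbb C^{M_m}$ of $D:n\to m$ is the linear map with $[\![D_2\circ D_1]\!]=[\![D_2]\!]\circ[\![D_1]\!]$, $[\![D_1\oplus D_2]\!]=[\![D_1]\!]\oplus[\![D_2]\!]$, $[\![s]\!]=0$, $[\![d]\!]=0$, $[\![\varepsilon]\!]=0$,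 identities and swaps interpreted as identities and permutations of positions, and - $[\![P_\varphi]\!]|c_0\rangle=e^{i\varphi}|c_0\rangle$, - $[\![W_\theta]\!]|c_0\rangle=\cos\theta\,|c_0\rangle+i\sin\theta\,|\bar c_0\rangle$, where $\bar V=H$ and $\bar H=V$, - $[\![B_\theta]\!]|c_p\rangle=\cos\theta\,|c_p\rangle+i\sin\theta\,|c_{1-p}\rangle$, - $[\![K]\!]|V_p\rangle=|V_p\rangle$, $[\![K]\!]|H_p\rangle=|H_{1-p}\rangle$. *Equational theory.* $\mathrm{LO_v}\vdash D_1=D_2$ is the smallest congruence that contains the axioms of PROPs and, for all real parameters, the equations 1. $P_{\varphi_1};P_{\varphi_2}=P_{\varphi_1+\varphi_2}$, $\;P_0=I$, $\;B_0=I\oplus I$; 2. $(N\oplus N);K;(N\oplus N)=K;\sigma$, $\;K;K=I\oplus I$, $\;K;(N\oplus I);K=(N\oplus I);K;(N\oplus I)$, $\;(K\oplus I);(I\oplus K);(K\oplus I)=(\sigma\oplus I);(I\oplus K);(\sigma\oplus I)$; 3. $s;d=\varepsilon$, $\;s;P_\varphi=s$, $\;s;W_\theta=s$, $\;(s\oplus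 s);K=s\oplus s$, $\;P_\varphi;d=d$, $\;W_\theta;d=d$, $\;K;(d\oplus d)=d\oplus d$; 4. $P_\varphi;W_{\pi/2}=W_{\pi/2};P_\varphi$, $\;(P_\varphi\oplus P_\varphi);K=K;(P_\varphi\oplus P_\varphi)$, $\;B_\theta=(I\oplus N);K;(W_\theta\oplus W_\theta);K;(I\oplus N)$; 5. (Euler) $L=R$, where $L=(B_{\theta_1}\oplus I);(P_{\varphi_2}\oplus P_{\varphi_1}\oplus I);(I\oplus B_{\theta_2});(B_{\theta_3}\oplus I)$ has arbitrary angles, $R=(I\oplus P_{\beta_1}\oplus I);(I\oplus B_{\alpha_1});(P_{\beta_2}\oplus I\oplus I);(B_{\alpha_2}\oplus I);(I\oplus P_{\beta_3}\oplus I);(I\oplus B_{\alpha_3});(P_{\beta_4}\oplus P_{\beta_5}\oplus P_{\beta_6})$, and $\alpha_1,\alpha_2,\alpha_3,\beta_1,\beta_2,\beta_3\in[0,\pi)$, $\beta_4,\beta_5,\beta_6\in[0,2\pi)$ are the unique angles such that $\alpha_i\in\{0,\frac\pi2\}\Rightarrow\beta_i=0$ for $i=1,2,3$, $\alpha_2=0\Rightarrow\alpha_1=0$,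 and $[\![L]\!]$ and $[\![R]\!]$ restrict to the same unitary of $\mathbb C^3$ on horizontally polarised photons. *Claim.* For all $n,m\in\mathbb N$ and all $\mathrm{LO_v}$-circuits $D_1,D_2:n\to m$, if $[\![D_1]\!]=[\![D_2]\!]$ then $\mathrm{LO_v}\vdash D_1=D_2$. Together with soundness, the equational theory is a complete axiomatisation: $[\![D_1]\!]=[\![D_2]\!]$ if and only if $\mathrm{LO_v}\vdash D_1=D_2$. -/

import Mathlib

/-! # Linear optical circuits with vacuum sources and detectors

Syntax (terms over the signature, with the operations of a PROP), single-photon semantics, and the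
equational theory of the `LOv`-calculus. -/

noncomputable section

namespace LOv

/-! ## Syntax -/

/-- Terms denoting `LOv`-circuits with `n` input wires and `m` output wires: the generators, closed
under the operations of a PROP (identities, symmetries, sequential and parallel composition).
`id 0` is the empty circuit, `id 1` is the wire, `swap 1 1` is the swap of two wires.
Two terms denote the same circuit when the axioms of PROPs identify them; these axioms are part of
the relation `Derivable` below. -/
inductive Circuit : ℕ → ℕ → Type
  /-- vacuum state source -/
  | source : Circuit 0 1
  /-- vacuum state detector -/
  | detector : Circuit 1 0
  /-- phase shifter -/
  | phase (φ : ℝ) : Circuit 1 1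
  /-- wave plate -/
  | waveplate (θ : ℝ) : Circuit 1 1
  /-- beam splitter -/
  | bs (θ : ℝ) : Circuit 2 2
  /-- polarising beam splitter -/
  | pbs : Circuit 2 2
  /-- identity on `n` wires -/
  | id (n : ℕ) : Circuit n n
  /-- the symmetry exchanging a block of `n` wires with a block of `m` wires -/
  | swap (n m : ℕ) : Circuit (n + m) (m + n)
  /-- `seq D₁ D₂` is `D₂ ∘ D₁` (first `D₁`, then `D₂`) -/
  | seq {n m k : ℕ} (D₁ : Circuit n m) (D₂ : Circuit m k) : Circuit n k
  /-- `par D₁ D₂` is `D₁ ⊕ D₂` (`D₁` above `D₂`) -/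
  | par {n m n' m' : ℕ} (D₁ : Circuit n m) (D₂ : Circuit n' m') : Circuit (n + n') (m + m')

infixl:65 " ⨟ " => Circuit.seq
infixl:70 " ⊕ᶜ " => Circuit.par

namespace Circuit

/-- Transport along equalities between numbers of wires; it does not change the circuit. -/
def cast {n m n' m' : ℕ} (hn : n = n') (hm : m = m') (D : Circuit n m) : Circuit n' m' :=
  hn ▸ hm ▸ D

/-- A single wire. -/
abbrev wire : Circuit 1 1 := id 1

/-- The negation of the polarisation: a wave plate of angle `π / 2` and a phase shifter of
angle `-π / 2`. -/
def neg : Circuit 1 1 := waveplate (Real.pi / 2) ⨟ phase (-(Real.pi / 2))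

end Circuit

/-! ## Single-photon semantics -/

/-- Vertical and horizontal polarisation. -/
inductive Pol
  | V
  | H
  deriving DecidableEq

instance : Fintype Pol := ⟨{.V, .H}, fun c => by cases c <;> simp⟩

/-- The set `M_n` of spatial and polarisation modes on `n` wires. -/
abbrev Mode (n : ℕ) : Type := Pol × Fin n

/-- The state space `ℂ^{M_n}` of a single photon on `n` wires. -/
abbrev State (n : ℕ) : Type := Mode n → ℂ

/-- The basis state `|c_p⟩`. -/
def ket {n : ℕ} (c : Pol) (p : Fin n) : State n := Pi.single (c, p) 1

/-- The linear map given by the images of the basis states `|c_p⟩`. -/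
def linearOn {n m : ℕ} (f : Pol → Fin n → State m) : State n →ₗ[ℂ] State m :=
  (Pi.basisFun ℂ (Mode n)).constr ℂ (fun x => f x.1 x.2)

/-- The direct sum of `f` and `g`: on `|c_k⟩` it is `f |c_k⟩` when `k < n`, and `g |c_{k-n}⟩` with
positions shifted by `m` when `k ≥ n`. -/
def directSum {n m n' m' : ℕ} (f : State n →ₗ[ℂ] State m) (g : State n' →ₗ[ℂ] State m') :
    State (n + n') →ₗ[ℂ] State (m + m') :=
  linearOn fun c k => Fin.addCases
    (fun k => linearOn (fun d q => ket d (Fin.castAdd m' q)) (f (ket c k)))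
    (fun k => linearOn (fun d q => ket d (Fin.natAdd m q)) (g (ket c k))) k

/-- The other polarisation. -/
def Pol.flip : Pol → Pol
  | .V => .H
  | .H => .V

/-- The position to which a position `p` is sent when the first `n` wires are exchanged with the
last `m` wires. -/
def swapPos (n m : ℕ) (p : Fin (n + m)) : Fin (m + n) :=
  Fin.addCases (fun i => Fin.natAdd m i) (fun j => Fin.castAdd n j) p

/-- The single-photon semantics of a circuit. -/
def interp : {n m : ℕ} → Circuit n m → (State n →ₗ[ℂ] State m)
  | _, _, .source => 0
  | _, _, .detector => 0
  | _, _, .phase φ => linearOn fun c p => Complex.exp (Complex.I * φ) • ket c p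
  | _, _, .waveplate θ => linearOn fun c p =>
      (Real.cos θ : ℂ) • ket c p + (Complex.I * Real.sin θ) • ket c.flip p
  | _, _, .bs θ => linearOn fun c p =>
      (Real.cos θ : ℂ) • ket c p + (Complex.I * Real.sin θ) • ket c (1 - p)
  | _, _, .pbs => linearOn fun c p =>
      match c with
      | .V => ket .V p
      | .H => ket .H (1 - p)
  | _, _, .id _ => LinearMap.id
  | _, _, .swap n m => linearOn fun c p => ket c (swapPos n m p)
  | _, _, .seq D₁ D₂ => interp D₂ ∘ₗ interp D₁
  | _, _, .par D₁ D₂ => directSum (interp D₁) (interp D₂)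

/-- The injection `ℂ^n → ℂ^{M_n}`, `|k⟩ ↦ |H_k⟩`. -/
def hInj (n : ℕ) : (Fin n → ℂ) →ₗ[ℂ] State n :=
  (Pi.basisFun ℂ (Fin n)).constr ℂ (fun k => ket .H k)

/-- `U` is the semantics of `D` restricted to horizontally polarised photons. As `hInj` is
injective there is at most one such `U`; there is one when `D` is polarisation-preserving, that is,
built from beam splitters and phase shifters only. -/
def IsHSemantics {n m : ℕ} (D : Circuit n m) (U : (Fin n → ℂ) →ₗ[ℂ] (Fin m → ℂ)) : Prop :=
  interp D ∘ₗ hInj n = hInj m ∘ₗ U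

/-! ## Equational theory -/

open Circuit

/-- The axioms of PROPs, i.e. of strict symmetric monoidal categories with objects the natural
numbers. -/
inductive PropAxiom : {n m : ℕ} → Circuit n m → Circuit n m → Prop
  | id_seq {n m : ℕ} (D : Circuit n m) : PropAxiom (id n ⨟ D) D
  | seq_id {n m : ℕ} (D : Circuit n m) : PropAxiom (D ⨟ id m) D
  | seq_assoc {n m k l : ℕ} (D₁ : Circuit n m) (D₂ : Circuit m k) (D₃ : Circuit k l) :
      PropAxiom ((D₁ ⨟ D₂) ⨟ D₃) (D₁ ⨟ (D₂ ⨟ D₃))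
  | empty_par {n m : ℕ} (D : Circuit n m) :
      PropAxiom ((id 0 ⊕ᶜ D).cast (Nat.zero_add n) (Nat.zero_add m)) D
  | par_empty {n m : ℕ} (D : Circuit n m) :
      PropAxiom ((D ⊕ᶜ id 0).cast (Nat.add_zero n) (Nat.add_zero m)) D
  | par_assoc {n m n' m' n'' m'' : ℕ} (D₁ : Circuit n m) (D₂ : Circuit n' m')
      (D₃ : Circuit n'' m'') :
      PropAxiom (((D₁ ⊕ᶜ D₂) ⊕ᶜ D₃).cast (Nat.add_assoc n n' n'') (Nat.add_assoc m m' m''))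
        (D₁ ⊕ᶜ (D₂ ⊕ᶜ D₃))
  | par_id (n m : ℕ) : PropAxiom (id n ⊕ᶜ id m) (id (n + m))
  | interchange {n m k n' m' k' : ℕ} (D₁ : Circuit n m) (E₁ : Circuit m k)
      (D₂ : Circuit n' m') (E₂ : Circuit m' k') :
      PropAxiom ((D₁ ⨟ E₁) ⊕ᶜ (D₂ ⨟ E₂)) ((D₁ ⊕ᶜ D₂) ⨟ (E₁ ⊕ᶜ E₂))
  | swap_swap (n m : ℕ) : PropAxiom (swap n m ⨟ swap m n) (id (n + m))
  | swap_natural {n m n' m' : ℕ} (D₁ : Circuit n m) (D₂ : Circuit n' m') :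
      PropAxiom ((D₁ ⊕ᶜ D₂) ⨟ swap m m') (swap n n' ⨟ (D₂ ⊕ᶜ D₁))
  | swap_empty (n : ℕ) : PropAxiom ((swap n 0).cast rfl (Nat.zero_add n)) (id n)
  | swap_add (n m k : ℕ) :
      PropAxiom ((swap n (m + k)).cast (Nat.add_assoc n m k).symm (Nat.add_assoc m k n))
        ((swap n m ⊕ᶜ id k).cast rfl (Nat.add_assoc m n k) ⨟ (id m ⊕ᶜ swap n k))

/-- A two-wire circuit on the top two of three wires. -/
abbrev onTop (D : Circuit 2 2) : Circuit 3 3 := par (n := 2) (m := 2) (n' := 1) (m' := 1) D wire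

/-- A two-wire circuit on the bottom two of three wires. -/
abbrev onBottom (D : Circuit 2 2) : Circuit 3 3 := par (n := 1) (m := 1) (n' := 2) (m' := 2) wire D

/-- Three one-wire circuits in parallel, from top to bottom. -/
abbrev par3 (D₀ D₁ D₂ : Circuit 1 1) : Circuit 3 3 := (D₀ ⊕ᶜ D₁) ⊕ᶜ D₂

/-- Left-hand side of the Euler equation: three beam splitters, on the top two wires, on the bottom
two wires, and on the top two wires again. -/
def eulerLeft (θ₁ θ₂ θ₃ φ₁ φ₂ : ℝ) : Circuit 3 3 :=
  onTop (bs θ₁) ⨟ par3 (phase φ₂) (phase φ₁) wire ⨟ onBottom (bs θ₂) ⨟ onTop (bs θ₃)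

/-- Right-hand side of the Euler equation: three beam splitters, on the bottom two wires, on the top
two wires, and on the bottom two wires again, each with a phase shifter on its top left, followed by
one phase shifter on each wire. -/
def eulerRight (α₁ α₂ α₃ β₁ β₂ β₃ β₄ β₅ β₆ : ℝ) : Circuit 3 3 :=
  par3 wire (phase β₁) wire ⨟ onBottom (bs α₁) ⨟
    par3 (phase β₂) wire wire ⨟ onTop (bs α₂) ⨟
    par3 wire (phase β₃) wire ⨟ onBottom (bs α₃) ⨟
    par3 (phase β₄) (phase β₅) (phase β₆)

/-- The conditions that make the angles of the right-hand side of the Euler equation unique. -/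
structure EulerAngles (α₁ α₂ α₃ β₁ β₂ β₃ β₄ β₅ β₆ : ℝ) : Prop where
  hα₁ : α₁ ∈ Set.Ico 0 Real.pi
  hα₂ : α₂ ∈ Set.Ico 0 Real.pi
  hα₃ : α₃ ∈ Set.Ico 0 Real.pi
  hβ₁ : β₁ ∈ Set.Ico 0 Real.pi
  hβ₂ : β₂ ∈ Set.Ico 0 Real.pi
  hβ₃ : β₃ ∈ Set.Ico 0 Real.pi
  hβ₄ : β₄ ∈ Set.Ico 0 (2 * Real.pi)
  hβ₅ : β₅ ∈ Set.Ico 0 (2 * Real.pi)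
  hβ₆ : β₆ ∈ Set.Ico 0 (2 * Real.pi)
  h₁ : α₁ = 0 ∨ α₁ = Real.pi / 2 → β₁ = 0
  h₂ : α₂ = 0 ∨ α₂ = Real.pi / 2 → β₂ = 0
  h₃ : α₃ = 0 ∨ α₃ = Real.pi / 2 → β₃ = 0
  h₂₁ : α₂ = 0 → α₁ = 0

/-- The axioms of the `LOv`-calculus. -/
inductive LOvAxiom : {n m : ℕ} → Circuit n m → Circuit n m → Prop
  | phase_add (φ₁ φ₂ : ℝ) : LOvAxiom (phase φ₁ ⨟ phase φ₂) (phase (φ₁ + φ₂))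
  | phase_zero : LOvAxiom (phase 0) wire
  | bs_zero : LOvAxiom (bs 0) (wire ⊕ᶜ wire)
  | neg_pbs_neg : LOvAxiom ((neg ⊕ᶜ neg) ⨟ pbs ⨟ (neg ⊕ᶜ neg)) (pbs ⨟ swap 1 1)
  | pbs_pbs : LOvAxiom (pbs ⨟ pbs) (wire ⊕ᶜ wire)
  | pbs_pbs_pbs : LOvAxiom (onTop pbs ⨟ onBottom pbs ⨟ onTop pbs)
      (onTop (swap 1 1) ⨟ onBottom pbs ⨟ onTop (swap 1 1))
  | pbs_neg_pbs : LOvAxiom (pbs ⨟ (neg ⊕ᶜ wire) ⨟ pbs) ((neg ⊕ᶜ wire) ⨟ pbs ⨟ (neg ⊕ᶜ wire))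
  | source_detector : LOvAxiom (source ⨟ detector) (id 0)
  | source_phase (φ : ℝ) : LOvAxiom (source ⨟ phase φ) source
  | source_waveplate (θ : ℝ) : LOvAxiom (source ⨟ waveplate θ) source
  | source_pbs : LOvAxiom ((source ⊕ᶜ source) ⨟ pbs) (source ⊕ᶜ source)
  | phase_detector (φ : ℝ) : LOvAxiom (phase φ ⨟ detector) detector
  | waveplate_detector (θ : ℝ) : LOvAxiom (waveplate θ ⨟ detector) detector
  | pbs_detector : LOvAxiom (pbs ⨟ (detector ⊕ᶜ detector)) (detector ⊕ᶜ detector)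
  | phase_waveplate (φ : ℝ) :
      LOvAxiom (phase φ ⨟ waveplate (Real.pi / 2)) (waveplate (Real.pi / 2) ⨟ phase φ)
  | phase_pbs (φ : ℝ) : LOvAxiom ((phase φ ⊕ᶜ phase φ) ⨟ pbs) (pbs ⨟ (phase φ ⊕ᶜ phase φ))
  | bs_waveplate (θ : ℝ) :
      LOvAxiom (bs θ)
        ((wire ⊕ᶜ neg) ⨟ pbs ⨟ (waveplate θ ⊕ᶜ waveplate θ) ⨟ pbs ⨟ (wire ⊕ᶜ neg))
  | euler (θ₁ θ₂ θ₃ φ₁ φ₂ α₁ α₂ α₃ β₁ β₂ β₃ β₄ β₅ β₆ : ℝ)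
      (hangles : EulerAngles α₁ α₂ α₃ β₁ β₂ β₃ β₄ β₅ β₆)
      (U : (Fin 3 → ℂ) →ₗ[ℂ] (Fin 3 → ℂ))
      (hleft : IsHSemantics (eulerLeft θ₁ θ₂ θ₃ φ₁ φ₂) U)
      (hright : IsHSemantics (eulerRight α₁ α₂ α₃ β₁ β₂ β₃ β₄ β₅ β₆) U) :
      LOvAxiom (eulerLeft θ₁ θ₂ θ₃ φ₁ φ₂) (eulerRight α₁ α₂ α₃ β₁ β₂ β₃ β₄ β₅ β₆)

/-- `Derivable D₁ D₂` is `LOv ⊢ D₁ = D₂`: the smallest congruence that satisfies the axioms of PROPs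
and the axioms of the `LOv`-calculus. -/
inductive Derivable : {n m : ℕ} → Circuit n m → Circuit n m → Prop
  | prop {n m : ℕ} {D₁ D₂ : Circuit n m} (h : PropAxiom D₁ D₂) : Derivable D₁ D₂
  | ax {n m : ℕ} {D₁ D₂ : Circuit n m} (h : LOvAxiom D₁ D₂) : Derivable D₁ D₂
  | refl {n m : ℕ} (D : Circuit n m) : Derivable D D
  | symm {n m : ℕ} {D₁ D₂ : Circuit n m} (h : Derivable D₁ D₂) : Derivable D₂ D₁
  | trans {n m : ℕ} {D₁ D₂ D₃ : Circuit n m} (h : Derivable D₁ D₂) (h' : Derivable D₂ D₃) :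
      Derivable D₁ D₃
  | seq {n m k : ℕ} {D₁ D₁' : Circuit n m} {D₂ D₂' : Circuit m k} (h₁ : Derivable D₁ D₁')
      (h₂ : Derivable D₂ D₂') : Derivable (D₁ ⨟ D₂) (D₁' ⨟ D₂')
  | par {n m n' m' : ℕ} {D₁ D₁' : Circuit n m} {D₂ D₂' : Circuit n' m'} (h₁ : Derivable D₁ D₁')
      (h₂ : Derivable D₂ D₂') : Derivable (D₁ ⊕ᶜ D₂) (D₁' ⊕ᶜ D₂')

end LOv

end

noncomputable section

namespace LOv

section Linear

open Circuit

/-! ## Linear maps between state spaces -/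

/-! Soundness is a computation on basis states. For completeness, circuits are taken modulo
derivability and `Mor.sem` is shown to be injective on the resulting PROP, in three layers.

Passive circuits (phase shifters and beam splitters) act as a unitary matrix on positions and
trivially on polarisations. The Euler axiom exchanges a top-bottom-top triple of gates for a
bottom-top-bottom triple and conversely, so a passive circuit can be rewritten until a single gate
touches its last wire (`Passive.exists_factorization`). If the matrix is the identity, that gate
degenerates to a phase on its other wire, the last wire becomes idle, and induction shows that the
circuit is the identity (`Passive.eq_id`). Passive circuits are invertible, so the matrix determines
the circuit (`Passive.ext`); every unitary matrix occurs (`exists_passive_sem_eq`).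

In a circuit that also has sources and detectors, these move to the two ends, leaving a passive
circuit with matrix `U` in between; the semantics is then a corner of `U`. Two unitary matrices with
the same corner differ by unitary factors fixing the coordinates of the corner
(`exists_unitary_of_corner_eq`, a Gram matrix argument). Such factors are passive circuits on the
vacuum wires only, and sources and detectors absorb them (`HasNormalForm.ext`).

Finally, `split` turns polarisation into position and is undone by `merge`. Pushed through `split`,
a wave plate becomes a beam splitter and a polarising beam splitter becomes an exchange of wires.
Hence every circuit `f` satisfies `f ⬝ splitAll m = splitAll n ⬝ g` with `g` free of polarisation
effects (`Encodable.mk`). The semantics of `f` determines the matrix of `g`, since `splitAll`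
reaches every position; the previous layer then determines `g`, and merging recovers `f`. -/

@[simp] theorem linearOn_ket {n m : ℕ} (f : Pol → Fin n → State m) (c : Pol) (p : Fin n) :
    linearOn f (ket c p) = f c p := by
  have := (Pi.basisFun ℂ (Mode n)).constr_basis ℂ (fun x => f x.1 x.2) (c, p)
  rwa [Pi.basisFun_apply] at this

theorem state_hom_ext {n : ℕ} {E : Type*} [AddCommMonoid E] [Module ℂ E]
    {f g : State n →ₗ[ℂ] E} (h : ∀ c p, f (ket c p) = g (ket c p)) : f = g := by
  refine (Pi.basisFun ℂ (Mode n)).ext fun x => ?_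
  rw [Pi.basisFun_apply]
  exact h x.1 x.2

/-- The linear map moving the photon along a map between positions. -/
def relabel {n m : ℕ} (f : Fin n → Fin m) : State n →ₗ[ℂ] State m :=
  linearOn fun c p => ket c (f p)

@[simp] theorem relabel_ket {n m : ℕ} (f : Fin n → Fin m) (c : Pol) (p : Fin n) :
    relabel f (ket c p) = ket c (f p) := by
  simp [relabel]

@[simp] theorem relabel_relabel {n m k : ℕ} (f : Fin n → Fin m) (g : Fin m → Fin k) (v : State n) :
    relabel g (relabel f v) = relabel (fun p => g (f p)) v := by
  have : relabel g ∘ₗ relabel f = relabel (fun p => g (f p)) := state_hom_ext fun c p => by simp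
  exact LinearMap.congr_fun this v

theorem relabel_id {n : ℕ} : relabel (fun p : Fin n => p) = LinearMap.id :=
  state_hom_ext fun c p => by simp

@[simp] theorem relabel_id_apply {n : ℕ} (v : State n) : relabel (fun p : Fin n => p) v = v := by
  rw [relabel_id]; rfl

@[simp] theorem directSum_relabel_castAdd {n m n' m' : ℕ} (f : State n →ₗ[ℂ] State m)
    (g : State n' →ₗ[ℂ] State m') (v : State n) :
    directSum f g (relabel (Fin.castAdd n') v) = relabel (Fin.castAdd m') (f v) := by
  have : directSum f g ∘ₗ relabel (Fin.castAdd n') = relabel (Fin.castAdd m') ∘ₗ f :=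
    state_hom_ext fun c p => by simp [directSum, relabel]
  exact LinearMap.congr_fun this v

@[simp] theorem directSum_relabel_natAdd {n m n' m' : ℕ} (f : State n →ₗ[ℂ] State m)
    (g : State n' →ₗ[ℂ] State m') (v : State n') :
    directSum f g (relabel (Fin.natAdd n) v) = relabel (Fin.natAdd m) (g v) := by
  have : directSum f g ∘ₗ relabel (Fin.natAdd n) = relabel (Fin.natAdd m) ∘ₗ g :=
    state_hom_ext fun c p => by simp [directSum, relabel]
  exact LinearMap.congr_fun this v

@[simp] theorem directSum_ket_castAdd {n m n' m' : ℕ} (f : State n →ₗ[ℂ] State m)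
    (g : State n' →ₗ[ℂ] State m') (c : Pol) (p : Fin n) :
    directSum f g (ket c (Fin.castAdd n' p)) = relabel (Fin.castAdd m') (f (ket c p)) := by
  rw [← directSum_relabel_castAdd f g, relabel_ket]

@[simp] theorem directSum_ket_natAdd {n m n' m' : ℕ} (f : State n →ₗ[ℂ] State m)
    (g : State n' →ₗ[ℂ] State m') (c : Pol) (p : Fin n') :
    directSum f g (ket c (Fin.natAdd n p)) = relabel (Fin.natAdd m) (g (ket c p)) := by
  rw [← directSum_relabel_natAdd f g, relabel_ket]

/-- A linear map out of a direct sum is determined by its restrictions to the summands. -/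
theorem state_add_hom_ext {n m : ℕ} {E : Type*} [AddCommMonoid E] [Module ℂ E]
    {f g : State (n + m) →ₗ[ℂ] E}
    (h : ∀ v : State n, f (relabel (Fin.castAdd m) v) = g (relabel (Fin.castAdd m) v))
    (h' : ∀ v : State m, f (relabel (Fin.natAdd n) v) = g (relabel (Fin.natAdd n) v)) : f = g := by
  refine state_hom_ext fun c p => ?_
  refine Fin.addCases (fun i => ?_) (fun i => ?_) p
  · simpa using h (ket c i)
  · simpa using h' (ket c i)

theorem directSum_id (n m : ℕ) :
    directSum (LinearMap.id : State n →ₗ[ℂ] State n) (LinearMap.id : State m →ₗ[ℂ] State m)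
      = LinearMap.id :=
  state_add_hom_ext (fun v => by simp) (fun v => by simp)

theorem directSum_comp {n m k n' m' k' : ℕ} (f : State n →ₗ[ℂ] State m)
    (g : State m →ₗ[ℂ] State k) (f' : State n' →ₗ[ℂ] State m') (g' : State m' →ₗ[ℂ] State k') :
    directSum (g ∘ₗ f) (g' ∘ₗ f') = directSum g g' ∘ₗ directSum f f' :=
  state_add_hom_ext (fun v => by simp) (fun v => by simp)

/-! ## Semantics of the operations of a PROP -/

theorem interp_cast {n m n' m' : ℕ} (hn : n = n') (hm : m = m') (D : Circuit n m) (v : State n') :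
    interp (D.cast hn hm) v = relabel (Fin.cast hm) (interp D (relabel (Fin.cast hn.symm) v)) := by
  subst hn hm
  simp only [Circuit.cast]
  have (n : ℕ) (v : State n) : relabel (Fin.cast rfl) v = v := relabel_id_apply v
  rw [this, this]

theorem interp_seq {n m k : ℕ} (D₁ : Circuit n m) (D₂ : Circuit m k) :
    interp (D₁ ⨟ D₂) = interp D₂ ∘ₗ interp D₁ := rfl

theorem interp_par {n m n' m' : ℕ} (D₁ : Circuit n m) (D₂ : Circuit n' m') :
    interp (D₁ ⊕ᶜ D₂) = directSum (interp D₁) (interp D₂) := rfl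

theorem interp_id (n : ℕ) : interp (Circuit.id n) = LinearMap.id := rfl

theorem interp_swap (n m : ℕ) : interp (swap n m) = relabel (swapPos n m) := by
  simp [interp, relabel]

@[simp] theorem swapPos_castAdd (n m : ℕ) (p : Fin n) :
    swapPos n m (Fin.castAdd m p) = Fin.natAdd m p := by simp [swapPos]

@[simp] theorem swapPos_natAdd (n m : ℕ) (p : Fin m) :
    swapPos n m (Fin.natAdd n p) = Fin.castAdd n p := by simp [swapPos]

theorem swapPos_val (n m : ℕ) (p : Fin (n + m)) :
    (swapPos n m p : ℕ) = if (p : ℕ) < n then m + p else p - n := by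
  refine Fin.addCases (fun i => ?_) (fun i => ?_) p <;> simp

theorem interp_eq_of_propAxiom {n m : ℕ} {D₁ D₂ : Circuit n m} (h : PropAxiom D₁ D₂) :
    interp D₁ = interp D₂ := by
  cases h with
  | id_seq D => rfl
  | seq_id D => rfl
  | seq_assoc => rfl
  | empty_par =>
    refine LinearMap.ext fun v => ?_
    rw [interp_cast]
    have h1 (n : ℕ) (v : State n) : relabel (Fin.cast (Nat.zero_add n).symm) v
        = relabel (Fin.natAdd 0) v := by
      congr 2; ext; simp
    rw [h1]
    simp only [interp, directSum_relabel_natAdd, relabel_relabel]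
    have h2 (n : ℕ) : (fun p : Fin n => Fin.cast (Nat.zero_add n) (Fin.natAdd 0 p)) = fun p => p := by
      ext; simp
    rw [h2]; simp
  | par_empty =>
    refine LinearMap.ext fun v => ?_
    rw [interp_cast]
    have h1 {n m : ℕ} (f : State n →ₗ[ℂ] State m) (v : State n) :
        relabel (Fin.cast (Nat.add_zero m)) (directSum f LinearMap.id
          (relabel (Fin.cast (Nat.add_zero n).symm) v) : State (m + 0)) = f v := by
      have e : (Fin.cast (Nat.add_zero n).symm) = (Fin.castAdd 0 : Fin n → Fin (n + 0)) := rfl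
      have e' : (fun p => Fin.cast (Nat.add_zero m) (Fin.castAdd 0 p)) = fun p => p := rfl
      rw [e, directSum_relabel_castAdd, relabel_relabel, e', relabel_id_apply]
    exact h1 _ v
  | @par_assoc n m n' m' n'' m'' D₁ D₂ D₃ =>
    -- Casts along associativity only rename positions; these six identities record where each of
    -- the three blocks goes, on the input side (`e`) and on the output side (`f`).
    have e1 (a b c : ℕ) : (fun p : Fin a => Fin.cast (Nat.add_assoc a b c).symm (Fin.castAdd (b + c) p))
        = fun p => Fin.castAdd c (Fin.castAdd b p) := by ext; simp
    have e2 (a b c : ℕ) : (fun p : Fin b => Fin.cast (Nat.add_assoc a b c).symm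
        (Fin.natAdd a (Fin.castAdd c p))) = fun p => Fin.castAdd c (Fin.natAdd a p) := by ext; simp
    have e3 (a b c : ℕ) : (fun p : Fin c => Fin.cast (Nat.add_assoc a b c).symm
        (Fin.natAdd a (Fin.natAdd b p))) = fun p => Fin.natAdd (a + b) p := by
      ext; simp [Nat.add_assoc]
    have f1 (a b c : ℕ) : (fun p : Fin a => Fin.cast (Nat.add_assoc a b c)
        (Fin.castAdd c (Fin.castAdd b p))) = fun p => Fin.castAdd (b + c) p := by ext; simp
    have f2 (a b c : ℕ) : (fun p : Fin b => Fin.cast (Nat.add_assoc a b c)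
        (Fin.castAdd c (Fin.natAdd a p))) = fun p => Fin.natAdd a (Fin.castAdd c p) := by ext; simp
    have f3 (a b c : ℕ) : (fun p : Fin c => Fin.cast (Nat.add_assoc a b c)
        (Fin.natAdd (a + b) p)) = fun p => Fin.natAdd a (Fin.natAdd b p) := by
      ext; simp [Nat.add_assoc]
    refine state_hom_ext fun c p => ?_
    rw [interp_cast]
    refine Fin.addCases (fun i => ?_) (fun i => ?_) p
    · have := congrFun (e1 n n' n'') i
      simp [interp, this, f1]
    · refine Fin.addCases (fun i => ?_) (fun i => ?_) i
      · have := congrFun (e2 n n' n'') i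
        simp [interp, this, f2]
      · have := congrFun (e3 n n' n'') i
        simp [interp, this, f3]
  | par_id n m => exact directSum_id n m
  | interchange => exact directSum_comp _ _ _ _
  | swap_swap n m =>
    refine state_hom_ext fun c p => ?_
    refine Fin.addCases (fun i => ?_) (fun i => ?_) p <;> simp [interp]
  | swap_natural =>
    rw [interp_seq, interp_seq, interp_swap, interp_swap, interp_par, interp_par]
    exact state_add_hom_ext (fun v => by simp) (fun v => by simp)
  | swap_empty n =>
    refine state_hom_ext fun c p => ?_
    rw [interp_cast, interp_swap]
    simp only [relabel_ket, interp, LinearMap.id_apply]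
    congr 1; ext; simp [swapPos_val]
  | swap_add n m k =>
    refine state_hom_ext fun c p => ?_
    rw [interp_cast, interp_swap, interp_seq, LinearMap.comp_apply, interp_cast, interp_par,
      interp_par, interp_swap, interp_swap, interp_id]
    simp only [relabel_ket]
    -- The equality proofs are generalised so that `q` can be split into its three blocks without
    -- disturbing the casts.
    have key : ∀ q : Fin (n + m + k), ∀ (h : n + m + k = n + (m + k)) (h' : m + k + n = m + (k + n))
        (h'' : m + n + k = m + (n + k)),
        ket c (Fin.cast h' (swapPos n (m + k) (Fin.cast h q)))
        = directSum LinearMap.id (relabel (swapPos n k)) (relabel (Fin.cast h'')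
          (directSum (relabel (swapPos n m)) (interp (Circuit.id k)) (ket c q))) := by
      intro q h h' h''
      have a1 (p : Fin m) : (Fin.cast h'' (Fin.castAdd k (Fin.castAdd n p))) = Fin.castAdd (n + k) p := by
        ext; simp
      have a2 (p : Fin n) : (Fin.cast h'' (Fin.castAdd k (Fin.natAdd m p))) =
        Fin.natAdd m (Fin.castAdd k p) := by
        ext; simp
      have a3 (p : Fin k) : (Fin.cast h'' (Fin.natAdd (m + n) p)) =
        Fin.natAdd m (Fin.natAdd n p) := by
        ext; simp [Nat.add_assoc]
      refine Fin.addCases (fun i => ?_) (fun i => ?_) q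
      · refine Fin.addCases (fun i => ?_) (fun i => ?_) i
        · simp [a2]
          congr 1; ext; simp [swapPos_val]; omega
        · simp [a1]
          congr 1; ext; simp [swapPos_val]
      · simp [a3, interp]
        congr 1; ext; simp [swapPos_val]; split_ifs <;> omega
    exact key p _ _ _

end Linear

section Soundness

open Circuit

/-! ## Polarisation-independent linear maps -/

/-- The linear map acting as the matrix `C` on positions and trivially on polarisations. -/
def spatial {n m : ℕ} (C : Matrix (Fin m) (Fin n) ℂ) : State n →ₗ[ℂ] State m :=
  linearOn fun c p => ∑ q, C q p • ket c q

@[simp] theorem spatial_ket {n m : ℕ} (C : Matrix (Fin m) (Fin n) ℂ) (c : Pol) (p : Fin n) :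
    spatial C (ket c p) = ∑ q, C q p • ket c q := by simp [spatial]

theorem ket_apply {n : ℕ} (c d : Pol) (p q : Fin n) :
    ket c p (d, q) = if c = d ∧ p = q then 1 else 0 := by
  simp [ket, Pi.single_apply, Prod.ext_iff, eq_comm]

theorem spatial_ket_apply {n m : ℕ} (C : Matrix (Fin m) (Fin n) ℂ) (c d : Pol) (p : Fin n)
    (q : Fin m) : spatial C (ket c p) (d, q) = if c = d then C q p else 0 := by
  by_cases h : c = d <;> simp [ket_apply, Finset.sum_apply, h]

theorem spatial_injective {n m : ℕ} :
    Function.Injective (spatial : Matrix (Fin m) (Fin n) ℂ → State n →ₗ[ℂ] State m) := by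
  intro A B h
  ext q p
  have := congrFun (LinearMap.congr_fun h (ket .V p)) (.V, q)
  simpa [spatial_ket_apply] using this

theorem spatial_mul {n m k : ℕ} (A : Matrix (Fin k) (Fin m) ℂ) (B : Matrix (Fin m) (Fin n) ℂ) :
    spatial (A * B) = spatial A ∘ₗ spatial B := by
  refine state_hom_ext fun c p => ?_
  simp only [spatial_ket, LinearMap.comp_apply, map_sum, map_smul, Matrix.mul_apply,
    Finset.sum_smul, Finset.smul_sum, smul_smul]
  rw [Finset.sum_comm]
  simp only [mul_comm]

theorem spatial_one {n : ℕ} : spatial (1 : Matrix (Fin n) (Fin n) ℂ) = LinearMap.id := by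
  refine state_hom_ext fun c p => ?_
  simp [Matrix.one_apply]

theorem spatial_zero {n m : ℕ} : spatial (0 : Matrix (Fin m) (Fin n) ℂ) = 0 := by
  refine state_hom_ext fun c p => ?_
  simp

/-- The block diagonal matrix with blocks `A` and `B`. -/
def blockDiag {n m n' m' : ℕ} (A : Matrix (Fin m) (Fin n) ℂ) (B : Matrix (Fin m') (Fin n') ℂ) :
    Matrix (Fin (m + m')) (Fin (n + n')) ℂ :=
  (Matrix.fromBlocks A 0 0 B).submatrix finSumFinEquiv.symm finSumFinEquiv.symm

section blockDiag

variable {n m n' m' : ℕ} (A : Matrix (Fin m) (Fin n) ℂ) (B : Matrix (Fin m') (Fin n') ℂ)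

@[simp] theorem blockDiag_castAdd_castAdd (i : Fin m) (j : Fin n) :
    blockDiag A B (Fin.castAdd m' i) (Fin.castAdd n' j) = A i j := by simp [blockDiag]

@[simp] theorem blockDiag_castAdd_natAdd (i : Fin m) (j : Fin n') :
    blockDiag A B (Fin.castAdd m' i) (Fin.natAdd n j) = 0 := by simp [blockDiag]

@[simp] theorem blockDiag_natAdd_castAdd (i : Fin m') (j : Fin n) :
    blockDiag A B (Fin.natAdd m i) (Fin.castAdd n' j) = 0 := by simp [blockDiag]

@[simp] theorem blockDiag_natAdd_natAdd (i : Fin m') (j : Fin n') :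
    blockDiag A B (Fin.natAdd m i) (Fin.natAdd n j) = B i j := by simp [blockDiag]

theorem directSum_spatial : directSum (spatial A) (spatial B) = spatial (blockDiag A B) := by
  refine state_hom_ext fun c p => ?_
  refine Fin.addCases (fun i => ?_) (fun i => ?_) p <;>
    simp [Fin.sum_univ_add]

theorem blockDiag_one : blockDiag (1 : Matrix (Fin n) (Fin n) ℂ) (1 : Matrix (Fin m) (Fin m) ℂ) = 1 := by
  simp [blockDiag]

theorem blockDiag_mul {k k' : ℕ} (A' : Matrix (Fin n) (Fin k) ℂ) (B' : Matrix (Fin n') (Fin k') ℂ) :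
    blockDiag A B * blockDiag A' B' = blockDiag (A * A') (B * B') := by
  simp [blockDiag, Matrix.submatrix_mul_equiv, Matrix.fromBlocks_multiply]

theorem blockDiag_conjTranspose : (blockDiag A B).conjTranspose =
    blockDiag A.conjTranspose B.conjTranspose := by
  simp [blockDiag, Matrix.conjTranspose_submatrix, Matrix.fromBlocks_conjTranspose]

end blockDiag

/-- The matrix of a phase shifter. -/
def phaseMat (φ : ℝ) : Matrix (Fin 1) (Fin 1) ℂ := !![Complex.exp (Complex.I * φ)]

/-- The matrix of a beam splitter. -/
def bsMat (θ : ℝ) : Matrix (Fin 2) (Fin 2) ℂ :=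
  !![(Real.cos θ : ℂ), Complex.I * Real.sin θ; Complex.I * Real.sin θ, (Real.cos θ : ℂ)]

theorem interp_phase (φ : ℝ) : interp (phase φ) = spatial (phaseMat φ) := by
  refine state_hom_ext fun c p => ?_
  fin_cases p
  simp [interp, phaseMat]

theorem interp_bs (θ : ℝ) : interp (bs θ) = spatial (bsMat θ) := by
  refine state_hom_ext fun c p => ?_
  fin_cases p
  · simp [interp, bsMat, Fin.sum_univ_two]
  · simp [interp, bsMat, Fin.sum_univ_two]
    abel

/-! ### Restriction to horizontally polarised photons -/

theorem hInj_single {n : ℕ} (p : Fin n) : hInj n (Pi.single p 1) = ket .H p := by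
  have := (Pi.basisFun ℂ (Fin n)).constr_basis ℂ (fun k => (ket .H k : State n)) p
  rwa [Pi.basisFun_apply] at this

theorem hInj_apply {n : ℕ} (v : Fin n → ℂ) (q : Fin n) : hInj n v (.H, q) = v q := by
  have : LinearMap.proj (Pol.H, q) ∘ₗ hInj n = LinearMap.proj q := by
    refine (Pi.basisFun ℂ (Fin n)).ext fun p => ?_
    rw [Pi.basisFun_apply]
    simp [hInj_single, ket_apply, Pi.single_apply, eq_comm]
  exact LinearMap.congr_fun this v

/-- `spatial C` restricts to `C` on horizontally polarised photons. -/
theorem spatial_comp_hInj {n m : ℕ} (C : Matrix (Fin m) (Fin n) ℂ) :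
    spatial C ∘ₗ hInj n = hInj m ∘ₗ C.mulVecLin := by
  refine (Pi.basisFun ℂ (Fin n)).ext fun p => ?_
  rw [Pi.basisFun_apply, LinearMap.comp_apply, LinearMap.comp_apply, hInj_single]
  have : C.mulVecLin (Pi.single p 1) = ∑ q, C q p • Pi.single q 1 := by
    ext q; simp [Finset.sum_apply, Pi.single_apply]
  rw [this, map_sum, spatial_ket]
  simp [hInj_single]

/-- The Euler axiom only compares horizontal photons. Both of its sides act independently of the
polarisation, so this comparison already decides equality of the full semantics. -/
theorem eq_of_isHSemantics {n m : ℕ} {D₁ D₂ : Circuit n m} {C₁ C₂ : Matrix (Fin m) (Fin n) ℂ}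
    {U : (Fin n → ℂ) →ₗ[ℂ] (Fin m → ℂ)} (h₁ : interp D₁ = spatial C₁) (h₂ : interp D₂ = spatial C₂)
    (hU₁ : IsHSemantics D₁ U) (hU₂ : IsHSemantics D₂ U) : C₁ = C₂ := by
  unfold IsHSemantics at hU₁ hU₂
  have h := hU₁.trans hU₂.symm
  rw [h₁, h₂, spatial_comp_hInj, spatial_comp_hInj] at h
  ext q p
  have h' := congrFun (LinearMap.congr_fun h (Pi.single p 1)) (.H, q)
  simpa [hInj_apply] using h'

/-- The matrix of the left-hand side of the Euler equation. -/
def eulerLeftMat (θ₁ θ₂ θ₃ φ₁ φ₂ : ℝ) : Matrix (Fin 3) (Fin 3) ℂ :=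
  blockDiag (n := 2) (m := 2) (bsMat θ₃) (1 : Matrix (Fin 1) (Fin 1) ℂ) *
    (blockDiag (n := 1) (m := 1) (1 : Matrix (Fin 1) (Fin 1) ℂ) (bsMat θ₂) *
    ((blockDiag (blockDiag (phaseMat φ₂) (phaseMat φ₁)) (1 : Matrix (Fin 1) (Fin 1) ℂ) *
    blockDiag (n := 2) (m := 2) (bsMat θ₁) (1 : Matrix (Fin 1) (Fin 1) ℂ))))

/-- The matrix of the right-hand side of the Euler equation. -/
def eulerRightMat (α₁ α₂ α₃ β₁ β₂ β₃ β₄ β₅ β₆ : ℝ) : Matrix (Fin 3) (Fin 3) ℂ :=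
  blockDiag (blockDiag (phaseMat β₄) (phaseMat β₅)) (phaseMat β₆) *
  (blockDiag (n := 1) (m := 1) (1 : Matrix (Fin 1) (Fin 1) ℂ) (bsMat α₃) *
  (blockDiag (blockDiag (1 : Matrix (Fin 1) (Fin 1) ℂ) (phaseMat β₃)) (1 : Matrix (Fin 1) (Fin 1) ℂ) *
  (blockDiag (n := 2) (m := 2) (bsMat α₂) (1 : Matrix (Fin 1) (Fin 1) ℂ) *
  (blockDiag (blockDiag (phaseMat β₂) (1 : Matrix (Fin 1) (Fin 1) ℂ)) (1 : Matrix (Fin 1) (Fin 1) ℂ) *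
  (blockDiag (n := 1) (m := 1) (1 : Matrix (Fin 1) (Fin 1) ℂ) (bsMat α₁) *
  blockDiag (blockDiag (1 : Matrix (Fin 1) (Fin 1) ℂ) (phaseMat β₁)) (1 : Matrix (Fin 1) (Fin 1) ℂ))))))

theorem interp_wire : interp wire = spatial 1 := by rw [spatial_one]; rfl

theorem interp_eulerLeft (θ₁ θ₂ θ₃ φ₁ φ₂ : ℝ) :
    interp (eulerLeft θ₁ θ₂ θ₃ φ₁ φ₂) = spatial (eulerLeftMat θ₁ θ₂ θ₃ φ₁ φ₂) := by
  simp only [eulerLeft, eulerLeftMat, onTop, onBottom, par3, interp_seq, interp_par, interp_wire,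
    interp_bs, interp_phase, directSum_spatial, spatial_mul]

theorem interp_eulerRight (α₁ α₂ α₃ β₁ β₂ β₃ β₄ β₅ β₆ : ℝ) :
    interp (eulerRight α₁ α₂ α₃ β₁ β₂ β₃ β₄ β₅ β₆) =
      spatial (eulerRightMat α₁ α₂ α₃ β₁ β₂ β₃ β₄ β₅ β₆) := by
  simp only [eulerRight, eulerRightMat, onTop, onBottom, par3, interp_seq, interp_par, interp_wire,
    interp_bs, interp_phase, directSum_spatial, spatial_mul]

/-! ## Soundness of the axioms -/

theorem interp_neg : interp neg = linearOn fun c p => ket c.flip p := by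
  refine state_hom_ext fun c p => ?_
  have h : Complex.exp (-(Complex.I * (Real.pi / 2))) = -Complex.I := by
    rw [mul_comm, Complex.exp_neg, Complex.exp_pi_div_two_mul_I, Complex.inv_I]
  simp [neg, interp, smul_smul, h]

theorem interp_waveplate_ket (θ : ℝ) (c : Pol) (p : Fin 1) : interp (waveplate θ) (ket c p) =
    (Real.cos θ : ℂ) • ket c p + (Complex.I * Real.sin θ) • ket c.flip p := by
  simp [interp]

theorem interp_phase_ket (φ : ℝ) (c : Pol) (p : Fin 1) : interp (phase φ) (ket c p) =
    Complex.exp (Complex.I * φ) • ket c p := by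
  simp [interp]

theorem interp_bs_ket (θ : ℝ) (c : Pol) (p : Fin 2) : interp (bs θ) (ket c p) =
    (Real.cos θ : ℂ) • ket c p + (Complex.I * Real.sin θ) • ket c (1 - p) := by
  simp [interp]

theorem interp_pbs_ket (c : Pol) (p : Fin 2) :
    interp pbs (ket c p) = ket c (match c with | .V => p | .H => 1 - p) := by
  cases c <;> simp [interp]

theorem interp_par_ket_zero (D D' : Circuit 1 1) (c : Pol) :
    interp (D ⊕ᶜ D') (ket c 0) = relabel (fun _ => 0) (interp D (ket c 0)) := by
  have := directSum_ket_castAdd (interp D) (interp D') c 0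
  rw [interp_par]
  refine this.trans ?_
  congr 2; funext i; fin_cases i; rfl

theorem interp_par_ket_one (D D' : Circuit 1 1) (c : Pol) :
    interp (D ⊕ᶜ D') (ket c 1) = relabel (fun _ => 1) (interp D' (ket c 0)) := by
  have := directSum_ket_natAdd (interp D) (interp D') c 0
  rw [interp_par]
  refine this.trans ?_
  congr 2; funext i; fin_cases i; rfl

theorem state_two_hom_ext {E : Type*} [AddCommMonoid E] [Module ℂ E]
    {f g : State 2 →ₗ[ℂ] E} (h₀ : ∀ c, f (ket c 0) = g (ket c 0))
    (h₁ : ∀ c, f (ket c 1) = g (ket c 1)) : f = g :=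
  state_hom_ext fun c p => by fin_cases p; exacts [h₀ c, h₁ c]

theorem interp_swap_ket_zero (c : Pol) : interp (swap 1 1) (ket c (0 : Fin 2)) = ket c (1 : Fin 2) := by
  rw [interp_swap, relabel_ket]; rfl

theorem interp_swap_ket_one (c : Pol) : interp (swap 1 1) (ket c (1 : Fin 2)) = ket c (0 : Fin 2) := by
  rw [interp_swap, relabel_ket]; rfl

theorem interp_onTop_ket_zero (D : Circuit 2 2) (c : Pol) :
    interp (onTop D) (ket c 0) = relabel Fin.castSucc (interp D (ket c 0)) :=
  directSum_ket_castAdd (interp D) (interp wire) c 0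

theorem interp_onTop_ket_one (D : Circuit 2 2) (c : Pol) :
    interp (onTop D) (ket c 1) = relabel Fin.castSucc (interp D (ket c 1)) :=
  directSum_ket_castAdd (interp D) (interp wire) c 1

theorem interp_onTop_ket_two (D : Circuit 2 2) (c : Pol) :
    interp (onTop D) (ket c 2) = ket c 2 := by
  have := directSum_ket_natAdd (interp D) (interp wire) c 0
  refine this.trans ?_
  rw [interp_id, LinearMap.id_apply, relabel_ket]; rfl

theorem interp_onBottom_ket_zero (D : Circuit 2 2) (c : Pol) :
    interp (onBottom D) (ket c 0) = ket c 0 := by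
  have := directSum_ket_castAdd (interp wire) (interp D) c 0
  refine this.trans ?_
  rw [interp_id, LinearMap.id_apply, relabel_ket]; rfl

theorem relabel_natAdd_one (v : State 2) :
    relabel (Fin.natAdd 1 : Fin 2 → Fin (1 + 2)) v = relabel (fun p => (p.succ : Fin 3)) v := by
  congr 2; funext i; fin_cases i <;> rfl

theorem interp_onBottom_ket_one (D : Circuit 2 2) (c : Pol) :
    interp (onBottom D) (ket c 1) = relabel (fun p => (p.succ : Fin 3)) (interp D (ket c 0)) :=
  (directSum_ket_natAdd (interp wire) (interp D) c 0).trans (relabel_natAdd_one _)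

theorem interp_onBottom_ket_two (D : Circuit 2 2) (c : Pol) :
    interp (onBottom D) (ket c 2) = relabel (fun p => (p.succ : Fin 3)) (interp D (ket c 1)) :=
  (directSum_ket_natAdd (interp wire) (interp D) c 1).trans (relabel_natAdd_one _)

instance : Subsingleton (State 0) := ⟨fun _ _ => funext fun x => x.2.elim0⟩

theorem state_three_hom_ext {E : Type*} [AddCommMonoid E] [Module ℂ E]
    {f g : State 3 →ₗ[ℂ] E} (h₀ : ∀ c, f (ket c 0) = g (ket c 0))
    (h₁ : ∀ c, f (ket c 1) = g (ket c 1)) (h₂ : ∀ c, f (ket c 2) = g (ket c 2)) : f = g :=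
  state_hom_ext fun c p => by fin_cases p; exacts [h₀ c, h₁ c, h₂ c]

theorem hom_eq_of_zero_left {n : ℕ} (f g : State 0 →ₗ[ℂ] State n) : f = g :=
  state_hom_ext fun _ p => p.elim0

theorem hom_eq_of_zero_right {n : ℕ} (f g : State n →ₗ[ℂ] State 0) : f = g :=
  LinearMap.ext fun _ => Subsingleton.elim _ _

theorem interp_eq_of_axiom {n m : ℕ} {D₁ D₂ : Circuit n m} (h : LOvAxiom D₁ D₂) :
    interp D₁ = interp D₂ := by
  cases h with
  | phase_add φ₁ φ₂ =>
    refine state_hom_ext fun c p => ?_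
    simp [interp_seq, interp_phase_ket, smul_smul, ← Complex.exp_add]
    ring_nf
  | phase_zero =>
    refine state_hom_ext fun c p => ?_
    simp [interp_phase_ket, interp_id]
  | bs_zero =>
    refine state_two_hom_ext (fun c => ?_) (fun c => ?_) <;>
    simp [interp_bs_ket, interp_par_ket_zero, interp_par_ket_one, interp_id]
  | neg_pbs_neg =>
    refine state_two_hom_ext (fun c => ?_) (fun c => ?_) <;> cases c <;>
    simp [interp_seq, interp_par_ket_zero, interp_par_ket_one, interp_neg, interp_pbs_ket, Pol.flip,
      interp_swap_ket_zero, interp_swap_ket_one]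
  | pbs_pbs =>
    refine state_two_hom_ext (fun c => ?_) (fun c => ?_) <;> cases c <;>
    simp [interp_seq, interp_par_ket_zero, interp_par_ket_one, interp_pbs_ket, interp_id]
  | pbs_pbs_pbs =>
    refine state_three_hom_ext (fun c => ?_) (fun c => ?_) (fun c => ?_) <;> cases c <;>
    simp [interp_seq, interp_onTop_ket_zero, interp_onTop_ket_one, interp_onTop_ket_two,
      interp_onBottom_ket_zero, interp_onBottom_ket_one, interp_onBottom_ket_two, interp_pbs_ket,
      interp_swap_ket_zero, interp_swap_ket_one]
  | pbs_neg_pbs =>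
    refine state_two_hom_ext (fun c => ?_) (fun c => ?_) <;> cases c <;>
    simp [interp_seq, interp_par_ket_zero, interp_par_ket_one, interp_neg, interp_pbs_ket, Pol.flip,
      interp_id]
  | source_detector => exact hom_eq_of_zero_left _ _
  | source_phase φ => exact hom_eq_of_zero_left _ _
  | source_waveplate θ => exact hom_eq_of_zero_left _ _
  | source_pbs => exact hom_eq_of_zero_left _ _
  | phase_detector φ => exact hom_eq_of_zero_right _ _
  | waveplate_detector θ => exact hom_eq_of_zero_right _ _
  | pbs_detector => exact hom_eq_of_zero_right _ _
  | phase_waveplate φ =>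
    refine state_hom_ext fun c p => ?_
    simp [interp_seq, interp_phase_ket, interp_waveplate_ket, smul_smul, mul_comm]
  | phase_pbs φ =>
    refine state_two_hom_ext (fun c => ?_) (fun c => ?_) <;> cases c <;>
    simp [interp_seq, interp_par_ket_zero, interp_par_ket_one, interp_pbs_ket, interp_phase_ket]
  | bs_waveplate θ =>
    refine state_two_hom_ext (fun c => ?_) (fun c => ?_) <;> cases c <;>
    simp [interp_seq, interp_par_ket_zero, interp_par_ket_one, interp_neg, interp_pbs_ket, Pol.flip,
      interp_id, interp_waveplate_ket, interp_bs_ket]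
  | euler θ₁ θ₂ θ₃ φ₁ φ₂ α₁ α₂ α₃ β₁ β₂ β₃ β₄ β₅ β₆ _ U hleft hright =>
    rw [interp_eulerLeft, interp_eulerRight,
      eq_of_isHSemantics (interp_eulerLeft ..) (interp_eulerRight ..) hleft hright]

theorem interp_eq_of_derivable {n m : ℕ} {D₁ D₂ : Circuit n m} (h : Derivable D₁ D₂) :
    interp D₁ = interp D₂ := by
  induction h with
  | prop h => exact interp_eq_of_propAxiom h
  | ax h => exact interp_eq_of_axiom h
  | refl => rfl
  | symm _ ih => exact ih.symm
  | trans _ _ ih ih' => exact ih.trans ih'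
  | seq _ _ ih ih' => rw [interp_seq, interp_seq, ih, ih']
  | par _ _ ih ih' => rw [interp_par, interp_par, ih, ih']

end Soundness

/-! ## The PROP of circuits modulo the equational theory -/

/-- In the quotient, derivability becomes equality, so equational proofs can be carried out by
rewriting; soundness makes the semantics well defined there. -/
instance derivableSetoid (n m : ℕ) : Setoid (Circuit n m) :=
  ⟨Derivable, Derivable.refl, Derivable.symm, Derivable.trans⟩

/-- Circuits modulo the equational theory. -/
def Mor (n m : ℕ) : Type := Quotient (derivableSetoid n m)

namespace Mor

/-- The class of a circuit. -/
def mk {n m : ℕ} (D : Circuit n m) : Mor n m := Quotient.mk _ D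

theorem mk_eq_mk {n m : ℕ} {D₁ D₂ : Circuit n m} : mk D₁ = mk D₂ ↔ Derivable D₁ D₂ :=
  Quotient.eq

theorem ind {n m : ℕ} {P : Mor n m → Prop} (h : ∀ D, P (mk D)) (f : Mor n m) : P f :=
  Quotient.ind h f

/-- Sequential composition. -/
def seq {n m k : ℕ} : Mor n m → Mor m k → Mor n k :=
  Quotient.map₂ Circuit.seq fun _ _ h _ _ h' => Derivable.seq h h'

/-- Parallel composition. -/
def par {n m n' m' : ℕ} : Mor n m → Mor n' m' → Mor (n + n') (m + m') :=
  Quotient.map₂ Circuit.par fun _ _ h _ _ h' => Derivable.par h h'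

/-- Semantics. -/
def sem {n m : ℕ} : Mor n m → (State n →ₗ[ℂ] State m) :=
  Quotient.lift interp fun _ _ h => interp_eq_of_derivable h

/-- Transport along equalities between numbers of wires. -/
def cast {n m n' m' : ℕ} (hn : n = n') (hm : m = m') (f : Mor n m) : Mor n' m' :=
  hn ▸ hm ▸ f

/-- The identity. -/
def id (n : ℕ) : Mor n n := mk (Circuit.id n)
/-- The symmetry. -/
def swap (n m : ℕ) : Mor (n + m) (m + n) := mk (Circuit.swap n m)
/-- The vacuum source. -/
def source : Mor 0 1 := mk Circuit.source
/-- The vacuum detector. -/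
def detector : Mor 1 0 := mk Circuit.detector
/-- The phase shifter. -/
def phase (φ : ℝ) : Mor 1 1 := mk (Circuit.phase φ)
/-- The wave plate. -/
def waveplate (θ : ℝ) : Mor 1 1 := mk (Circuit.waveplate θ)
/-- The beam splitter. -/
def bs (θ : ℝ) : Mor 2 2 := mk (Circuit.bs θ)
/-- The polarising beam splitter. -/
def pbs : Mor 2 2 := mk Circuit.pbs
/-- The negation. -/
def neg : Mor 1 1 := mk Circuit.neg
/-- The swap of two wires. -/
def swap₂ : Mor 2 2 := swap 1 1

end Mor

local infixl:65 " ⬝ " => Mor.seq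
local infixl:70 " ⊠ " => Mor.par

namespace Mor

theorem mk_seq {n m k : ℕ} (D₁ : Circuit n m) (D₂ : Circuit m k) :
    mk (D₁ ⨟ D₂) = mk D₁ ⬝ mk D₂ := rfl

theorem mk_cast {n m n' m' : ℕ} (hn : n = n') (hm : m = m') (D : Circuit n m) :
    mk (D.cast hn hm) = cast hn hm (mk D) := by
  subst hn hm; rfl

theorem mk_eq_of_propAxiom {n m : ℕ} {D₁ D₂ : Circuit n m} (h : PropAxiom D₁ D₂) :
    mk D₁ = mk D₂ := mk_eq_mk.2 (.prop h)

theorem mk_eq_of_axiom {n m : ℕ} {D₁ D₂ : Circuit n m} (h : LOvAxiom D₁ D₂) :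
    mk D₁ = mk D₂ := mk_eq_mk.2 (.ax h)

section

variable {n m k l n' m' k' n'' m'' : ℕ}

@[simp] theorem id_seq (f : Mor n m) : id n ⬝ f = f := by
  induction f using ind with | h D => exact mk_eq_of_propAxiom (.id_seq D)

@[simp] theorem seq_id (f : Mor n m) : f ⬝ id m = f := by
  induction f using ind with | h D => exact mk_eq_of_propAxiom (.seq_id D)

theorem seq_assoc (f : Mor n m) (g : Mor m k) (h : Mor k l) : f ⬝ g ⬝ h = f ⬝ (g ⬝ h) := by
  induction f using ind with | h D₁
  induction g using ind with | h D₂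
  induction h using ind with | h D₃
  exact mk_eq_of_propAxiom (.seq_assoc D₁ D₂ D₃)

theorem cast_empty_par (f : Mor n m) :
    cast (Nat.zero_add n) (Nat.zero_add m) (id 0 ⊠ f) = f := by
  induction f using ind with | h D
  exact (mk_cast _ _ _).symm.trans (mk_eq_of_propAxiom (.empty_par D))

-- No cast is needed on this side, since `n + 0` reduces to `n` whereas `0 + n` does not.
@[simp] theorem par_empty (f : Mor n m) : f ⊠ id 0 = f := by
  induction f using ind with | h D
  exact mk_eq_of_propAxiom (.par_empty D)

theorem cast_par_assoc (f : Mor n m) (g : Mor n' m') (h : Mor n'' m'') :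
    cast (Nat.add_assoc n n' n'') (Nat.add_assoc m m' m'') (f ⊠ g ⊠ h) = f ⊠ (g ⊠ h) := by
  induction f using ind with | h D₁
  induction g using ind with | h D₂
  induction h using ind with | h D₃
  exact (mk_cast _ _ _).symm.trans (mk_eq_of_propAxiom (.par_assoc D₁ D₂ D₃))

@[simp] theorem par_id (n m : ℕ) : id n ⊠ id m = id (n + m) :=
  mk_eq_of_propAxiom (.par_id n m)

theorem par_seq_par (f : Mor n m) (g : Mor n' m') (f' : Mor m k) (g' : Mor m' k') :
    (f ⊠ g) ⬝ (f' ⊠ g') = (f ⬝ f') ⊠ (g ⬝ g') := by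
  induction f using ind with | h D₁
  induction g using ind with | h D₂
  induction f' using ind with | h D₃
  induction g' using ind with | h D₄
  exact (mk_eq_of_propAxiom (.interchange D₁ D₃ D₂ D₄)).symm

theorem swap_swap (n m : ℕ) : swap n m ⬝ swap m n = id (n + m) :=
  mk_eq_of_propAxiom (.swap_swap n m)

theorem par_seq_swap (f : Mor n m) (g : Mor n' m') :
    (f ⊠ g) ⬝ swap m m' = swap n n' ⬝ (g ⊠ f) := by
  induction f using ind with | h D₁
  induction g using ind with | h D₂
  exact mk_eq_of_propAxiom (.swap_natural D₁ D₂)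

theorem cast_swap_zero (n : ℕ) : cast rfl (Nat.zero_add n) (swap n 0) = id n :=
  (mk_cast _ _ _).symm.trans (mk_eq_of_propAxiom (.swap_empty n))

theorem cast_swap_add (n m k : ℕ) :
    cast (Nat.add_assoc n m k).symm (Nat.add_assoc m k n) (swap n (m + k)) =
      cast rfl (Nat.add_assoc m n k) (swap n m ⊠ id k) ⬝ (id m ⊠ swap n k) := by
  have := mk_eq_of_propAxiom (.swap_add n m k)
  rwa [mk_cast, mk_seq, mk_cast] at this

/-! Associativity and unit laws for casts that hold by computation. -/

theorem par_par_one (f : Mor n m) (g : Mor n' m') (h : Mor 1 1) :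
    f ⊠ (g ⊠ h) = f ⊠ g ⊠ h := (cast_par_assoc f g h).symm

theorem par_par_two (f : Mor n m) (g : Mor n' m') (h : Mor 2 2) :
    f ⊠ (g ⊠ h) = f ⊠ g ⊠ h := (cast_par_assoc f g h).symm

theorem par_par_source (f : Mor n m) (g : Mor n' m') (h : Mor 0 1) :
    f ⊠ (g ⊠ h) = f ⊠ g ⊠ h := (cast_par_assoc f g h).symm

theorem par_par_detector (f : Mor n m) (g : Mor n' m') (h : Mor 1 0) :
    f ⊠ (g ⊠ h) = f ⊠ g ⊠ h := (cast_par_assoc f g h).symm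

theorem seq_id_par_comm (f : Mor n m) (g : Mor n' m') :
    (f ⊠ id n') ⬝ (id m ⊠ g) = (id n ⊠ g) ⬝ (f ⊠ id m') := by
  simp [par_seq_par]

theorem sem_seq (f : Mor n m) (g : Mor m k) : sem (f ⬝ g) = sem g ∘ₗ sem f := by
  induction f using ind with | h D₁
  induction g using ind with | h D₂
  rfl

theorem sem_par (f : Mor n m) (g : Mor n' m') : sem (f ⊠ g) = directSum (sem f) (sem g) := by
  induction f using ind with | h D₁
  induction g using ind with | h D₂
  rfl

theorem sem_id (n : ℕ) : sem (id n) = LinearMap.id := rfl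

end

/-- A two-wire morphism on the top two of three wires. -/
def onTop (f : Mor 2 2) : Mor 3 3 := par (n := 2) (m := 2) (n' := 1) (m' := 1) f (id 1)

/-- A two-wire morphism on the bottom two of three wires. -/
def onBottom (f : Mor 2 2) : Mor 3 3 := par (n := 1) (m := 1) (n' := 2) (m' := 2) (id 1) f

/-! ## Derived equations -/

theorem phase_add (a b : ℝ) : phase a ⬝ phase b = phase (a + b) := mk_eq_of_axiom (.phase_add a b)
@[simp] theorem phase_zero : phase 0 = id 1 := mk_eq_of_axiom .phase_zero
@[simp] theorem bs_zero : bs 0 = id 2 := (mk_eq_of_axiom .bs_zero).trans (par_id 1 1)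
theorem pbs_pbs : pbs ⬝ pbs = id 2 := (mk_eq_of_axiom .pbs_pbs).trans (par_id 1 1)
theorem source_detector : source ⬝ detector = id 0 := mk_eq_of_axiom .source_detector
theorem source_phase (φ : ℝ) : source ⬝ phase φ = source := mk_eq_of_axiom (.source_phase φ)
theorem source_waveplate (θ : ℝ) : source ⬝ waveplate θ = source :=
  mk_eq_of_axiom (.source_waveplate θ)
theorem source_pbs : (source ⊠ source) ⬝ pbs = source ⊠ source := mk_eq_of_axiom .source_pbs
theorem phase_detector (φ : ℝ) : phase φ ⬝ detector = detector := mk_eq_of_axiom (.phase_detector φ)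
theorem waveplate_detector (θ : ℝ) : waveplate θ ⬝ detector = detector :=
  mk_eq_of_axiom (.waveplate_detector θ)
theorem pbs_detector : pbs ⬝ (detector ⊠ detector) = detector ⊠ detector :=
  mk_eq_of_axiom .pbs_detector
theorem neg_def : neg = waveplate (Real.pi / 2) ⬝ phase (-(Real.pi / 2)) := rfl
theorem neg_pbs_neg : (neg ⊠ neg) ⬝ pbs ⬝ (neg ⊠ neg) = pbs ⬝ swap₂ := mk_eq_of_axiom .neg_pbs_neg
theorem pbs_neg_pbs : pbs ⬝ (neg ⊠ id 1) ⬝ pbs = (neg ⊠ id 1) ⬝ pbs ⬝ (neg ⊠ id 1) :=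
  mk_eq_of_axiom .pbs_neg_pbs
theorem pbs_pbs_pbs : onTop pbs ⬝ onBottom pbs ⬝ onTop pbs =
    onTop swap₂ ⬝ onBottom pbs ⬝ onTop swap₂ := mk_eq_of_axiom .pbs_pbs_pbs
theorem phase_waveplate (φ : ℝ) :
    phase φ ⬝ waveplate (Real.pi / 2) = waveplate (Real.pi / 2) ⬝ phase φ :=
  mk_eq_of_axiom (.phase_waveplate φ)
theorem phase_pbs (φ : ℝ) : (phase φ ⊠ phase φ) ⬝ pbs = pbs ⬝ (phase φ ⊠ phase φ) :=
  mk_eq_of_axiom (.phase_pbs φ)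
theorem bs_waveplate (θ : ℝ) : bs θ =
    (id 1 ⊠ neg) ⬝ pbs ⬝ (waveplate θ ⊠ waveplate θ) ⬝ pbs ⬝ (id 1 ⊠ neg) :=
  mk_eq_of_axiom (.bs_waveplate θ)
theorem swap₂_swap₂ : swap₂ ⬝ swap₂ = id 2 := swap_swap 1 1

theorem phase_comm (a b : ℝ) : phase a ⬝ phase b = phase b ⬝ phase a := by
  rw [phase_add, phase_add, add_comm]

theorem phase_neg_comm (φ : ℝ) : phase φ ⬝ neg = neg ⬝ phase φ := by
  rw [neg_def, ← seq_assoc, phase_waveplate, seq_assoc, seq_assoc, phase_comm]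

theorem source_neg : source ⬝ neg = source := by
  rw [neg_def, ← seq_assoc, source_waveplate, source_phase]

theorem neg_detector : neg ⬝ detector = detector := by
  rw [neg_def, seq_assoc, phase_detector, waveplate_detector]

/-- Plugging a source and a detector on an idle last wire removes the wire. -/
theorem pad_injective {n m : ℕ} {f g : Mor n m} (h : f ⊠ id 1 = g ⊠ id 1) : f = g := by
  have key (f : Mor n m) : (id n ⊠ source) ⬝ (f ⊠ id 1) ⬝ (id m ⊠ detector) = f := by
    rw [par_seq_par, par_seq_par]; simp [source_detector]
  rw [← key f, ← key g, h]

theorem seq_cancel {n m k : ℕ} {a : Mor n m} {b : Mor m n} (h : a ⬝ b = id n) (f : Mor n k) :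
    a ⬝ (b ⬝ f) = f := by rw [← seq_assoc, h, id_seq]

/-- By `neg_pbs_neg`, `neg ⊠ neg` has a right inverse, because `pbs ⬝ swap₂` is invertible. Closing
the second wire with a source, which absorbs its `neg`, and with a detector leaves a right inverse
of `neg` itself. -/
theorem exists_neg_inverse : ∃ r : Mor 1 1, neg ⬝ r = id 1 := by
  have h : (neg ⊠ neg) ⬝ (pbs ⬝ ((neg ⊠ neg) ⬝ (swap₂ ⬝ pbs))) = id 2 := by
    have := congrArg (· ⬝ (swap₂ ⬝ pbs)) neg_pbs_neg
    simp only [seq_assoc] at this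
    rw [this, seq_cancel swap₂_swap₂, pbs_pbs]
  refine ⟨(id 1 ⊠ source) ⬝ (pbs ⬝ ((neg ⊠ neg) ⬝ (swap₂ ⬝ pbs))) ⬝ (id 1 ⊠ detector), ?_⟩
  have h' : neg ⬝ (id 1 ⊠ source) = (id 1 ⊠ source) ⬝ (neg ⊠ neg) := by
    have := par_seq_par neg (id 0) (id 1) source
    rw [par_empty] at this
    refine this.trans ?_
    rw [par_seq_par]; simp [source_neg]
  rw [← seq_assoc, ← seq_assoc, h', seq_assoc (id 1 ⊠ source), h, seq_id, par_seq_par]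
  simp [source_detector]

/-- With `b = neg ⊠ id 1`, the relation `pbs ⬝ b ⬝ pbs = b ⬝ pbs ⬝ b` and `pbs ⬝ pbs = id 2` give `b
⬝ b ⬝ pbs ⬝ b = pbs ⬝ b`. The right inverse cancels the last `b`, and then `pbs` cancels. -/
theorem neg_neg : neg ⬝ neg = id 1 := by
  obtain ⟨r, hr⟩ := exists_neg_inverse
  apply pad_injective
  set b : Mor 2 2 := neg ⊠ id 1 with hb
  have hbr : b ⬝ (r ⊠ id 1) = id 2 := by
    rw [hb, par_seq_par, hr, id_seq]; exact par_id 1 1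
  have h1 : pbs ⬝ b ⬝ pbs = b ⬝ pbs ⬝ b := pbs_neg_pbs
  have h2 : b ⬝ b ⬝ pbs ⬝ b = pbs ⬝ b := by
    rw [seq_assoc b b, seq_assoc b (b ⬝ pbs), ← h1, ← seq_assoc, ← seq_assoc, ← h1, seq_assoc,
      pbs_pbs, seq_id]
  have h3 : b ⬝ b ⬝ pbs = pbs := by
    have := congrArg (· ⬝ (r ⊠ id 1)) h2
    simpa only [seq_assoc, hbr, seq_id] using this
  have h4 : b ⬝ b = id 2 := by
    have := congrArg (· ⬝ pbs) h3
    simpa only [seq_assoc, pbs_pbs, seq_id] using this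
  rw [par_id 1 1, ← h4, hb, par_seq_par, id_seq]

theorem neg_par_neg_sq : (neg ⊠ neg) ⬝ (neg ⊠ neg) = id 2 := by
  rw [par_seq_par, neg_neg]; exact par_id 1 1

theorem swap₂_natural (f g : Mor 1 1) : (f ⊠ g) ⬝ swap₂ = swap₂ ⬝ (g ⊠ f) := par_seq_swap f g

/-- By `neg_pbs_neg`, `pbs ⬝ swap₂` is the conjugate of the involution `pbs` by the involution `neg
⊠ neg`, hence an involution. Two involutions whose product is an involution commute. -/
theorem pbs_swap₂ : pbs ⬝ swap₂ = swap₂ ⬝ pbs := by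
  have h : (pbs ⬝ swap₂) ⬝ (pbs ⬝ swap₂) = id 2 := by
    rw [← neg_pbs_neg]
    simp only [seq_assoc, seq_cancel neg_par_neg_sq, seq_cancel pbs_pbs]
    exact neg_par_neg_sq
  have := congrArg (· ⬝ (swap₂ ⬝ pbs)) h
  simpa only [seq_assoc, seq_cancel swap₂_swap₂, pbs_pbs, seq_id, id_seq] using this

theorem pbs_neg_neg_pbs : pbs ⬝ (neg ⊠ neg) ⬝ pbs = swap₂ ⬝ (neg ⊠ neg) := by
  have h : (neg ⊠ neg) ⬝ pbs = pbs ⬝ swap₂ ⬝ (neg ⊠ neg) := by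
    rw [← neg_pbs_neg, seq_assoc _ (neg ⊠ neg), neg_par_neg_sq, seq_id]
  rw [seq_assoc, h, ← seq_assoc, ← seq_assoc, pbs_pbs, id_seq]

theorem waveplate_pi_div_two : waveplate (Real.pi / 2) = neg ⬝ phase (Real.pi / 2) := by
  rw [neg_def, seq_assoc, phase_add]; simp

theorem phase_par_comm_id_par_neg (φ : ℝ) :
    (phase φ ⊠ phase φ) ⬝ (id 1 ⊠ neg) = (id 1 ⊠ neg) ⬝ (phase φ ⊠ phase φ) := by
  rw [par_seq_par, par_seq_par, phase_neg_comm, id_seq, seq_id]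

/-- The swap of two wires is a beam splitter up to phases. -/
theorem bs_pi_div_two : bs (Real.pi / 2) = swap₂ ⬝ (phase (Real.pi / 2) ⊠ phase (Real.pi / 2)) := by
  set p := phase (Real.pi / 2)
  have hn : (id 1 ⊠ neg) ⬝ swap₂ = swap₂ ⬝ (neg ⊠ id 1) := swap₂_natural _ _
  rw [bs_waveplate, waveplate_pi_div_two, ← par_seq_par]
  calc (id 1 ⊠ neg) ⬝ pbs ⬝ ((neg ⊠ neg) ⬝ (p ⊠ p)) ⬝ pbs ⬝ (id 1 ⊠ neg)
      = (id 1 ⊠ neg) ⬝ (pbs ⬝ (neg ⊠ neg) ⬝ pbs) ⬝ ((p ⊠ p) ⬝ (id 1 ⊠ neg)) := by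
        simp only [seq_assoc]; rw [← seq_assoc (p ⊠ p) pbs, phase_pbs, seq_assoc]
    _ = swap₂ ⬝ ((neg ⊠ id 1) ⬝ (neg ⊠ neg) ⬝ (id 1 ⊠ neg)) ⬝ (p ⊠ p) := by
        rw [pbs_neg_neg_pbs, phase_par_comm_id_par_neg, ← seq_assoc _ swap₂, hn]
        simp only [seq_assoc]
        rfl
    _ = swap₂ ⬝ (p ⊠ p) := by
        rw [par_seq_par, par_seq_par]; simp [neg_neg]

/-- The axioms do not state absorption of beam splitters, but sources absorb every factor of
`bs_waveplate` in turn. -/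
theorem source_source_bs (θ : ℝ) : (source ⊠ source) ⬝ bs θ = source ⊠ source := by
  have h (f g : Mor 1 1) (hf : source ⬝ f = source) (hg : source ⬝ g = source) (h : Mor 2 2) :
      (source ⊠ source) ⬝ ((f ⊠ g) ⬝ h) = (source ⊠ source) ⬝ h := by
    rw [← seq_assoc, par_seq_par, hf, hg]
  have h' (h : Mor 2 2) : (source ⊠ source) ⬝ (pbs ⬝ h) = (source ⊠ source) ⬝ h := by
    rw [← seq_assoc, source_pbs]
  rw [bs_waveplate]
  simp only [seq_assoc]
  rw [h _ _ (seq_id _) source_neg, h', h _ _ (source_waveplate _) (source_waveplate _), h',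
    par_seq_par, source_neg, seq_id]

theorem bs_detector_detector (θ : ℝ) : bs θ ⬝ (detector ⊠ detector) = detector ⊠ detector := by
  rw [bs_waveplate]
  simp only [seq_assoc]
  rw [par_seq_par, id_seq, neg_detector, pbs_detector, par_seq_par, waveplate_detector,
    pbs_detector, par_seq_par, id_seq, neg_detector]

/-! ### Matrices of polarisation-independent morphisms -/

theorem sem_phase (φ : ℝ) : sem (phase φ) = spatial (phaseMat φ) := interp_phase φ

theorem sem_bs (θ : ℝ) : sem (bs θ) = spatial (bsMat θ) := interp_bs θ

theorem sem_par_spatial {n m n' m' : ℕ} {f : Mor n m} {g : Mor n' m'}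
    {A : Matrix (Fin m) (Fin n) ℂ} {B : Matrix (Fin m') (Fin n') ℂ} (hf : sem f = spatial A)
    (hg : sem g = spatial B) : sem (f ⊠ g) = spatial (blockDiag A B) := by
  rw [sem_par, hf, hg, directSum_spatial]

theorem sem_seq_spatial {n m k : ℕ} {f : Mor n m} {g : Mor m k}
    {A : Matrix (Fin m) (Fin n) ℂ} {B : Matrix (Fin k) (Fin m) ℂ} (hf : sem f = spatial A)
    (hg : sem g = spatial B) : sem (f ⬝ g) = spatial (B * A) := by
  rw [sem_seq, hf, hg, spatial_mul]

theorem sem_id_spatial (n : ℕ) : sem (id n) = spatial 1 := by rw [sem_id, spatial_one]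

end Mor

section Euler

/-! ## Existence of Euler angles -/

open Complex Matrix

theorem blockDiag_mem_unitary {n m : ℕ} {A : Matrix (Fin n) (Fin n) ℂ}
    {B : Matrix (Fin m) (Fin m) ℂ} (hA : A ∈ unitaryGroup (Fin n) ℂ)
    (hB : B ∈ unitaryGroup (Fin m) ℂ) : blockDiag A B ∈ unitaryGroup (Fin (n + m)) ℂ := by
  rw [mem_unitaryGroup_iff, star_eq_conjTranspose] at *
  rw [blockDiag_conjTranspose, blockDiag_mul, hA, hB, blockDiag_one]

theorem phaseMat_mem_unitary (φ : ℝ) : phaseMat φ ∈ unitaryGroup (Fin 1) ℂ := by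
  rw [mem_unitaryGroup_iff, star_eq_conjTranspose]
  ext i j
  fin_cases i; fin_cases j
  simp [phaseMat, Matrix.mul_apply, ← Complex.exp_conj, ← Complex.exp_add]

theorem bsMat_mem_unitary (θ : ℝ) : bsMat θ ∈ unitaryGroup (Fin 2) ℂ := by
  have h : (Complex.cos θ) * Complex.cos θ + Complex.sin θ * Complex.sin θ = 1 := by
    have := Complex.cos_sq_add_sin_sq (θ : ℂ)
    linear_combination this
  have hc : (starRingEnd ℂ) (Complex.cos θ) = Complex.cos θ := by
    rw [← Complex.cos_conj, Complex.conj_ofReal]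
  have hs : (starRingEnd ℂ) (Complex.sin θ) = Complex.sin θ := by
    rw [← Complex.sin_conj, Complex.conj_ofReal]
  rw [mem_unitaryGroup_iff, star_eq_conjTranspose]
  ext i j
  fin_cases i <;> fin_cases j <;>
    simp [bsMat, Matrix.mul_apply, Fin.sum_univ_two, hc, hs]
  · linear_combination h - Complex.sin θ * Complex.sin θ * I_sq
  · ring
  · ring
  · linear_combination h - Complex.sin θ * Complex.sin θ * I_sq

/-- The matrix of a phase shifter on the first of two wires followed by a beam splitter. -/
def phasedBsMat (α β : ℝ) : Matrix (Fin 2) (Fin 2) ℂ :=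
  bsMat α * blockDiag (phaseMat β) (1 : Matrix (Fin 1) (Fin 1) ℂ)

theorem phasedBsMat_mem_unitary (α β : ℝ) : phasedBsMat α β ∈ unitaryGroup (Fin 2) ℂ :=
  mul_mem (bsMat_mem_unitary α) (blockDiag_mem_unitary (phaseMat_mem_unitary β) (one_mem _))

theorem blockDiag_one_one (A B : Matrix (Fin 1) (Fin 1) ℂ) :
    blockDiag A B = !![A 0 0, 0; 0, B 0 0] := by
  ext i j
  fin_cases i <;> fin_cases j
  exacts [blockDiag_castAdd_castAdd A B 0 0, blockDiag_castAdd_natAdd A B 0 0,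
    blockDiag_natAdd_castAdd A B 0 0, blockDiag_natAdd_natAdd A B 0 0]

theorem phasedBsMat_eq (α β : ℝ) : phasedBsMat α β =
    !![cos α * exp (I * β), I * sin α; I * sin α * exp (I * β), cos α] := by
  rw [phasedBsMat, blockDiag_one_one]
  ext i j
  fin_cases i <;> fin_cases j <;> simp [bsMat, phaseMat, Matrix.mul_apply, Fin.sum_univ_two]

/-- The conditions on one beam splitter of the right-hand side of the Euler equation, and the fact
that its inverse sends the row vector `(b, c)` to a row vector with vanishing second entry. -/
structure KillAngles (b c : ℂ) (α β : ℝ) : Prop where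
  hα : α ∈ Set.Ico 0 Real.pi
  hβ : β ∈ Set.Ico 0 Real.pi
  hβ_zero : α = 0 ∨ α = Real.pi / 2 → β = 0
  hα_zero : c = 0 → α = 0
  kill : b * star (phasedBsMat α β 1 0) + c * star (phasedBsMat α β 1 1) = 0

/-- For nonzero `b`, this reads `c / (I * b) = exp (-(I * β)) * tan α` when `cos α ≠ 0`: `β` carries
the argument modulo `π` and `α` the signed modulus. -/
theorem kill_iff (b c : ℂ) (α β : ℝ) :
    b * star (phasedBsMat α β 1 0) + c * star (phasedBsMat α β 1 1) = 0 ↔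
      c * cos α = I * b * exp (-(I * β)) * sin α := by
  have hc : (starRingEnd ℂ) (Complex.cos α) = Complex.cos α := by
    rw [← Complex.cos_conj, Complex.conj_ofReal]
  have hs : (starRingEnd ℂ) (Complex.sin α) = Complex.sin α := by
    rw [← Complex.sin_conj, Complex.conj_ofReal]
  have he : (starRingEnd ℂ) (exp (I * β)) = exp (-(I * β)) := by
    rw [← Complex.exp_conj]; simp
  rw [phasedBsMat_eq]
  simp [hc, hs, he]
  constructor <;> intro h <;> linear_combination h

/-- Restricting `β` to a half turn leaves an undetermined sign in the polar form of `c / (I * b)`;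
the tangent of `α` absorbs it, as `α` may exceed `π / 2`. -/
theorem exists_killAngles (b c : ℂ) : ∃ α β, KillAngles b c α β := by
  have hpi := Real.pi_pos
  by_cases hc : c = 0
  -- The condition `hα_zero` leaves no other choice of `α` here.
  · refine ⟨0, 0, ⟨le_rfl, hpi⟩, ⟨le_rfl, hpi⟩, fun _ => rfl, fun _ => rfl, ?_⟩
    rw [kill_iff]; simp [hc]
  by_cases hb : b = 0
  · refine ⟨Real.pi / 2, 0, ⟨by positivity, by linarith⟩, ⟨le_rfl, hpi⟩, fun _ => rfl,
      fun h => absurd h hc, ?_⟩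
    rw [kill_iff]
    simp [hb]
  obtain ⟨t, β, ht, hβ, hw⟩ : ∃ t β : ℝ, t ≠ 0 ∧ β ∈ Set.Ico 0 Real.pi ∧
      c / (I * b) = t * exp (-(I * β)) := by
    set w := c / (I * b) with hw
    have hw0 : w ≠ 0 := div_ne_zero hc (mul_ne_zero I_ne_zero hb)
    have hn : ‖w‖ ≠ 0 := norm_ne_zero_iff.2 hw0
    have hwe := Complex.norm_mul_exp_arg_mul_I w
    -- If `arg w ≤ 0`, then `-arg w` already lies in `[0, π)`. Otherwise a half turn is traded for
    -- the sign of `t`.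
    by_cases ha : w.arg ≤ 0
    · refine ⟨‖w‖, -w.arg, hn, ⟨by linarith, by linarith [Complex.neg_pi_lt_arg w]⟩, ?_⟩
      rw [← hwe]; congr 1
      · simp
      · congr 1
        rw [hwe]; push_cast; ring
    · refine ⟨-‖w‖, Real.pi - w.arg, neg_ne_zero.2 hn,
        ⟨by linarith [Complex.arg_le_pi w], by linarith⟩, ?_⟩
      have : exp (-(I * ((Real.pi - w.arg : ℝ) : ℂ))) = -exp (w.arg * I) := by
        have : -(I * ((Real.pi - w.arg : ℝ) : ℂ)) = w.arg * I - Real.pi * I := by push_cast; ring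
        rw [this, Complex.exp_sub_pi_mul_I]
      rw [this]; push_cast
      linear_combination -hwe
  have hc' : c = I * b * (t * exp (-(I * β))) := by
    rw [← hw]; field_simp
  -- Solve `tan α = t` in `[0, π)`. As `t` is nonzero and finite, `α` avoids `0` and `π / 2`, so the
  -- side condition on `β` is vacuous.
  obtain ⟨α, hα, hα0, hα2, hs⟩ : ∃ α ∈ Set.Ico 0 Real.pi, α ≠ 0 ∧ α ≠ Real.pi / 2 ∧
      Real.sin α = t * Real.cos α := by
    have key (x : ℝ) : Real.sin (Real.arctan x) = x * Real.cos (Real.arctan x) := by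
      have h := Real.tan_arctan x
      rw [Real.tan_eq_sin_div_cos, div_eq_iff (Real.cos_arctan_pos x).ne'] at h
      exact h
    rcases lt_or_gt_of_ne ht with h | h
    · have h1 : 0 < Real.arctan (-t) := by
        rw [← Real.arctan_zero]; exact Real.arctan_strictMono (by linarith)
      have h2 := Real.arctan_lt_pi_div_two (-t)
      refine ⟨Real.pi - Real.arctan (-t), ⟨by linarith, by linarith⟩, by linarith, by linarith, ?_⟩
      rw [Real.sin_pi_sub, Real.cos_pi_sub, key]; ring
    · have h1 : 0 < Real.arctan t := by
        rw [← Real.arctan_zero]; exact Real.arctan_strictMono h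
      have h2 := Real.arctan_lt_pi_div_two t
      exact ⟨Real.arctan t, ⟨h1.le, by linarith⟩, h1.ne', h2.ne, key t⟩
  refine ⟨α, β, hα, hβ, fun h => (h.elim hα0 hα2).elim, fun h => absurd h hc, ?_⟩
  rw [kill_iff]
  have hs' : sin α = t * cos α := by exact_mod_cast hs
  rw [hs']
  linear_combination (cos α) * hc'

/-- Converse of `hα_zero`; it yields the condition that `α₂ = 0` forces `α₁ = 0` among the Euler
angles. -/
theorem KillAngles.eq_zero {b c : ℂ} {β : ℝ} (h : KillAngles b c 0 β) : c = 0 := by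
  have := (kill_iff b c 0 β).1 h.kill
  simpa using this

theorem exists_phaseMat_eq {z : ℂ} (hz : ‖z‖ = 1) :
    ∃ φ ∈ Set.Ico 0 (2 * Real.pi), exp (I * φ) = z := by
  have hpi := Real.pi_pos
  have hwe := Complex.norm_mul_exp_arg_mul_I z
  rw [hz] at hwe
  by_cases h : 0 ≤ z.arg
  · refine ⟨z.arg, ⟨h, by linarith [Complex.arg_le_pi z]⟩, ?_⟩
    rw [mul_comm]; simpa using hwe
  · refine ⟨z.arg + 2 * Real.pi, ⟨by linarith [Complex.neg_pi_lt_arg z], by linarith⟩, ?_⟩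
    have : I * ((z.arg + 2 * Real.pi : ℝ) : ℂ) = z.arg * I + 2 * Real.pi * I := by push_cast; ring
    rw [this, Complex.exp_add, Complex.exp_two_pi_mul_I, mul_one]; simpa using hwe

theorem norm_eq_one_of_mul_conj {z : ℂ} (h : z * (starRingEnd ℂ) z = 1) : ‖z‖ = 1 := by
  rw [Complex.mul_conj, Complex.normSq_eq_norm_sq] at h
  have h' : ‖z‖ ^ 2 = 1 := by exact_mod_cast h
  nlinarith [norm_nonneg z]

/-- A unitary matrix of size two factors into a phased beam splitter and two phases. -/
theorem exists_angles_two {U : Matrix (Fin 2) (Fin 2) ℂ} (hU : U ∈ unitaryGroup (Fin 2) ℂ) :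
    ∃ α β φ ψ : ℝ, α ∈ Set.Ico 0 Real.pi ∧ β ∈ Set.Ico 0 Real.pi ∧
      (α = 0 ∨ α = Real.pi / 2 → β = 0) ∧ φ ∈ Set.Ico 0 (2 * Real.pi) ∧
      ψ ∈ Set.Ico 0 (2 * Real.pi) ∧
      U = blockDiag (phaseMat φ) (phaseMat ψ) * phasedBsMat α β := by
  obtain ⟨α, β, h⟩ := exists_killAngles (U 0 0) (U 0 1)
  set g := phasedBsMat α β with hg
  have hgU : g ∈ unitaryGroup (Fin 2) ℂ := phasedBsMat_mem_unitary α β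
  set V := U * star g with hV
  have hVU : V ∈ unitaryGroup (Fin 2) ℂ := mul_mem hU (Unitary.star_mem hgU)
  have hUV : U = V * g := by rw [hV, mul_assoc, Unitary.star_mul_self_of_mem hgU, mul_one]
  have v01 : V 0 1 = 0 := by
    have := h.kill
    rw [← this, hV]
    simp [Matrix.mul_apply, Fin.sum_univ_two, star_eq_conjTranspose, hg]
  -- A triangular unitary matrix is diagonal: orthonormality of the rows gives a unit entry in the
  -- first row, then a zero below it, then a second unit entry.
  have hVV := (mem_unitaryGroup_iff).1 hVU
  have e (i j) := congrFun (congrFun hVV i) j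
  have e00 := e 0 0
  have e10 := e 1 0
  have e11 := e 1 1
  simp [Matrix.mul_apply, Fin.sum_univ_two, star_eq_conjTranspose, v01] at e00 e10 e11
  have n0 := norm_eq_one_of_mul_conj e00
  have v00 : V 0 0 ≠ 0 := fun h => by simp [h] at n0
  have v10 : V 1 0 = 0 := e10.resolve_right v00
  simp [v10] at e11
  have n1 := norm_eq_one_of_mul_conj e11
  obtain ⟨φ, hφ, eφ⟩ := exists_phaseMat_eq n0
  obtain ⟨ψ, hψ, eψ⟩ := exists_phaseMat_eq n1
  refine ⟨α, β, φ, ψ, h.hα, h.hβ, h.hβ_zero, hφ, hψ, ?_⟩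
  rw [hUV]
  congr 1
  rw [blockDiag_one_one]
  ext i j
  fin_cases i <;> fin_cases j <;> simp [phaseMat, v01, v10, eφ, eψ]

/-- A matrix of size two acting on the first two of three coordinates. -/
def topMat (A : Matrix (Fin 2) (Fin 2) ℂ) : Matrix (Fin 3) (Fin 3) ℂ :=
  blockDiag (n := 2) (m := 2) A (1 : Matrix (Fin 1) (Fin 1) ℂ)

/-- A matrix of size two acting on the last two of three coordinates. -/
def bottomMat (A : Matrix (Fin 2) (Fin 2) ℂ) : Matrix (Fin 3) (Fin 3) ℂ :=
  blockDiag (n := 1) (m := 1) (1 : Matrix (Fin 1) (Fin 1) ℂ) A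

theorem topMat_eq (A : Matrix (Fin 2) (Fin 2) ℂ) :
    topMat A = !![A 0 0, A 0 1, 0; A 1 0, A 1 1, 0; 0, 0, 1] := by
  ext i j
  have h := blockDiag_castAdd_castAdd A (1 : Matrix (Fin 1) (Fin 1) ℂ)
  have h' := blockDiag_natAdd_castAdd A (1 : Matrix (Fin 1) (Fin 1) ℂ) 0
  have h'' := fun i => blockDiag_castAdd_natAdd A (1 : Matrix (Fin 1) (Fin 1) ℂ) i 0
  fin_cases i <;> fin_cases j
  exacts [h 0 0, h 0 1, h'' 0, h 1 0, h 1 1, h'' 1, h' 0, h' 1,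
    blockDiag_natAdd_natAdd A (1 : Matrix (Fin 1) (Fin 1) ℂ) 0 0]

theorem bottomMat_eq (A : Matrix (Fin 2) (Fin 2) ℂ) :
    bottomMat A = !![1, 0, 0; 0, A 0 0, A 0 1; 0, A 1 0, A 1 1] := by
  ext i j
  have h := blockDiag_natAdd_natAdd (1 : Matrix (Fin 1) (Fin 1) ℂ) A
  have h' := blockDiag_castAdd_natAdd (1 : Matrix (Fin 1) (Fin 1) ℂ) A 0
  have h'' := fun i => blockDiag_natAdd_castAdd (1 : Matrix (Fin 1) (Fin 1) ℂ) A i 0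
  fin_cases i <;> fin_cases j
  exacts [blockDiag_castAdd_castAdd (1 : Matrix (Fin 1) (Fin 1) ℂ) A 0 0, h' 0, h' 1, h'' 0,
    h 0 0, h 0 1, h'' 1, h 1 0, h 1 1]

theorem topMat_mem_unitary {A : Matrix (Fin 2) (Fin 2) ℂ} (hA : A ∈ unitaryGroup (Fin 2) ℂ) :
    topMat A ∈ unitaryGroup (Fin 3) ℂ := blockDiag_mem_unitary hA (one_mem _)

theorem bottomMat_mem_unitary {A : Matrix (Fin 2) (Fin 2) ℂ} (hA : A ∈ unitaryGroup (Fin 2) ℂ) :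
    bottomMat A ∈ unitaryGroup (Fin 3) ℂ := blockDiag_mem_unitary (one_mem _) hA

theorem topMat_mul (A B : Matrix (Fin 2) (Fin 2) ℂ) : topMat (A * B) = topMat A * topMat B := by
  rw [topMat, topMat, topMat, blockDiag_mul, mul_one]

theorem bottomMat_mul (A B : Matrix (Fin 2) (Fin 2) ℂ) :
    bottomMat (A * B) = bottomMat A * bottomMat B := by
  rw [bottomMat, bottomMat, bottomMat, blockDiag_mul, mul_one]

theorem blockDiag_one_one_one (A B C : Matrix (Fin 1) (Fin 1) ℂ) :
    blockDiag (blockDiag A B) C = !![A 0 0, 0, 0; 0, B 0 0, 0; 0, 0, C 0 0] := by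
  ext i j
  rw [blockDiag_one_one]
  have h := blockDiag_castAdd_castAdd (!![A 0 0, 0; 0, B 0 0]) C
  have h' := blockDiag_natAdd_castAdd (!![A 0 0, 0; 0, B 0 0]) C 0
  have h'' := fun i => blockDiag_castAdd_natAdd (!![A 0 0, 0; 0, B 0 0]) C i 0
  fin_cases i <;> fin_cases j
  exacts [h 0 0, h 0 1, h'' 0, h 1 0, h 1 1, h'' 1, h' 0, h' 1,
    blockDiag_natAdd_natAdd (!![A 0 0, 0; 0, B 0 0]) C 0 0]

/-- Groups each phase with the beam splitter that follows it, the form in which elimination produces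
the factors. -/
theorem eulerRightMat_eq (α₁ α₂ α₃ β₁ β₂ β₃ β₄ β₅ β₆ : ℝ) :
    eulerRightMat α₁ α₂ α₃ β₁ β₂ β₃ β₄ β₅ β₆ =
      blockDiag (blockDiag (phaseMat β₄) (phaseMat β₅)) (phaseMat β₆) *
        (bottomMat (phasedBsMat α₃ β₃) * (topMat (phasedBsMat α₂ β₂) *
          bottomMat (phasedBsMat α₁ β₁))) := by
  have h (β : ℝ) : blockDiag (blockDiag (1 : Matrix (Fin 1) (Fin 1) ℂ) (phaseMat β)) (1 : Matrix (Fin 1) (Fin 1) ℂ) =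
      bottomMat (blockDiag (phaseMat β) (1 : Matrix (Fin 1) (Fin 1) ℂ)) := by
    rw [blockDiag_one_one_one, bottomMat_eq, blockDiag_one_one]; simp
  rw [phasedBsMat, phasedBsMat, phasedBsMat, bottomMat_mul, topMat_mul, bottomMat_mul,
    eulerRightMat, h, h]
  simp only [← mul_assoc]
  rfl

/-- Givens elimination on columns: entry `(0, 2)` is cleared by the last two columns, `(0, 1)` by
the first two, `(1, 2)` by the last two. What remains is lower triangular and unitary, hence a
diagonal of three phases. Only existence of the angles is proved. -/
theorem exists_eulerAngles {U : Matrix (Fin 3) (Fin 3) ℂ} (hU : U ∈ unitaryGroup (Fin 3) ℂ) :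
    ∃ α₁ α₂ α₃ β₁ β₂ β₃ β₄ β₅ β₆, EulerAngles α₁ α₂ α₃ β₁ β₂ β₃ β₄ β₅ β₆ ∧
      U = eulerRightMat α₁ α₂ α₃ β₁ β₂ β₃ β₄ β₅ β₆ := by
  obtain ⟨α₁, β₁, h₁⟩ := exists_killAngles (U 0 1) (U 0 2)
  set g₁ := bottomMat (phasedBsMat α₁ β₁) with hg₁
  have hgU₁ : g₁ ∈ unitaryGroup (Fin 3) ℂ := bottomMat_mem_unitary (phasedBsMat_mem_unitary _ _)
  set V₁ := U * star g₁ with hV₁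
  have hVU₁ : V₁ ∈ unitaryGroup (Fin 3) ℂ := mul_mem hU (Unitary.star_mem hgU₁)
  have hUV₁ : U = V₁ * g₁ := by rw [hV₁, mul_assoc, Unitary.star_mul_self_of_mem hgU₁, mul_one]
  obtain ⟨α₂, β₂, h₂⟩ := exists_killAngles (V₁ 0 0) (V₁ 0 1)
  set g₂ := topMat (phasedBsMat α₂ β₂) with hg₂
  have hgU₂ : g₂ ∈ unitaryGroup (Fin 3) ℂ := topMat_mem_unitary (phasedBsMat_mem_unitary _ _)
  set V₂ := V₁ * star g₂ with hV₂
  have hVU₂ : V₂ ∈ unitaryGroup (Fin 3) ℂ := mul_mem hVU₁ (Unitary.star_mem hgU₂)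
  have hUV₂ : V₁ = V₂ * g₂ := by rw [hV₂, mul_assoc, Unitary.star_mul_self_of_mem hgU₂, mul_one]
  obtain ⟨α₃, β₃, h₃⟩ := exists_killAngles (V₂ 1 1) (V₂ 1 2)
  set g₃ := bottomMat (phasedBsMat α₃ β₃) with hg₃
  have hgU₃ : g₃ ∈ unitaryGroup (Fin 3) ℂ := bottomMat_mem_unitary (phasedBsMat_mem_unitary _ _)
  set V := V₂ * star g₃ with hV
  have hVU : V ∈ unitaryGroup (Fin 3) ℂ := mul_mem hVU₂ (Unitary.star_mem hgU₃)
  have hUV : V₂ = V * g₃ := by rw [hV, mul_assoc, Unitary.star_mul_self_of_mem hgU₃, mul_one]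
  have a02 : V₁ 0 2 = 0 := by
    rw [← h₁.kill, hV₁, hg₁, bottomMat_eq]
    simp [Matrix.mul_apply, Fin.sum_univ_three, star_eq_conjTranspose]
  -- `g₂` does not touch the last column, so the first zero survives.
  have b02 : V₂ 0 2 = 0 := by
    rw [hV₂, hg₂, topMat_eq]
    simp [Matrix.mul_apply, Fin.sum_univ_three, star_eq_conjTranspose, a02]
  have b01 : V₂ 0 1 = 0 := by
    rw [← h₂.kill, hV₂, hg₂, topMat_eq]
    simp [Matrix.mul_apply, Fin.sum_univ_three, star_eq_conjTranspose]
  have v01 : V 0 1 = 0 := by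
    rw [hV, hg₃, bottomMat_eq]
    simp [Matrix.mul_apply, Fin.sum_univ_three, star_eq_conjTranspose, b01, b02]
  have v02 : V 0 2 = 0 := by
    rw [hV, hg₃, bottomMat_eq]
    simp [Matrix.mul_apply, Fin.sum_univ_three, star_eq_conjTranspose, b01, b02]
  have v12 : V 1 2 = 0 := by
    rw [← h₃.kill, hV, hg₃, bottomMat_eq]
    simp [Matrix.mul_apply, Fin.sum_univ_three, star_eq_conjTranspose]
  -- If `α₂ = 0`, then `V₁ 0 1` was already zero, so the first row of `V₁` vanishes off the
  -- diagonal. Multiplication by `g₁` preserves this, hence `U 0 2 = 0` and the first elimination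
  -- step was trivial.
  have h₂₁ : α₂ = 0 → α₁ = 0 := by
    intro h0
    apply h₁.hα_zero
    subst h0
    have a01 : V₁ 0 1 = 0 := h₂.eq_zero
    rw [hUV₁, hg₁, bottomMat_eq]
    simp [Matrix.mul_apply, Fin.sum_univ_three, a01, a02]
  -- Row orthonormality, read from the top row down, makes the triangular matrix `V` diagonal with
  -- entries of modulus one.
  have e (i j) := congrFun (congrFun ((mem_unitaryGroup_iff).1 hVU) i) j
  have e00 := e 0 0
  have e10 := e 1 0
  have e20 := e 2 0
  have e11 := e 1 1
  have e21 := e 2 1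
  have e22 := e 2 2
  simp [Matrix.mul_apply, Fin.sum_univ_three, star_eq_conjTranspose, v01, v02, v12] at e00 e10 e20 e11 e21 e22
  have n0 := norm_eq_one_of_mul_conj e00
  have v00 : V 0 0 ≠ 0 := fun h => by simp [h] at n0
  have v10 : V 1 0 = 0 := e10.resolve_right v00
  have v20 : V 2 0 = 0 := e20.resolve_right v00
  simp [v10, v20] at e11 e21 e22
  have n1 := norm_eq_one_of_mul_conj e11
  have v11 : V 1 1 ≠ 0 := fun h => by simp [h] at n1
  have v21 : V 2 1 = 0 := e21.resolve_right v11
  simp [v21] at e22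
  have n2 := norm_eq_one_of_mul_conj e22
  obtain ⟨β₄, hβ₄, e₄⟩ := exists_phaseMat_eq n0
  obtain ⟨β₅, hβ₅, e₅⟩ := exists_phaseMat_eq n1
  obtain ⟨β₆, hβ₆, e₆⟩ := exists_phaseMat_eq n2
  refine ⟨α₁, α₂, α₃, β₁, β₂, β₃, β₄, β₅, β₆, ⟨h₁.hα, h₂.hα, h₃.hα, h₁.hβ, h₂.hβ, h₃.hβ,
    hβ₄, hβ₅, hβ₆, h₁.hβ_zero, h₂.hβ_zero, h₃.hβ_zero, h₂₁⟩, ?_⟩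
  have hVd : V = blockDiag (blockDiag (phaseMat β₄) (phaseMat β₅)) (phaseMat β₆) := by
    rw [blockDiag_one_one_one]
    ext i j
    fin_cases i <;> fin_cases j <;> simp [phaseMat, v01, v02, v12, v10, v20, v21, e₄, e₅, e₆]
  rw [eulerRightMat_eq, ← hVd, hUV₁, hUV₂, hUV, mul_assoc, mul_assoc]

theorem eulerLeftMat_mem_unitary (θ₁ θ₂ θ₃ φ₁ φ₂ : ℝ) :
    eulerLeftMat θ₁ θ₂ θ₃ φ₁ φ₂ ∈ unitaryGroup (Fin 3) ℂ :=
  mul_mem (topMat_mem_unitary (bsMat_mem_unitary _)) (mul_mem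
    (bottomMat_mem_unitary (bsMat_mem_unitary _)) (mul_mem (blockDiag_mem_unitary
      (blockDiag_mem_unitary (phaseMat_mem_unitary _) (phaseMat_mem_unitary _)) (one_mem _))
      (topMat_mem_unitary (bsMat_mem_unitary _))))

/-- The Euler axiom in matrix form: the required restriction to horizontal photons is the matrix
itself, viewed as a linear map. -/
theorem mk_eulerLeft_eq {θ₁ θ₂ θ₃ φ₁ φ₂ α₁ α₂ α₃ β₁ β₂ β₃ β₄ β₅ β₆ : ℝ}
    (h : EulerAngles α₁ α₂ α₃ β₁ β₂ β₃ β₄ β₅ β₆)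
    (h' : eulerLeftMat θ₁ θ₂ θ₃ φ₁ φ₂ = eulerRightMat α₁ α₂ α₃ β₁ β₂ β₃ β₄ β₅ β₆) :
    Mor.mk (eulerLeft θ₁ θ₂ θ₃ φ₁ φ₂) = Mor.mk (eulerRight α₁ α₂ α₃ β₁ β₂ β₃ β₄ β₅ β₆) := by
  refine Mor.mk_eq_of_axiom (.euler _ _ _ _ _ _ _ _ _ _ _ _ _ _ h
    (eulerLeftMat θ₁ θ₂ θ₃ φ₁ φ₂).mulVecLin ?_ ?_)
  · rw [IsHSemantics, interp_eulerLeft, spatial_comp_hInj]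
  · rw [IsHSemantics, interp_eulerRight, h', spatial_comp_hInj]

/-- Two left-hand sides of the Euler equation with the same matrix are equal. -/
theorem mk_eulerLeft_congr {θ₁ θ₂ θ₃ φ₁ φ₂ θ₁' θ₂' θ₃' φ₁' φ₂' : ℝ}
    (h : eulerLeftMat θ₁ θ₂ θ₃ φ₁ φ₂ = eulerLeftMat θ₁' θ₂' θ₃' φ₁' φ₂') :
    Mor.mk (eulerLeft θ₁ θ₂ θ₃ φ₁ φ₂) = Mor.mk (eulerLeft θ₁' θ₂' θ₃' φ₁' φ₂') := by
  -- One choice of admissible angles serves both sides, so uniqueness of the angles plays no role.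
  obtain ⟨α₁, α₂, α₃, β₁, β₂, β₃, β₄, β₅, β₆, ha, hm⟩ :=
    exists_eulerAngles (eulerLeftMat_mem_unitary θ₁ θ₂ θ₃ φ₁ φ₂)
  rw [mk_eulerLeft_eq ha hm, mk_eulerLeft_eq ha (h.symm.trans hm)]

end Euler

namespace Mor

open Complex Matrix

/-! ## Equations between one- and two-wire passive circuits -/

theorem onTop_seq (f g : Mor 2 2) : onTop (f ⬝ g) = onTop f ⬝ onTop g := by
  simp [onTop, par_seq_par]

theorem onBottom_seq (f g : Mor 2 2) : onBottom (f ⬝ g) = onBottom f ⬝ onBottom g := by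
  simp [onBottom, par_seq_par]

@[simp] theorem onTop_id : onTop (id 2) = id 3 := par_id 2 1

@[simp] theorem onBottom_id : onBottom (id 2) = id 3 := par_id 1 2

/-- Phase shifters on each of three wires. -/
def phases₃ (a b c : ℝ) : Mor 3 3 := phase a ⊠ phase b ⊠ phase c

theorem mk_eulerLeft (θ₁ θ₂ θ₃ φ₁ φ₂ : ℝ) : mk (eulerLeft θ₁ θ₂ θ₃ φ₁ φ₂) =
    onTop (bs θ₁) ⬝ phases₃ φ₂ φ₁ 0 ⬝ onBottom (bs θ₂) ⬝ onTop (bs θ₃) := by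
  rw [phases₃, phase_zero]; rfl

theorem mk_eulerRight (α₁ α₂ α₃ β₁ β₂ β₃ β₄ β₅ β₆ : ℝ) :
    mk (eulerRight α₁ α₂ α₃ β₁ β₂ β₃ β₄ β₅ β₆) =
      phases₃ 0 β₁ 0 ⬝ onBottom (bs α₁) ⬝ phases₃ β₂ 0 0 ⬝ onTop (bs α₂) ⬝ phases₃ 0 β₃ 0 ⬝
        onBottom (bs α₃) ⬝ phases₃ β₄ β₅ β₆ := by
  simp only [phases₃, phase_zero]; rfl

theorem onTop_phases (a b : ℝ) : onTop (phase a ⊠ phase b) = phases₃ a b 0 := by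
  rw [phases₃, phase_zero]; rfl

theorem onBottom_phases (a b : ℝ) : onBottom (phase a ⊠ phase b) = phases₃ 0 a b := by
  rw [phases₃, phase_zero]; exact par_par_one _ _ _

theorem phases₃_seq (a b c a' b' c' : ℝ) :
    phases₃ a b c ⬝ phases₃ a' b' c' = phases₃ (a + a') (b + b') (c + c') := by
  rw [phases₃, phases₃, par_seq_par, par_seq_par, phase_add, phase_add, phase_add]; rfl

@[simp] theorem phases₃_zero : phases₃ 0 0 0 = id 3 := by
  rw [← onTop_phases, phase_zero]; simp

/-- With the middle beam splitter trivial, the third wire is idle; this extracts two-wire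
consequences from the three-wire axiom. -/
theorem mk_eulerLeft_zero (θ₁ θ₃ φ₁ φ₂ : ℝ) : mk (eulerLeft θ₁ 0 θ₃ φ₁ φ₂) =
    onTop (bs θ₁ ⬝ (phase φ₂ ⊠ phase φ₁) ⬝ bs θ₃) := by
  rw [mk_eulerLeft, bs_zero, onBottom_id, seq_id, onTop_seq, onTop_seq, onTop_phases]

theorem onTop_injective {f g : Mor 2 2} (h : onTop f = onTop g) : f = g := pad_injective h

/-- The matrix of two phase shifters in parallel. -/
def phases₂Mat (a b : ℝ) : Matrix (Fin 2) (Fin 2) ℂ := blockDiag (phaseMat a) (phaseMat b)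

theorem bsMat_zero : bsMat 0 = 1 := by
  ext i j; fin_cases i <;> fin_cases j <;> simp [bsMat]

theorem eulerLeftMat_zero (θ₁ θ₃ φ₁ φ₂ : ℝ) : eulerLeftMat θ₁ 0 θ₃ φ₁ φ₂ =
    topMat (bsMat θ₃ * (phases₂Mat φ₂ φ₁ * bsMat θ₁)) := by
  rw [topMat_mul, topMat_mul, eulerLeftMat, bsMat_zero, blockDiag_one]
  erw [one_mul]
  rfl

/-- Equality of matrices implies derivability for two beam splitters with phases in between. -/
theorem bs_phases_bs_congr {θ₁ θ₃ φ₁ φ₂ θ₁' θ₃' φ₁' φ₂' : ℝ}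
    (h : bsMat θ₃ * (phases₂Mat φ₂ φ₁ * bsMat θ₁) = bsMat θ₃' * (phases₂Mat φ₂' φ₁' * bsMat θ₁')) :
    bs θ₁ ⬝ (phase φ₂ ⊠ phase φ₁) ⬝ bs θ₃ = bs θ₁' ⬝ (phase φ₂' ⊠ phase φ₁') ⬝ bs θ₃' := by
  apply onTop_injective
  rw [← mk_eulerLeft_zero, ← mk_eulerLeft_zero]
  apply mk_eulerLeft_congr
  rw [eulerLeftMat_zero, eulerLeftMat_zero, h]

theorem phases₂Mat_eq (a b : ℝ) : phases₂Mat a b = !![exp (I * a), 0; 0, exp (I * b)] := by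
  rw [phases₂Mat, blockDiag_one_one]; simp [phaseMat]

theorem phases₂Mat_zero : phases₂Mat 0 0 = 1 := by
  rw [phases₂Mat_eq]
  ext i j; fin_cases i <;> fin_cases j <;> simp

/-- Periodicity of phase shifters comes from the Euler axiom with all beam splitter angles on the
left equal to zero. -/
theorem phase_congr {a b : ℝ} (h : exp (I * a) = exp (I * b)) : phase a = phase b := by
  have := bs_phases_bs_congr (θ₁ := 0) (θ₃ := 0) (φ₁ := 0) (φ₂ := a) (θ₁' := 0) (θ₃' := 0)
    (φ₁' := 0) (φ₂' := b) (by rw [phases₂Mat_eq, phases₂Mat_eq, h])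
  apply pad_injective
  simpa using this

theorem bs_add (a b : ℝ) : bs a ⬝ bs b = bs (a + b) := by
  have := bs_phases_bs_congr (θ₁ := a) (θ₃ := b) (φ₁ := 0) (φ₂ := 0) (θ₁' := a + b) (θ₃' := 0)
    (φ₁' := 0) (φ₂' := 0) (by
      rw [phases₂Mat_zero, bsMat_zero, one_mul, one_mul, one_mul]
      ext i j
      fin_cases i <;> fin_cases j <;>
        simp [bsMat, Matrix.mul_apply, Fin.sum_univ_two, Complex.cos_add, Complex.sin_add]
      · linear_combination (Complex.sin a * Complex.sin b) * I_sq
      · ring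
      · ring
      · linear_combination (Complex.sin a * Complex.sin b) * I_sq)
  simpa using this

theorem bs_neg (a : ℝ) : bs a ⬝ bs (-a) = id 2 := by rw [bs_add]; simp

theorem phases_bs_comm (φ θ : ℝ) :
    (phase φ ⊠ phase φ) ⬝ bs θ = bs θ ⬝ (phase φ ⊠ phase φ) := by
  have := bs_phases_bs_congr (θ₁ := 0) (θ₃ := θ) (φ₁ := φ) (φ₂ := φ) (θ₁' := θ) (θ₃' := 0)
    (φ₁' := φ) (φ₂' := φ) (by
      rw [bsMat_zero, mul_one, one_mul, phases₂Mat_eq]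
      ext i j
      fin_cases i <;> fin_cases j <;>
        simp [bsMat, Matrix.mul_apply, Fin.sum_univ_two, mul_comm])
  simpa using this

theorem phases₂_seq (a b c d : ℝ) :
    (phase a ⊠ phase b) ⬝ (phase c ⊠ phase d) = phase (a + c) ⊠ phase (b + d) := by
  rw [par_seq_par, phase_add, phase_add]

theorem phases₂_zero : phase 0 ⊠ phase 0 = id 2 := by
  rw [phase_zero]; exact par_id 1 1

/-- The two-wire instance of the Euler equation: the outer two beam splitters on the right-hand side
are trivial, so a single one remains. -/
theorem bs_phases_bs (θ₁ θ₃ φ₁ φ₂ : ℝ) : ∃ α β φ ψ : ℝ, α ∈ Set.Ico 0 Real.pi ∧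
    bs θ₁ ⬝ (phase φ₂ ⊠ phase φ₁) ⬝ bs θ₃ =
      (phase β ⊠ phase 0) ⬝ bs α ⬝ (phase φ ⊠ phase ψ) := by
  have hU : bsMat θ₃ * (phases₂Mat φ₂ φ₁ * bsMat θ₁) ∈ unitaryGroup (Fin 2) ℂ :=
    mul_mem (bsMat_mem_unitary _) (mul_mem (blockDiag_mem_unitary (phaseMat_mem_unitary _)
      (phaseMat_mem_unitary _)) (bsMat_mem_unitary _))
  obtain ⟨α, β, φ, ψ, hα, hβ, h, hφ, hψ, e⟩ := exists_angles_two hU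
  refine ⟨α, β, φ, ψ, hα, onTop_injective ?_⟩
  have hpi := Real.pi_pos
  -- The condition linking `α₂` to `α₁` holds because `α₁ = 0`.
  have ha : EulerAngles 0 α 0 0 β 0 φ ψ 0 :=
    ⟨⟨le_rfl, hpi⟩, hα, ⟨le_rfl, hpi⟩, ⟨le_rfl, hpi⟩, hβ, ⟨le_rfl, hpi⟩, hφ, hψ,
      ⟨le_rfl, by linarith⟩, fun _ => rfl, h, fun _ => rfl, fun _ => rfl⟩
  rw [← mk_eulerLeft_zero, mk_eulerLeft_eq ha, mk_eulerRight]
  · rw [onTop_seq, onTop_seq, onTop_phases, onTop_phases]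
    simp
  · have h0 : phaseMat 0 = 1 := by
      ext i j; fin_cases i; fin_cases j; simp [phaseMat]
    have h1 : phasedBsMat 0 0 = 1 := by
      rw [phasedBsMat, bsMat_zero, h0, blockDiag_one]; exact one_mul _
    have h2 : bottomMat 1 = 1 := blockDiag_one
    rw [eulerLeftMat_zero, eulerRightMat_eq, e, h1, h2, mul_one, one_mul, topMat_mul, h0]
    rfl

/-- Two-wire passive circuits. -/
inductive Gate₂ : Mor 2 2 → Prop
  | id : Gate₂ (id 2)
  | seq {f g : Mor 2 2} : Gate₂ f → Gate₂ g → Gate₂ (f ⬝ g)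
  | bs (θ : ℝ) : Gate₂ (bs θ)
  | phases (a b : ℝ) : Gate₂ (phase a ⊠ phase b)

theorem Gate₂.normalForm {f : Mor 2 2} (hf : Gate₂ f) : ∃ a b α c d : ℝ, α ∈ Set.Ico 0 Real.pi ∧
    f = (phase a ⊠ phase b) ⬝ Mor.bs α ⬝ (phase c ⊠ phase d) := by
  -- With an arbitrary prefix in normal form, sequential composition becomes an immediate case of
  -- the induction.
  suffices H : ∀ g : Mor 2 2, (∃ a b α c d : ℝ, α ∈ Set.Ico 0 Real.pi ∧
      g = (phase a ⊠ phase b) ⬝ Mor.bs α ⬝ (phase c ⊠ phase d)) →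
      ∃ a b α c d : ℝ, α ∈ Set.Ico 0 Real.pi ∧
      g ⬝ f = (phase a ⊠ phase b) ⬝ Mor.bs α ⬝ (phase c ⊠ phase d) by
    simpa using H (Mor.id 2) ⟨0, 0, 0, 0, 0, ⟨le_rfl, Real.pi_pos⟩, by
      rw [phases₂_zero]; simp⟩
  induction hf with
  | id => intro g h; simpa using h
  | seq _ _ ih₁ ih₂ =>
    intro g h
    rw [← seq_assoc]
    exact ih₂ _ (ih₁ _ h)
  | bs θ =>
    rintro g ⟨a, b, α, c, d, -, rfl⟩
    obtain ⟨α', β, φ, ψ, hα', e⟩ := bs_phases_bs α θ d c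
    refine ⟨a + β, b + 0, α', φ, ψ, hα', ?_⟩
    rw [seq_assoc, seq_assoc, ← seq_assoc (Mor.bs α), e, ← phases₂_seq]
    simp only [seq_assoc]
  | phases c' d' =>
    rintro g ⟨a, b, α, c, d, hα, rfl⟩
    exact ⟨a, b, α, c + c', d + d', hα, by rw [seq_assoc, phases₂_seq]⟩

theorem phases₂_neg (a b : ℝ) : (phase a ⊠ phase b) ⬝ (phase (-a) ⊠ phase (-b)) = id 2 := by
  rw [phases₂_seq, add_neg_cancel, add_neg_cancel, phases₂_zero]

theorem Gate₂.exists_inverse {f : Mor 2 2} (hf : Gate₂ f) :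
    ∃ g, Gate₂ g ∧ f ⬝ g = Mor.id 2 ∧ g ⬝ f = Mor.id 2 := by
  induction hf with
  | id => exact ⟨_, .id, by simp, by simp⟩
  | @seq f₁ f₂ _ _ ih₁ ih₂ =>
    obtain ⟨g₁, h₁, e₁, e₁'⟩ := ih₁
    obtain ⟨g₂, h₂, e₂, e₂'⟩ := ih₂
    exact ⟨g₂ ⬝ g₁, h₂.seq h₁, by rw [seq_assoc, seq_cancel e₂, e₁],
      by rw [seq_assoc, seq_cancel e₁', e₂']⟩
  | bs θ =>
    refine ⟨_, .bs (-θ), bs_neg θ, ?_⟩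
    simpa using bs_neg (-θ)
  | phases a b =>
    refine ⟨_, .phases (-a) (-b), phases₂_neg a b, ?_⟩
    simpa using phases₂_neg (-a) (-b)

/-- Allows wire crossings to be treated as gates: solve `bs_pi_div_two` for the swap. -/
theorem Gate₂.swap₂ : Gate₂ swap₂ := by
  have : Mor.swap₂ = Mor.bs (Real.pi / 2) ⬝ (phase (-(Real.pi / 2)) ⊠ phase (-(Real.pi / 2))) := by
    rw [bs_pi_div_two, seq_assoc, phases₂_neg, seq_id]
  rw [this]
  exact (Gate₂.bs _).seq (.phases _ _)

theorem Gate₂.sem {f : Mor 2 2} (hf : Gate₂ f) :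
    ∃ C ∈ unitaryGroup (Fin 2) ℂ, Mor.sem f = spatial C := by
  induction hf with
  | id => exact ⟨1, one_mem _, sem_id_spatial 2⟩
  | seq _ _ ih₁ ih₂ =>
    obtain ⟨C₁, h₁, e₁⟩ := ih₁
    obtain ⟨C₂, h₂, e₂⟩ := ih₂
    exact ⟨C₂ * C₁, mul_mem h₂ h₁, sem_seq_spatial e₁ e₂⟩
  | bs θ => exact ⟨_, bsMat_mem_unitary θ, sem_bs θ⟩
  | phases a b => exact ⟨phases₂Mat a b, blockDiag_mem_unitary (phaseMat_mem_unitary _)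
      (phaseMat_mem_unitary _), sem_par_spatial (sem_phase a) (sem_phase b)⟩

/-! ## Euler decompositions on three wires -/

theorem onTop_comm_phase (f : Mor 2 2) (c : ℝ) :
    onTop f ⬝ phases₃ 0 0 c = phases₃ 0 0 c ⬝ onTop f := by
  have h : phases₃ 0 0 c = par (n := 2) (m := 2) (n' := 1) (m' := 1) (id 2) (phase c) := by
    rw [phases₃, phases₂_zero]
  rw [h, onTop, par_seq_par, par_seq_par]
  simp

theorem onBottom_comm_phase (f : Mor 2 2) (a : ℝ) :
    onBottom f ⬝ phases₃ a 0 0 = phases₃ a 0 0 ⬝ onBottom f := by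
  have h : phases₃ a 0 0 = par (n := 1) (m := 1) (n' := 2) (m' := 2) (phase a) (id 2) := by
    rw [← phases₂_zero]; exact (par_par_one _ _ _).symm
  rw [h, onBottom, par_seq_par, par_seq_par]
  simp

theorem onTop_bs_comm_phases (θ a : ℝ) :
    onTop (bs θ) ⬝ phases₃ a a 0 = phases₃ a a 0 ⬝ onTop (bs θ) := by
  rw [← onTop_phases, ← onTop_seq, ← onTop_seq, phases_bs_comm]

/-- Three gates on the top, the bottom and the top pair of wires can be written as three gates on
the bottom, the top and the bottom pair of wires. -/
theorem top_bottom_top {f g h : Mor 2 2} (hf : Gate₂ f) (hg : Gate₂ g) (hh : Gate₂ h) :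
    ∃ f' g' h', Gate₂ f' ∧ Gate₂ g' ∧ Gate₂ h' ∧
      onTop f ⬝ onBottom g ⬝ onTop h = onBottom f' ⬝ onTop g' ⬝ onBottom h' := by
  obtain ⟨a, b, θ₁, c, d, -, rfl⟩ := hf.normalForm
  obtain ⟨e, f, θ₂, g, k, -, rfl⟩ := hg.normalForm
  obtain ⟨i, j, θ₃, l, m, -, rfl⟩ := hh.normalForm
  -- Angles for the core left after moving phases outwards. Before the last top gate, wires 0 and 1
  -- carry `i` and `g + j`. The common phase `g + j` passes through `bs θ₃`; the excess `i - (g +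
  -- j)` on wire 0 passes back through the bottom gate and joins `c`. On wire 1, `d` meets `e`.
  obtain ⟨α₁, α₂, α₃, β₁, β₂, β₃, β₄, β₅, β₆, ha, he⟩ :=
    exists_eulerAngles (eulerLeftMat_mem_unitary θ₁ θ₂ θ₃ (d + e) (c + (i - (g + j))))
  have key := mk_eulerLeft_eq ha he
  rw [mk_eulerLeft, mk_eulerRight] at key
  have hsplit' (x y z : ℝ) : phases₃ x y z = phases₃ x y 0 ⬝ phases₃ 0 0 z := by
    simp [phases₃_seq]
  have hsplit'' (x y z : ℝ) : phases₃ x y z = phases₃ x 0 0 ⬝ phases₃ 0 y z := by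
    simp [phases₃_seq]
  have left : onTop ((phase a ⊠ phase b) ⬝ bs θ₁ ⬝ (phase c ⊠ phase d)) ⬝
      onBottom ((phase e ⊠ phase f) ⬝ bs θ₂ ⬝ (phase g ⊠ phase k)) ⬝
      onTop ((phase i ⊠ phase j) ⬝ bs θ₃ ⬝ (phase l ⊠ phase m)) =
      phases₃ a b f ⬝ (onTop (bs θ₁) ⬝ phases₃ (c + (i - (g + j))) (d + e) 0 ⬝
        onBottom (bs θ₂) ⬝ onTop (bs θ₃)) ⬝ phases₃ (g + j + l) (g + j + m) k := by
    simp only [onTop_seq, onBottom_seq, onTop_phases, onBottom_phases]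
    calc _ = phases₃ a b 0 ⬝ onTop (bs θ₁) ⬝ (phases₃ c d 0 ⬝ phases₃ 0 e f) ⬝ onBottom (bs θ₂) ⬝
          (phases₃ 0 g k ⬝ phases₃ i j 0) ⬝ onTop (bs θ₃) ⬝ phases₃ l m 0 := by
          simp only [seq_assoc]
      _ = phases₃ a b 0 ⬝ (onTop (bs θ₁) ⬝ phases₃ 0 0 f) ⬝ phases₃ c (d + e) 0 ⬝
          (onBottom (bs θ₂) ⬝ phases₃ (i - (g + j)) 0 0) ⬝ phases₃ 0 0 k ⬝
          (phases₃ (g + j) (g + j) 0 ⬝ onTop (bs θ₃)) ⬝ phases₃ l m 0 := by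
          have h1 : phases₃ c d 0 ⬝ phases₃ 0 e f = phases₃ 0 0 f ⬝ phases₃ c (d + e) 0 := by
            simp [phases₃_seq]
          have h2 : phases₃ 0 g k ⬝ phases₃ i j 0 =
              phases₃ (i - (g + j)) 0 0 ⬝ phases₃ 0 0 k ⬝ phases₃ (g + j) (g + j) 0 := by
            simp [phases₃_seq]
          rw [h1, h2]
          simp only [seq_assoc]
      _ = (phases₃ a b 0 ⬝ phases₃ 0 0 f) ⬝ onTop (bs θ₁) ⬝ (phases₃ c (d + e) 0 ⬝
          phases₃ (i - (g + j)) 0 0) ⬝ onBottom (bs θ₂) ⬝ (phases₃ 0 0 k ⬝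
          onTop (bs θ₃)) ⬝ (phases₃ (g + j) (g + j) 0 ⬝ phases₃ l m 0) := by
          rw [onTop_comm_phase, onBottom_comm_phase, ← onTop_bs_comm_phases]
          simp only [seq_assoc]
      _ = _ := by
          rw [← onTop_comm_phase, ← hsplit', phases₃_seq, phases₃_seq,
            hsplit' (g + j + l) (g + j + m) k]
          have h3 : phases₃ (g + j + l) (g + j + m) 0 ⬝ phases₃ 0 0 k =
            phases₃ 0 0 k ⬝ phases₃ (g + j + l) (g + j + m) 0 := by simp [phases₃_seq]
          rw [h3]
          simp only [seq_assoc, add_zero]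
  -- Final phases of the three wires. `A` sits on wire 0, so it commutes past the last bottom gate
  -- and is assigned to the middle gate.
  set A := β₄ + (g + j + l)
  set B := β₅ + (g + j + m)
  set C := β₆ + k
  refine ⟨(phase (b + β₁) ⊠ phase f) ⬝ bs α₁, (phase (a + β₂) ⊠ phase 0) ⬝ bs α₂ ⬝
    (phase A ⊠ phase 0), (phase β₃ ⊠ phase 0) ⬝ bs α₃ ⬝ (phase B ⊠ phase C),
    (Gate₂.phases _ _).seq (.bs _), ((Gate₂.phases _ _).seq (.bs _)).seq (.phases _ _),
    ((Gate₂.phases _ _).seq (.bs _)).seq (.phases _ _), ?_⟩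
  rw [left, key]
  simp only [onTop_seq, onBottom_seq, onTop_phases, onBottom_phases]
  calc _ = (phases₃ a b f ⬝ phases₃ 0 β₁ 0) ⬝ onBottom (bs α₁) ⬝ phases₃ β₂ 0 0 ⬝ onTop (bs α₂) ⬝
        phases₃ 0 β₃ 0 ⬝ onBottom (bs α₃) ⬝ (phases₃ β₄ β₅ β₆ ⬝
        phases₃ (g + j + l) (g + j + m) k) := by simp only [seq_assoc]
    _ = phases₃ 0 (b + β₁) f ⬝ (phases₃ a 0 0 ⬝ onBottom (bs α₁)) ⬝ phases₃ β₂ 0 0 ⬝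
        onTop (bs α₂) ⬝ phases₃ 0 β₃ 0 ⬝ (onBottom (bs α₃) ⬝ phases₃ A 0 0) ⬝
        phases₃ 0 B C := by
        have h1 : phases₃ a b f ⬝ phases₃ 0 β₁ 0 = phases₃ 0 (b + β₁) f ⬝ phases₃ a 0 0 := by
          simp [phases₃_seq]
        have h2 : phases₃ β₄ β₅ β₆ ⬝ phases₃ (g + j + l) (g + j + m) k =
            phases₃ A 0 0 ⬝ phases₃ 0 B C := by rw [phases₃_seq, ← hsplit'']
        rw [h1, h2]
        simp only [seq_assoc]
    _ = phases₃ 0 (b + β₁) f ⬝ onBottom (bs α₁) ⬝ (phases₃ a 0 0 ⬝ phases₃ β₂ 0 0) ⬝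
        onTop (bs α₂) ⬝ (phases₃ 0 β₃ 0 ⬝ phases₃ A 0 0) ⬝ onBottom (bs α₃) ⬝
        phases₃ 0 B C := by
        rw [← onBottom_comm_phase, onBottom_comm_phase (bs α₃)]
        simp only [seq_assoc]
    _ = _ := by
        have h1 : phases₃ 0 β₃ 0 ⬝ phases₃ A 0 0 = phases₃ A 0 0 ⬝ phases₃ 0 β₃ 0 := by
          simp [phases₃_seq]
        rw [h1, phases₃_seq, add_zero]
        simp only [seq_assoc]

theorem swap_one_two : swap 1 2 = onTop swap₂ ⬝ onBottom swap₂ := cast_swap_add 1 1 1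

theorem swap_two_one : swap 2 1 = onBottom swap₂ ⬝ onTop swap₂ := by
  have h : (onBottom swap₂ ⬝ onTop swap₂) ⬝ swap 1 2 = id 3 := by
    rw [swap_one_two, ← seq_assoc, seq_assoc (onBottom swap₂), ← onTop_seq, swap₂_swap₂, onTop_id,
      seq_id, ← onBottom_seq, swap₂_swap₂, onBottom_id]
  have := congrArg (· ⬝ swap 2 1) h
  have e : swap 1 2 ⬝ swap 2 1 = id 3 := swap_swap 1 2
  simp only [seq_assoc, id_seq] at this
  rw [← this]
  have e2 : onTop swap₂ ⬝ (swap 1 2 ⬝ swap 2 1) = onTop swap₂ ⬝ id 3 := by rw [e]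
  rw [e2, seq_id]

/-- The reversal of three wires. -/
def reverse₃ : Mor 3 3 := onTop swap₂ ⬝ onBottom swap₂ ⬝ onTop swap₂

theorem reverse₃_seq_reverse₃ : reverse₃ ⬝ reverse₃ = id 3 := by
  have h := onTop_seq swap₂ swap₂
  have h' := onBottom_seq swap₂ swap₂
  rw [swap₂_swap₂, onTop_id] at h
  rw [swap₂_swap₂, onBottom_id] at h'
  simp only [reverse₃, seq_assoc]
  rw [seq_cancel h.symm, seq_cancel h'.symm, h]

/-- Reversing the three wires exchanges the top and bottom pairs and flips each of them. It follows
from naturality of the block symmetry `swap 1 2`. -/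
theorem onBottom_eq_reverse (f : Mor 2 2) :
    onBottom f = reverse₃ ⬝ onTop (swap₂ ⬝ f ⬝ swap₂) ⬝ reverse₃ := by
  have h : onBottom f ⬝ swap 1 2 = swap 1 2 ⬝ onTop f := par_seq_swap (id 1) f
  have h' : onBottom f ⬝ reverse₃ = reverse₃ ⬝ onTop (swap₂ ⬝ f ⬝ swap₂) := by
    rw [swap_one_two] at h
    rw [reverse₃, ← seq_assoc, h]
    simp only [seq_assoc, ← onTop_seq]
    rw [seq_cancel swap₂_swap₂]
  rw [← h', seq_assoc, reverse₃_seq_reverse₃, seq_id]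

theorem onTop_eq_reverse (f : Mor 2 2) :
    onTop f = reverse₃ ⬝ onBottom (swap₂ ⬝ f ⬝ swap₂) ⬝ reverse₃ := by
  have h : swap₂ ⬝ (swap₂ ⬝ f ⬝ swap₂) ⬝ swap₂ = f := by
    simp only [seq_assoc]
    rw [seq_cancel swap₂_swap₂, swap₂_swap₂, seq_id]
  rw [onBottom_eq_reverse, h]
  simp only [seq_assoc]
  rw [reverse₃_seq_reverse₃, seq_id, seq_cancel reverse₃_seq_reverse₃]

/-- Mirror image of `top_bottom_top` under conjugation by `reverse₃`; gates are stable under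
conjugation by `swap₂`. -/
theorem bottom_top_bottom {f g h : Mor 2 2} (hf : Gate₂ f) (hg : Gate₂ g) (hh : Gate₂ h) :
    ∃ f' g' h', Gate₂ f' ∧ Gate₂ g' ∧ Gate₂ h' ∧
      onBottom f ⬝ onTop g ⬝ onBottom h = onTop f' ⬝ onBottom g' ⬝ onTop h' := by
  have hs {f : Mor 2 2} (hf : Gate₂ f) : Gate₂ (swap₂ ⬝ f ⬝ swap₂) :=
    (Gate₂.swap₂.seq hf).seq .swap₂
  obtain ⟨f', g', h', hf', hg', hh', e⟩ := top_bottom_top (hs hf) (hs hg) (hs hh)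
  refine ⟨_, _, _, hs hf', hs hg', hs hh', ?_⟩
  have c (x y z : Mor 3 3) : reverse₃ ⬝ x ⬝ reverse₃ ⬝ (reverse₃ ⬝ y ⬝ reverse₃) ⬝
      (reverse₃ ⬝ z ⬝ reverse₃) = reverse₃ ⬝ (x ⬝ y ⬝ z) ⬝ reverse₃ := by
    simp only [seq_assoc]
    rw [seq_cancel reverse₃_seq_reverse₃, seq_cancel reverse₃_seq_reverse₃]
  have d {x y : Mor 2 2} (h : onBottom x = reverse₃ ⬝ onTop y ⬝ reverse₃) :
      onTop y = reverse₃ ⬝ onBottom x ⬝ reverse₃ := by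
    rw [h]
    simp only [seq_assoc]
    rw [reverse₃_seq_reverse₃, seq_id, seq_cancel reverse₃_seq_reverse₃]
  rw [onBottom_eq_reverse f, onTop_eq_reverse g, onBottom_eq_reverse h, c, e,
    d (onBottom_eq_reverse f'), d (onBottom_eq_reverse h'),
    onBottom_eq_reverse (swap₂ ⬝ g' ⬝ swap₂), c]
  congr 4
  simp only [seq_assoc]
  rw [seq_cancel swap₂_swap₂, swap₂_swap₂, seq_id]

/-! ## Placing circuits on some of the wires -/

/-- Add an idle wire at the bottom. -/
def pad {n m : ℕ} (f : Mor n m) : Mor (n + 1) (m + 1) := f ⊠ id 1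

/-- A gate on the last two wires. -/
def gateAt (n : ℕ) (f : Mor 2 2) : Mor (n + 2) (n + 2) := par (n := n) (m := n) (id n) f

/-- A phase shifter on the last wire. -/
def phaseAt (n : ℕ) (φ : ℝ) : Mor (n + 1) (n + 1) := par (n := n) (m := n) (id n) (phase φ)

/-- A morphism on the last three wires. -/
def threeAt (n : ℕ) (f : Mor 3 3) : Mor (n + 3) (n + 3) := par (n := n) (m := n) (id n) f

@[simp] theorem pad_id (n : ℕ) : pad (id n) = id (n + 1) := par_id n 1

theorem pad_seq {n m k : ℕ} (f : Mor n m) (g : Mor m k) : pad (f ⬝ g) = pad f ⬝ pad g := by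
  rw [pad, pad, pad, par_seq_par, seq_id]

theorem id_par_seq {n m k : ℕ} (a : ℕ) (f : Mor n m) (g : Mor m k) :
    id a ⊠ (f ⬝ g) = (id a ⊠ f) ⬝ (id a ⊠ g) := by
  rw [par_seq_par, seq_id]

theorem gateAt_seq (n : ℕ) (f g : Mor 2 2) : gateAt n (f ⬝ g) = gateAt n f ⬝ gateAt n g :=
  id_par_seq n f g

@[simp] theorem gateAt_id (n : ℕ) : gateAt n (id 2) = id (n + 2) := par_id n 2

theorem threeAt_seq (n : ℕ) (f g : Mor 3 3) : threeAt n (f ⬝ g) = threeAt n f ⬝ threeAt n g :=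
  id_par_seq n f g

theorem gateAt_zero (f : Mor 2 2) : gateAt 0 f = f := cast_empty_par f

theorem phaseAt_zero (φ : ℝ) : phaseAt 0 φ = phase φ := cast_empty_par (phase φ)

/-- The equalities are arguments so that, for numerals `n` and `m`, they can be `rfl` and the cast
disappears. -/
theorem id_par_id_par {n m : ℕ} (a : ℕ) (f : Mor n m) (h : a + 1 + n = a + (1 + n))
    (h' : a + 1 + m = a + (1 + m)) : cast h h' (id (a + 1) ⊠ f) = id a ⊠ (id 1 ⊠ f) := by
  rw [← par_id a 1]; exact cast_par_assoc _ _ _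

theorem phaseAt_succ (n : ℕ) (φ : ℝ) : phaseAt (n + 1) φ = gateAt n (phase 0 ⊠ phase φ) := by
  rw [phase_zero]; exact id_par_id_par n (phase φ) rfl rfl

theorem threeAt_onBottom (n : ℕ) (f : Mor 2 2) : threeAt n (onBottom f) = gateAt (n + 1) f :=
  (id_par_id_par n f rfl rfl).symm

theorem threeAt_onTop (n : ℕ) (f : Mor 2 2) : threeAt n (onTop f) = pad (gateAt n f) :=
  par_par_one (id n) f (id 1)

theorem pad_phaseAt (n : ℕ) (φ : ℝ) : pad (phaseAt n φ) = gateAt n (phase φ ⊠ id 1) :=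
  (par_par_one (id n) (phase φ) (id 1)).symm

theorem pad_pad {n m : ℕ} (f : Mor n m) :
    pad (pad f) = par (n := n) (m := m) (n' := 2) (m' := 2) f (id 2) := by
  rw [← par_id 1 1]; exact (par_par_one f (id 1) (id 1)).symm

theorem gateAt_comm {n : ℕ} (f : Mor n n) (g : Mor 2 2) :
    gateAt n g ⬝ pad (pad f) = pad (pad f) ⬝ gateAt n g := by
  rw [pad_pad]; exact (seq_id_par_comm f g).symm

/-- The matrix of a circuit with an additional idle wire. -/
def padMat {n m : ℕ} (A : Matrix (Fin m) (Fin n) ℂ) : Matrix (Fin (m + 1)) (Fin (n + 1)) ℂ :=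
  blockDiag A 1

/-- The matrix of a gate on the last two wires. -/
def gateMat (n : ℕ) (A : Matrix (Fin 2) (Fin 2) ℂ) : Matrix (Fin (n + 2)) (Fin (n + 2)) ℂ :=
  blockDiag (1 : Matrix (Fin n) (Fin n) ℂ) A

theorem padMat_mul {n m k : ℕ} (A : Matrix (Fin k) (Fin m) ℂ) (B : Matrix (Fin m) (Fin n) ℂ) :
    padMat (A * B) = padMat A * padMat B := by
  rw [padMat, padMat, padMat, blockDiag_mul, mul_one]

@[simp] theorem padMat_one (n : ℕ) : padMat (1 : Matrix (Fin n) (Fin n) ℂ) = 1 := blockDiag_one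

@[simp] theorem padMat_castSucc_castSucc {n m : ℕ} (A : Matrix (Fin m) (Fin n) ℂ) (i : Fin m)
    (j : Fin n) : padMat A i.castSucc j.castSucc = A i j :=
  blockDiag_castAdd_castAdd A 1 i j

@[simp] theorem padMat_castSucc_last {n m : ℕ} (A : Matrix (Fin m) (Fin n) ℂ) (i : Fin m) :
    padMat A i.castSucc (Fin.last n) = 0 :=
  blockDiag_castAdd_natAdd A 1 i 0

@[simp] theorem padMat_last_castSucc {n m : ℕ} (A : Matrix (Fin m) (Fin n) ℂ) (j : Fin n) :
    padMat A (Fin.last m) j.castSucc = 0 :=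
  blockDiag_natAdd_castAdd A 1 0 j

@[simp] theorem padMat_last_last {n m : ℕ} (A : Matrix (Fin m) (Fin n) ℂ) :
    padMat A (Fin.last m) (Fin.last n) = 1 :=
  blockDiag_natAdd_natAdd A 1 0 0

theorem padMat_injective {n m : ℕ} {A B : Matrix (Fin m) (Fin n) ℂ} (h : padMat A = padMat B) :
    A = B := by
  ext i j
  rw [← padMat_castSucc_castSucc A, h, padMat_castSucc_castSucc]

theorem padMat_mem_unitary {n : ℕ} {A : Matrix (Fin n) (Fin n) ℂ}
    (hA : A ∈ unitaryGroup (Fin n) ℂ) : padMat A ∈ unitaryGroup (Fin (n + 1)) ℂ :=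
  blockDiag_mem_unitary hA (one_mem _)

theorem gateMat_castSucc_last (n : ℕ) (A : Matrix (Fin 2) (Fin 2) ℂ) :
    gateMat n A (Fin.last n).castSucc (Fin.last (n + 1)) = A 0 1 :=
  blockDiag_natAdd_natAdd (1 : Matrix (Fin n) (Fin n) ℂ) A 0 1

theorem gateMat_last_last (n : ℕ) (A : Matrix (Fin 2) (Fin 2) ℂ) :
    gateMat n A (Fin.last (n + 1)) (Fin.last (n + 1)) = A 1 1 :=
  blockDiag_natAdd_natAdd (1 : Matrix (Fin n) (Fin n) ℂ) A 1 1

theorem sem_pad {n m : ℕ} {f : Mor n m} {A : Matrix (Fin m) (Fin n) ℂ} (h : sem f = spatial A) :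
    sem (pad f) = spatial (padMat A) := sem_par_spatial h (sem_id_spatial 1)

theorem sem_gateAt (n : ℕ) {f : Mor 2 2} {A : Matrix (Fin 2) (Fin 2) ℂ} (h : sem f = spatial A) :
    sem (gateAt n f) = spatial (gateMat n A) := sem_par_spatial (sem_id_spatial n) h

/-! ## Passive circuits -/

/-- Morphisms generated by a class of morphisms on all wires but the last, and by gates on the last
two wires. -/
inductive PassiveStep (n : ℕ) (S : Mor (n + 1) (n + 1) → Prop) : Mor (n + 2) (n + 2) → Prop
  | id : PassiveStep n S (id (n + 2))
  | seq {f g : Mor (n + 2) (n + 2)} : PassiveStep n S f → PassiveStep n S g → PassiveStep n S (f ⬝ g)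
  | pad {f : Mor (n + 1) (n + 1)} : S f → PassiveStep n S (Mor.pad f)
  | gate {f : Mor 2 2} : Gate₂ f → PassiveStep n S (gateAt n f)

/-- Passive circuits: those built from phase shifters and beam splitters on adjacent wires. -/
def Passive : (n : ℕ) → Mor n n → Prop
  | 0 => fun f => f = id 0
  | 1 => fun f => ∃ φ, f = phase φ
  | n + 2 => PassiveStep n (Passive (n + 1))

theorem Passive.id (n : ℕ) : Passive n (id n) := by
  match n with
  | 0 => rfl
  | 1 => exact ⟨0, phase_zero.symm⟩
  | n + 2 => exact PassiveStep.id

theorem Passive.seq {n : ℕ} {f g : Mor n n} (hf : Passive n f) (hg : Passive n g) :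
    Passive n (f ⬝ g) := by
  match n with
  | 0 => obtain rfl := hf; obtain rfl := hg; exact id_seq _
  | 1 =>
    obtain ⟨a, rfl⟩ := hf
    obtain ⟨b, rfl⟩ := hg
    exact ⟨_, phase_add a b⟩
  | n + 2 => exact PassiveStep.seq hf hg

theorem Passive.pad {n : ℕ} {f : Mor n n} (hf : Passive n f) : Passive (n + 1) (Mor.pad f) := by
  match n with
  | 0 => obtain rfl := hf; exact ⟨0, (pad_id 0).trans phase_zero.symm⟩
  | n + 1 => exact PassiveStep.pad hf

theorem Passive.gate (n : ℕ) {f : Mor 2 2} (hf : Gate₂ f) : Passive (n + 2) (gateAt n f) :=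
  PassiveStep.gate hf

theorem Passive.phase (n : ℕ) (φ : ℝ) : Passive (n + 1) (phaseAt n φ) := by
  match n with
  | 0 => exact ⟨φ, phaseAt_zero _⟩
  | n + 1 =>
    rw [phaseAt_succ]
    exact .gate n (.phases 0 φ)

theorem Passive.exists_inverse {n : ℕ} {f : Mor n n} (hf : Passive n f) :
    ∃ g, Passive n g ∧ f ⬝ g = Mor.id n ∧ g ⬝ f = Mor.id n := by
  induction n with
  | zero => obtain rfl := hf; exact ⟨_, .id 0, id_seq _, id_seq _⟩
  | succ n ih =>
    cases n with
    | zero =>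
      obtain ⟨φ, rfl⟩ := hf
      exact ⟨Mor.phase (-φ), ⟨_, rfl⟩, by rw [phase_add]; simp, by rw [phase_add]; simp⟩
    | succ n =>
      change PassiveStep n (Passive (n + 1)) f at hf
      induction hf with
      | id => exact ⟨_, .id _, id_seq _, id_seq _⟩
      | @seq f₁ f₂ _ _ ih₁ ih₂ =>
        obtain ⟨g₁, h₁, e₁, e₁'⟩ := ih₁
        obtain ⟨g₂, h₂, e₂, e₂'⟩ := ih₂
        exact ⟨g₂ ⬝ g₁, h₂.seq h₁, by rw [seq_assoc, seq_cancel e₂, e₁],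
          by rw [seq_assoc, seq_cancel e₁', e₂']⟩
      | pad h =>
        obtain ⟨g, hg, e, e'⟩ := ih h
        exact ⟨Mor.pad g, hg.pad, by rw [← pad_seq, e, pad_id], by rw [← pad_seq, e', pad_id]⟩
      | gate h =>
        obtain ⟨g, hg, e, e'⟩ := h.exists_inverse
        exact ⟨gateAt n g, .gate n hg, by rw [← gateAt_seq, e, gateAt_id],
          by rw [← gateAt_seq, e', gateAt_id]⟩

theorem Passive.sem {n : ℕ} {f : Mor n n} (hf : Passive n f) :
    ∃ C ∈ unitaryGroup (Fin n) ℂ, Mor.sem f = spatial C := by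
  induction n with
  | zero => obtain rfl := hf; exact ⟨1, one_mem _, sem_id_spatial 0⟩
  | succ n ih =>
    cases n with
    | zero =>
      obtain ⟨φ, rfl⟩ := hf
      exact ⟨_, phaseMat_mem_unitary φ, sem_phase φ⟩
    | succ n =>
      change PassiveStep n (Passive (n + 1)) f at hf
      induction hf with
      | id => exact ⟨1, one_mem _, sem_id_spatial _⟩
      | seq _ _ ih₁ ih₂ =>
        obtain ⟨C₁, h₁, e₁⟩ := ih₁
        obtain ⟨C₂, h₂, e₂⟩ := ih₂
        exact ⟨C₂ * C₁, mul_mem h₂ h₁, sem_seq_spatial e₁ e₂⟩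
      | pad h =>
        obtain ⟨C, hC, e⟩ := ih h
        exact ⟨_, padMat_mem_unitary hC, sem_pad e⟩
      | gate h =>
        obtain ⟨C, hC, e⟩ := h.sem
        exact ⟨gateMat n C, blockDiag_mem_unitary (one_mem _) hC, sem_gateAt n e⟩

theorem passive_two {f : Mor 2 2} (hf : Passive 2 f) : Gate₂ f := by
  change PassiveStep 0 (Passive 1) f at hf
  induction hf with
  | id => exact .id
  | seq _ _ h₁ h₂ => exact h₁.seq h₂
  | pad h =>
    obtain ⟨φ, rfl⟩ := h
    rw [Mor.pad, ← phase_zero]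
    exact .phases _ _
  | gate h => rw [gateAt_zero]; exact h

/-- A passive circuit factors through a single gate involving the last wire. -/
theorem Passive.exists_factorization {n : ℕ} {f : Mor (n + 2) (n + 2)} (hf : Passive (n + 2) f) :
    ∃ g x g', Passive (n + 1) g ∧ Gate₂ x ∧ Passive (n + 1) g' ∧
      f = Mor.pad g ⬝ gateAt n x ⬝ Mor.pad g' := by
  induction n with
  | zero =>
    refine ⟨_, f, _, .id 1, passive_two hf, .id 1, ?_⟩
    rw [gateAt_zero, pad_id, id_seq, seq_id]
  | succ n ih =>
    -- It suffices that prefixes in factored form are stable under appending a generator.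
    suffices H : ∀ z : Mor (n + 3) (n + 3), (∃ g x g', Passive (n + 2) g ∧ Gate₂ x ∧
        Passive (n + 2) g' ∧ z = Mor.pad g ⬝ gateAt (n + 1) x ⬝ Mor.pad g') →
        ∃ g x g', Passive (n + 2) g ∧ Gate₂ x ∧ Passive (n + 2) g' ∧
        z ⬝ f = Mor.pad g ⬝ gateAt (n + 1) x ⬝ Mor.pad g' by
      simpa using H (Mor.id _) ⟨_, _, _, .id _, .id, .id _, by simp⟩
    change PassiveStep (n + 1) (Passive (n + 2)) f at hf
    induction hf with
    | id => intro z h; simpa using h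
    | seq _ _ h₁ h₂ => intro z h; rw [← seq_assoc]; exact h₂ _ (h₁ _ h)
    | pad h =>
      rintro z ⟨g, x, g', hg, hx, hg', rfl⟩
      exact ⟨g, x, _, hg, hx, hg'.seq h, by rw [seq_assoc, ← pad_seq]⟩
    | @gate y hy =>
      rintro z ⟨g, x, g', hg, hx, hg', rfl⟩
      -- The only hard case: `x` and the new gate `y` are separated by `g'`. By induction `g'` is
      -- `k`, a gate `w`, then `k'`; padded twice, `k` and `k'` commute past gates on the last two
      -- wires. The triple `x`, `w`, `y` is then of shape bottom-top-bottom, and rewriting it as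
      -- top-bottom-top leaves one gate on the last wire.
      obtain ⟨k, w, k', hk, hw, hk', rfl⟩ := ih hg'
      obtain ⟨f', g', h', hf', hg', hh', e⟩ := bottom_top_bottom hx hw hy
      have e' := congrArg (threeAt n) e
      simp only [threeAt_seq, threeAt_onBottom, threeAt_onTop] at e'
      refine ⟨g ⬝ Mor.pad k ⬝ gateAt n f', g', gateAt n h' ⬝ Mor.pad k',
        (hg.seq hk.pad).seq (.gate n hf'), hg', (Passive.gate n hh').seq hk'.pad, ?_⟩
      simp only [pad_seq]
      calc _ = Mor.pad g ⬝ (gateAt (n + 1) x ⬝ Mor.pad (Mor.pad k)) ⬝ Mor.pad (gateAt n w) ⬝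
            (Mor.pad (Mor.pad k') ⬝ gateAt (n + 1) y) := by simp only [seq_assoc]
        _ = Mor.pad g ⬝ Mor.pad (Mor.pad k) ⬝
            (gateAt (n + 1) x ⬝ Mor.pad (gateAt n w) ⬝ gateAt (n + 1) y) ⬝
            Mor.pad (Mor.pad k') := by
            rw [← gateAt_comm, gateAt_comm]; simp only [seq_assoc]
        _ = _ := by
            rw [e']; simp only [seq_assoc]

/-! ## Completeness for passive circuits -/

theorem phaseMat_eq_one_iff {φ : ℝ} : phaseMat φ = 1 ↔ exp (I * φ) = 1 := by
  constructor
  · intro h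
    have := congrFun (congrFun h 0) 0
    simpa [phaseMat] using this
  · intro h
    ext i j; fin_cases i; fin_cases j; simp [phaseMat, h]

/-- In a factorisation through one gate on the last wire, identity semantics forces that gate to fix
the last coordinate, so it is only a phase on its first wire. The circuit is then a padded passive
circuit with one wire fewer. -/
theorem Passive.eq_id {n : ℕ} {f : Mor n n} (hf : Passive n f) (h : Mor.sem f = spatial 1) :
    f = Mor.id n := by
  induction n with
  | zero => exact hf
  | succ n ih =>
    cases n with
    | zero =>
      obtain ⟨φ, rfl⟩ := hf
      rw [sem_phase] at h
      have h' := phaseMat_eq_one_iff.1 (spatial_injective h)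
      rw [phase_congr (b := 0) (by rw [h']; simp), phase_zero]
    | succ n =>
      obtain ⟨g, x, g', hg, hx, hg', rfl⟩ := hf.exists_factorization
      obtain ⟨G, hG, eG⟩ := hg.sem
      obtain ⟨G', hG', eG'⟩ := hg'.sem
      obtain ⟨a, b, α, c, d, hα, rfl⟩ := hx.normalForm
      set X := phases₂Mat c d * (bsMat α * phases₂Mat a b) with hX
      have eX : Mor.sem ((Mor.phase a ⊠ Mor.phase b) ⬝ bs α ⬝ (Mor.phase c ⊠ Mor.phase d)) =
          spatial X :=
        sem_seq_spatial (sem_seq_spatial (sem_par_spatial (sem_phase a) (sem_phase b)) (sem_bs α))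
          (sem_par_spatial (sem_phase c) (sem_phase d))
      have e : padMat G' * (gateMat n X * padMat G) = 1 := by
        apply spatial_injective
        rw [← h]
        exact (sem_seq_spatial (sem_seq_spatial (sem_pad eG) (sem_gateAt n eX)) (sem_pad eG')).symm
      -- Moving the padded unitary matrices to the other side shows that the gate matrix is itself
      -- padded, so its last column is a basis vector.
      have e' : gateMat n X = padMat (star G' * star G) := by
        have h1 : padMat (star G') * padMat G' = 1 := by
          rw [← padMat_mul, Unitary.star_mul_self_of_mem hG', padMat_one]
        have h2 : padMat G * padMat (star G) = 1 := by
          rw [← padMat_mul, Unitary.mul_star_self_of_mem hG, padMat_one]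
        have := congrArg (fun M => padMat (star G') * M * padMat (star G)) e
        simp only [mul_one, ← mul_assoc, h1, one_mul] at this
        rwa [mul_assoc, h2, mul_one, ← padMat_mul] at this
      have x01 : X 0 1 = 0 := by
        rw [← gateMat_castSucc_last n X, e', padMat_castSucc_last]
      have x11 : X 1 1 = 1 := by
        rw [← gateMat_last_last n X, e', padMat_last_last]
      -- The entry `X 0 1` is `I * sin α` times unit phases, and on `[0, π)` the sine vanishes only
      -- at `0`.
      have hsin : α = 0 := by
        rw [hX, phases₂Mat_eq, phases₂Mat_eq] at x01
        simp [bsMat, Matrix.mul_apply, Fin.sum_univ_two, Complex.exp_ne_zero] at x01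
        have hs : Real.sin α = 0 := by exact_mod_cast x01
        rcases hα.1.eq_or_lt with h | h
        · exact h.symm
        · exact absurd hs (Real.sin_pos_of_pos_of_lt_pi h hα.2).ne'
      subst hsin
      have hx' : (Mor.phase a ⊠ Mor.phase b) ⬝ bs 0 ⬝ (Mor.phase c ⊠ Mor.phase d) =
          Mor.phase (a + c) ⊠ Mor.id 1 := by
        rw [bs_zero, seq_id, phases₂_seq]
        congr 1
        rw [← phase_zero]
        apply phase_congr
        rw [hX, phases₂Mat_eq, phases₂Mat_eq, bsMat_zero] at x11
        simp [Matrix.mul_apply, Fin.sum_univ_two] at x11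
        rw [← Complex.exp_add] at x11
        simp only [ofReal_add, ofReal_zero, mul_zero, Complex.exp_zero]
        rw [← x11]
        ring_nf
      have hpad : Mor.pad g ⬝ gateAt n ((Mor.phase a ⊠ Mor.phase b) ⬝ bs 0 ⬝
          (Mor.phase c ⊠ Mor.phase d)) ⬝ Mor.pad g' =
          Mor.pad (g ⬝ phaseAt n (a + c) ⬝ g') := by
        rw [hx', pad_seq, pad_seq, pad_phaseAt]
      rw [hpad] at h ⊢
      have hp := (hg.seq (.phase n (a + c))).seq hg'
      obtain ⟨C, hC, eC⟩ := hp.sem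
      have hC1 : C = 1 := padMat_injective
        (by rw [padMat_one]; exact spatial_injective ((sem_pad eC).symm.trans h))
      rw [ih hp (by rw [eC, hC1]), pad_id]

/-- Passive circuits with the same semantics are equal. -/
theorem Passive.ext {n : ℕ} {f g : Mor n n} (hf : Passive n f) (hg : Passive n g)
    (h : Mor.sem f = Mor.sem g) : f = g := by
  obtain ⟨k, hk, e, e'⟩ := hg.exists_inverse
  have : f ⬝ k = Mor.id n := (hf.seq hk).eq_id (by
    rw [sem_seq, h, ← sem_seq, e, sem_id_spatial])
  rw [← seq_id f, ← e', ← seq_assoc, this, id_seq]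

/-! ## Every unitary matrix is the semantics of a passive circuit -/

theorem sem_swap₂ : sem swap₂ = spatial !![0, 1; 1, 0] := by
  refine state_two_hom_ext (fun c => ?_) (fun c => ?_)
  · exact (interp_swap_ket_zero c).trans (by simp [Fin.sum_univ_two])
  · exact (interp_swap_ket_one c).trans (by simp [Fin.sum_univ_two])

/-- Every vector can be sent by a gate to a vector supported on the last coordinate. -/
theorem exists_gate₂_mulVec (a b : ℂ) : ∃ x C, Gate₂ x ∧ Mor.sem x = spatial C ∧
    C 0 0 * a + C 0 1 * b = 0 := by
  -- The elimination lemma pairs its arguments with conjugated matrix entries; it is applied to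
  -- conjugates and conjugated back. It controls the second row, which the final swap moves to the
  -- first.
  obtain ⟨α, β, h⟩ := exists_killAngles (star a) (star b)
  have hk := congrArg star h.kill
  refine ⟨(phase β ⊠ phase 0) ⬝ bs α ⬝ swap₂, _, ((Gate₂.phases _ _).seq (.bs _)).seq .swap₂,
    sem_seq_spatial (sem_seq_spatial (sem_par_spatial (sem_phase β) (sem_phase 0)) (sem_bs α))
    sem_swap₂, ?_⟩
  have h0 : phaseMat 0 = 1 := by
    ext i j; fin_cases i; fin_cases j; simp [phaseMat]
  rw [h0]
  change ((!![0, 1; 1, 0] : Matrix (Fin 2) (Fin 2) ℂ) * phasedBsMat α β) 0 0 * a +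
    ((!![0, 1; 1, 0] : Matrix (Fin 2) (Fin 2) ℂ) * phasedBsMat α β) 0 1 * b = 0
  simp [Matrix.mul_apply, Fin.sum_univ_two] at hk ⊢
  linear_combination hk

/-- All coordinates but the last are gathered into the penultimate one by induction, and a gate on
the last two wires then empties that one. -/
theorem exists_passive_mulVec (n : ℕ) (v : Fin (n + 1) → ℂ) : ∃ f C, Passive (n + 1) f ∧
    Mor.sem f = spatial C ∧ ∀ i : Fin n, (C *ᵥ v) i.castSucc = 0 := by
  induction n with
  | zero => exact ⟨_, 1, .id 1, sem_id_spatial 1, fun i => i.elim0⟩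
  | succ n ih =>
    obtain ⟨f, C, hf, eC, h⟩ := ih (fun i => v i.castSucc)
    set w := padMat C *ᵥ v with hw
    have hw0 (i : Fin n) : w i.castSucc.castSucc = 0 := by
      rw [← h i, hw]
      simp [Matrix.mulVec, dotProduct, Fin.sum_univ_castSucc (n := n + 1)]
    obtain ⟨x, X, hx, eX, h'⟩ := exists_gate₂_mulVec (w (Fin.last n).castSucc) (w (Fin.last (n + 1)))
    refine ⟨_, _, hf.pad.seq (.gate n hx), sem_seq_spatial (sem_pad eC) (sem_gateAt n eX), ?_⟩
    intro i
    rw [← Matrix.mulVec_mulVec, ← hw]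
    simp only [Matrix.mulVec, dotProduct, Fin.sum_univ_castSucc (n := n + 1),
      Fin.sum_univ_castSucc (n := n), hw0, mul_zero, Finset.sum_const_zero, zero_add]
    refine Fin.lastCases ?_ (fun i => ?_) i
    · rw [gateMat_castSucc_last]
      have e := blockDiag_natAdd_natAdd (1 : Matrix (Fin n) (Fin n) ℂ) X 0 0
      have e' : gateMat n X (Fin.last n).castSucc (Fin.last n).castSucc = X 0 0 := e
      rw [e', h']
    · have e : gateMat n X i.castSucc.castSucc (Fin.last n).castSucc = 0 :=
        blockDiag_castAdd_natAdd (1 : Matrix (Fin n) (Fin n) ℂ) X i 0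
      have e' : gateMat n X i.castSucc.castSucc (Fin.last (n + 1)) = 0 :=
        blockDiag_castAdd_natAdd (1 : Matrix (Fin n) (Fin n) ℂ) X i 1
      rw [e, e']; simp

/-- A unitary matrix whose last column is the last basis vector is a padded unitary matrix. -/
theorem exists_eq_padMat {n : ℕ} {U : Matrix (Fin (n + 1)) (Fin (n + 1)) ℂ}
    (hU : U ∈ unitaryGroup (Fin (n + 1)) ℂ) (h : ∀ i : Fin n, U i.castSucc (Fin.last n) = 0)
    (h' : U (Fin.last n) (Fin.last n) = 1) : ∃ A ∈ unitaryGroup (Fin n) ℂ, U = padMat A := by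
  -- The other columns are orthogonal to the last one, which is a basis vector, so they vanish in
  -- the last row.
  have hrow : ∀ j : Fin n, U (Fin.last n) j.castSucc = 0 := by
    intro j
    have e := congrFun (congrFun ((mem_unitaryGroup_iff').1 hU) (Fin.last n)) j.castSucc
    simpa [Matrix.mul_apply, star_eq_conjTranspose, Fin.sum_univ_castSucc, h, h',
      Matrix.one_apply, Fin.ext_iff, j.isLt.ne'] using e
  have hpad : U = padMat (U.submatrix Fin.castSucc Fin.castSucc) := by
    ext i j
    refine Fin.lastCases ?_ (fun i => ?_) i <;> refine Fin.lastCases ?_ (fun j => ?_) j <;>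
      simp [h, h', hrow]
  refine ⟨_, ?_, hpad⟩
  rw [mem_unitaryGroup_iff] at hU ⊢
  apply padMat_injective
  rw [padMat_mul, padMat_one, ← hU, ← hpad]
  congr 1
  conv_rhs => rw [hpad]
  rw [star_eq_conjTranspose, star_eq_conjTranspose, padMat, padMat, blockDiag_conjTranspose,
    conjTranspose_one]

/-- Every unitary matrix is the semantics of a passive circuit. -/
theorem exists_passive_sem_eq {n : ℕ} {U : Matrix (Fin n) (Fin n) ℂ}
    (hU : U ∈ unitaryGroup (Fin n) ℂ) : ∃ f, Passive n f ∧ Mor.sem f = spatial U := by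
  induction n with
  | zero => exact ⟨_, .id 0, by rw [sem_id_spatial]; congr 1; exact Subsingleton.elim _ _⟩
  | succ n ih =>
    -- A passive `f` clears the last column of `U` except for its last entry `z`, a phase `-φ` turns
    -- `z` into `1`, and the result is a padded smaller unitary matrix. The circuit sought realises
    -- that matrix, then inverts `f` and the phase.
    obtain ⟨f, C, hf, eC, h⟩ := exists_passive_mulVec n (fun i => U i (Fin.last n))
    obtain ⟨C', hC', eC'⟩ := hf.sem
    obtain rfl := spatial_injective (eC.symm.trans eC')
    have hV : C * U ∈ unitaryGroup (Fin (n + 1)) ℂ := mul_mem hC' hU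
    have hcol (i : Fin n) : (C * U) i.castSucc (Fin.last n) = 0 := h i
    set z := (C * U) (Fin.last n) (Fin.last n) with hz
    have hz1 : z * (starRingEnd ℂ) z = 1 := by
      have e := congrFun (congrFun ((mem_unitaryGroup_iff').1 hV) (Fin.last n)) (Fin.last n)
      rw [Matrix.mul_apply, Fin.sum_univ_castSucc] at e
      simp only [star_eq_conjTranspose, conjTranspose_apply, hcol, mul_zero,
        Finset.sum_const_zero, zero_add, ← hz] at e
      rw [mul_comm]; simpa using e
    obtain ⟨φ, -, hφ⟩ := exists_phaseMat_eq (norm_eq_one_of_mul_conj hz1)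
    have hp := Passive.phase n (-φ)
    have ep : Mor.sem (phaseAt n (-φ)) = spatial (blockDiag (n := n) (m := n) 1 (phaseMat (-φ))) :=
      sem_par_spatial (sem_id_spatial n) (sem_phase _)
    set D : Matrix (Fin (n + 1)) (Fin (n + 1)) ℂ :=
      blockDiag (n := n) (m := n) 1 (phaseMat (-φ)) with hD
    have hDU : D ∈ unitaryGroup (Fin (n + 1)) ℂ :=
      blockDiag_mem_unitary (one_mem _) (phaseMat_mem_unitary _)
    have dl : D (Fin.last n) (Fin.last n) = exp (I * ((-φ : ℝ) : ℂ)) :=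
      blockDiag_natAdd_natAdd (1 : Matrix (Fin n) (Fin n) ℂ) (phaseMat (-φ)) 0 0
    have dc (i : Fin n) : D i.castSucc (Fin.last n) = 0 :=
      blockDiag_castAdd_natAdd (1 : Matrix (Fin n) (Fin n) ℂ) (phaseMat (-φ)) i 0
    obtain ⟨A, hA, eA⟩ := exists_eq_padMat (mul_mem hDU hV)
      (fun i => by
        rw [Matrix.mul_apply, Fin.sum_univ_castSucc]
        simp [hcol, dc])
      (by
        rw [Matrix.mul_apply, Fin.sum_univ_castSucc, ← hz, dl, ← hφ]
        simp only [hcol, mul_zero, Finset.sum_const_zero, zero_add, ← Complex.exp_add]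
        simp)
    obtain ⟨g, hg, eg⟩ := ih hA
    obtain ⟨k, hk, e, e'⟩ := (hf.seq hp).exists_inverse
    refine ⟨Mor.pad g ⬝ k, hg.pad.seq hk, ?_⟩
    rw [sem_seq, sem_pad eg, ← eA, spatial_mul, spatial_mul, ← ep, ← eC]
    rw [← LinearMap.comp_assoc (spatial U), ← sem_seq, ← LinearMap.comp_assoc, ← sem_seq, e, sem_id,
      LinearMap.id_comp]

end Mor

section Active

open Matrix

/-! ## Matrices with the same Gram matrix -/

/-- The assignment `S x ↦ T x` is well defined and isometric on the range of `S`; in finite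
dimension an isometry of a subspace extends to the whole space. -/
theorem exists_linearIsometry_comp_eq {F E : Type*} [AddCommGroup F] [Module ℂ F]
    [NormedAddCommGroup E] [InnerProductSpace ℂ E] [FiniteDimensional ℂ E] (S T : F →ₗ[ℂ] E)
    (h : ∀ x, ‖S x‖ = ‖T x‖) : ∃ L : E →ₗᵢ[ℂ] E, ∀ x, L (S x) = T x := by
  have hker : LinearMap.ker S ≤ LinearMap.ker T := by
    intro x hx
    rw [LinearMap.mem_ker] at hx ⊢
    rw [← norm_eq_zero, ← h, hx, norm_zero]
  let f : LinearMap.range S →ₗ[ℂ] E :=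
    (LinearMap.ker S).liftQ T hker ∘ₗ S.quotKerEquivRange.symm.toLinearMap
  have hf (x : F) : f ⟨S x, LinearMap.mem_range_self S x⟩ = T x := by
    have : S.quotKerEquivRange.symm ⟨S x, LinearMap.mem_range_self S x⟩ =
        (LinearMap.ker S).mkQ x := S.quotKerEquivRange_symm_apply_image x _
    simp [f, this]
  let L : LinearMap.range S →ₗᵢ[ℂ] E := ⟨f, by
    rintro ⟨_, x, rfl⟩
    rw [hf]; exact (h x).symm⟩
  refine ⟨L.extend, fun x => ?_⟩
  have := L.extend_apply ⟨S x, LinearMap.mem_range_self S x⟩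
  exact this.trans (hf x)

theorem inner_toEuclideanLin {κ ι : Type*} [Fintype κ] [DecidableEq κ] [Fintype ι] [DecidableEq ι]
    (S : Matrix ι κ ℂ) (x y : EuclideanSpace ℂ κ) :
    inner ℂ (toEuclideanLin S x) (toEuclideanLin S y) = inner ℂ x (toEuclideanLin (Sᴴ * S) y) := by
  rw [← LinearMap.adjoint_inner_right, ← Matrix.toEuclideanLin_conjTranspose_eq_adjoint]
  congr 1
  simp [toEuclideanLin]

/-- Two matrices with the same Gram matrix differ by a unitary matrix. -/
theorem exists_unitary_mul_eq {κ ι : Type*} [Fintype κ] [DecidableEq κ] [Fintype ι] [DecidableEq ι]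
    {S T : Matrix ι κ ℂ} (h : Sᴴ * S = Tᴴ * T) : ∃ B ∈ unitaryGroup ι ℂ, B * S = T := by
  have hn (x : EuclideanSpace ℂ κ) : ‖toEuclideanLin S x‖ = ‖toEuclideanLin T x‖ := by
    have h2 := inner_toEuclideanLin S x x
    rw [h, ← inner_toEuclideanLin, inner_self_eq_norm_sq_to_K, inner_self_eq_norm_sq_to_K] at h2
    have h3 : ‖toEuclideanLin S x‖ ^ 2 = ‖toEuclideanLin T x‖ ^ 2 := by exact_mod_cast h2
    exact (sq_eq_sq₀ (norm_nonneg _) (norm_nonneg _)).1 h3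
  obtain ⟨L, hL⟩ := exists_linearIsometry_comp_eq _ _ hn
  obtain ⟨B, hB⟩ := (toEuclideanLin (𝕜 := ℂ) (m := ι) (n := ι)).surjective L.toLinearMap
  refine ⟨B, ?_, ?_⟩
  · rw [mem_unitaryGroup_iff']
    apply toEuclideanLin.injective
    refine LinearMap.ext fun x => ?_
    refine ext_inner_left ℂ fun y => ?_
    rw [star_eq_conjTranspose, ← inner_toEuclideanLin, hB]
    refine (L.inner_map_map y x).trans ?_
    simp [toEuclideanLin]
  · apply toEuclideanLin.injective
    refine LinearMap.ext fun x => ?_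
    have : toEuclideanLin (B * S) x = toEuclideanLin B (toEuclideanLin S x) := by
      simp [toEuclideanLin]
    rw [this, hB]
    exact hL x

/-- The matrix of the inclusion of the first `n` of `N` coordinates. -/
def inclMat (n N : ℕ) : Matrix (Fin N) (Fin n) ℂ :=
  Matrix.of fun i j => if (i : ℕ) = j then 1 else 0

theorem inclMat_self (n : ℕ) : inclMat n n = 1 := by
  ext i j; simp [inclMat, Matrix.one_apply, Fin.ext_iff]

theorem inclMat_eq_submatrix {n N : ℕ} (h : n ≤ N) :
    inclMat n N = (1 : Matrix (Fin N) (Fin N) ℂ).submatrix _root_.id (Fin.castLE h) := by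
  ext i j; simp [inclMat, Matrix.one_apply, Fin.ext_iff]

theorem mul_inclMat {n N k : ℕ} (h : n ≤ N) (A : Matrix (Fin k) (Fin N) ℂ) :
    A * inclMat n N = A.submatrix _root_.id (Fin.castLE h) := by
  rw [inclMat_eq_submatrix h]
  ext i j
  simp [Matrix.mul_apply, Matrix.one_apply]

theorem inclMat_mul_inclMat {n m k : ℕ} (h : n ≤ m) :
    inclMat m k * inclMat n m = inclMat n k := by
  rw [mul_inclMat h]; ext i j; simp [inclMat]

theorem conjTranspose_inclMat_mul_self {n N : ℕ} (h : n ≤ N) :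
    (inclMat n N)ᴴ * inclMat n N = 1 := by
  rw [mul_inclMat h]
  ext i j; simp [inclMat, Matrix.one_apply, Fin.ext_iff, eq_comm]

/-- Two unitary matrices with the same upper left corner differ by unitary matrices that fix the
coordinates of the corner. -/
theorem exists_unitary_of_corner_eq {n m N : ℕ} (hn : n ≤ N)
    {U V : Matrix (Fin N) (Fin N) ℂ} (hU : U ∈ unitaryGroup (Fin N) ℂ)
    (hV : V ∈ unitaryGroup (Fin N) ℂ)
    (h : (inclMat m N)ᴴ * U * inclMat n N = (inclMat m N)ᴴ * V * inclMat n N) :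
    ∃ A ∈ unitaryGroup (Fin N) ℂ, ∃ B ∈ unitaryGroup (Fin N) ℂ, A * inclMat n N = inclMat n N ∧
      (inclMat m N)ᴴ * B = (inclMat m N)ᴴ ∧ V = B * U * A := by
  -- The Gram matrix of the columns of the inclusion and of `U * inclMat n N` depends on `U` only
  -- through the corner. Equal Gram matrices provide a unitary `B` that fixes the first block of
  -- columns and carries the second to that of `V`.
  have hg : (fromCols (inclMat m N) (U * inclMat n N))ᴴ * fromCols (inclMat m N) (U * inclMat n N) =
      (fromCols (inclMat m N) (V * inclMat n N))ᴴ * fromCols (inclMat m N) (V * inclMat n N) := by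
    have hu (U : Matrix (Fin N) (Fin N) ℂ) (hU : U ∈ unitaryGroup (Fin N) ℂ) :
        (U * inclMat n N)ᴴ * (U * inclMat n N) = 1 := by
      rw [conjTranspose_mul, Matrix.mul_assoc, ← Matrix.mul_assoc Uᴴ, ← star_eq_conjTranspose U,
        Unitary.star_mul_self_of_mem hU, Matrix.one_mul, conjTranspose_inclMat_mul_self hn]
    have hc : (inclMat m N)ᴴ * (U * inclMat n N) = (inclMat m N)ᴴ * (V * inclMat n N) := by
      rw [← Matrix.mul_assoc, h, Matrix.mul_assoc]
    have hc' : (U * inclMat n N)ᴴ * inclMat m N = (V * inclMat n N)ᴴ * inclMat m N := by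
      have := congrArg conjTranspose hc
      rwa [conjTranspose_mul, conjTranspose_mul (inclMat m N)ᴴ, conjTranspose_conjTranspose] at this
    rw [conjTranspose_fromCols_eq_fromRows_conjTranspose,
      conjTranspose_fromCols_eq_fromRows_conjTranspose, fromRows_mul_fromCols,
      fromRows_mul_fromCols, hu U hU, hu V hV, hc, hc']
  obtain ⟨B, hB, e⟩ := exists_unitary_mul_eq hg
  rw [mul_fromCols] at e
  obtain ⟨e₁, e₂⟩ := (fromCols_inj).eq_iff.1 e
  have hBs : star B * B = 1 := Unitary.star_mul_self_of_mem hB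
  have hUs : star U * U = 1 := Unitary.star_mul_self_of_mem hU
  have hBs' : B * star B = 1 := Unitary.mul_star_self_of_mem hB
  have hUs' : U * star U = 1 := Unitary.mul_star_self_of_mem hU
  -- The equation `V = B * U * A` dictates `A`; it fixes the first `n` coordinates because `B * U`
  -- and `V` agree on them.
  refine ⟨star U * star B * V, mul_mem (mul_mem (Unitary.star_mem hU) (Unitary.star_mem hB)) hV,
    B, hB, ?_, ?_, ?_⟩
  · rw [Matrix.mul_assoc, ← e₂, Matrix.mul_assoc, ← Matrix.mul_assoc (star B), hBs, Matrix.one_mul,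
      ← Matrix.mul_assoc, hUs, Matrix.one_mul]
  · have e₃ : star B * inclMat m N = inclMat m N := by
      conv_lhs => rw [← e₁]
      rw [← Matrix.mul_assoc, hBs, Matrix.one_mul]
    have := congrArg conjTranspose e₃
    rwa [conjTranspose_mul, star_eq_conjTranspose, conjTranspose_conjTranspose] at this
  · rw [← Matrix.mul_assoc, ← Matrix.mul_assoc, Matrix.mul_assoc B U, hUs', Matrix.mul_one, hBs',
      Matrix.one_mul]

/-- A unitary matrix fixing the first `n` coordinates is block diagonal. -/
theorem exists_eq_blockDiag {n k : ℕ} {C : Matrix (Fin (n + k)) (Fin (n + k)) ℂ}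
    (hC : C ∈ unitaryGroup (Fin (n + k)) ℂ) (h : C * inclMat n (n + k) = inclMat n (n + k)) :
    ∃ A ∈ unitaryGroup (Fin k) ℂ, C = blockDiag (1 : Matrix (Fin n) (Fin n) ℂ) A := by
  have hcol (i : Fin (n + k)) (j : Fin n) : C i (Fin.castAdd k j) = if (i : ℕ) = j then 1 else 0 := by
    have := congrFun (congrFun h i) j
    rwa [mul_inclMat (Nat.le_add_right n k)] at this
  -- A vector fixed by a unitary matrix is fixed by its adjoint, so the rows behave like the
  -- columns.
  have hrow : (inclMat n (n + k))ᴴ * C = (inclMat n (n + k))ᴴ := by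
    have e : star C * inclMat n (n + k) = inclMat n (n + k) := by
      conv_lhs => rw [← h]
      rw [← Matrix.mul_assoc, Unitary.star_mul_self_of_mem hC, Matrix.one_mul]
    have := congrArg conjTranspose e
    rwa [conjTranspose_mul, star_eq_conjTranspose, conjTranspose_conjTranspose] at this
  have hrow' (i : Fin n) (j : Fin (n + k)) : C (Fin.castAdd k i) j = if (j : ℕ) = i then 1 else 0 := by
    have e := congrArg conjTranspose hrow
    rw [conjTranspose_mul, conjTranspose_conjTranspose, mul_inclMat (Nat.le_add_right n k)] at e
    have e' := congrArg star (congrFun (congrFun e j) i)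
    have e'' : C (Fin.castAdd k i) j = star (inclMat n (n + k) j i) := by
      rw [← e']; simp [Fin.castAdd]
    rw [e'']; simp [inclMat]
  set A : Matrix (Fin k) (Fin k) ℂ := C.submatrix (Fin.natAdd n) (Fin.natAdd n) with hA
  have hCA : C = blockDiag (1 : Matrix (Fin n) (Fin n) ℂ) A := by
    ext i j
    refine Fin.addCases (fun i => ?_) (fun i => ?_) i <;>
      refine Fin.addCases (fun j => ?_) (fun j => ?_) j
    · rw [hcol]; simp [Matrix.one_apply, Fin.ext_iff]
    · rw [hrow']; simp; omega
    · rw [hcol]; simp; omega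
    · simp [hA]
  refine ⟨A, ?_, hCA⟩
  rw [mem_unitaryGroup_iff, star_eq_conjTranspose] at hC ⊢
  rw [hCA, blockDiag_conjTranspose, blockDiag_mul] at hC
  ext i j
  have := congrFun (congrFun hC (Fin.natAdd n i)) (Fin.natAdd n j)
  rw [blockDiag_natAdd_natAdd] at this
  rw [this]; simp [Matrix.one_apply]

namespace Mor

/-! ## Circuits with sources and detectors -/

/-- A source producing a new last wire. -/
def sourceAt (n : ℕ) : Mor n (n + 1) := par (n := n) (m := n) (id n) source

/-- A detector consuming the last wire. -/
def detectorAt (n : ℕ) : Mor (n + 1) n := par (n := n) (m := n) (id n) detector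

theorem seq_sourceAt {n m : ℕ} (f : Mor n m) : f ⬝ sourceAt m = sourceAt n ⬝ pad f := by
  have := seq_id_par_comm f source
  rwa [par_empty] at this

theorem pad_seq_detectorAt {n m : ℕ} (f : Mor n m) : pad f ⬝ detectorAt m = detectorAt n ⬝ f := by
  have := seq_id_par_comm f detector
  rwa [par_empty] at this

theorem sourceAt_detectorAt (n : ℕ) : sourceAt n ⬝ detectorAt n = id n := by
  have := id_par_seq n source detector
  rw [source_detector, par_empty] at this
  exact this.symm

theorem id_zero_par {n m : ℕ} (f : Mor n m) (h : 0 + n = n) (h' : 0 + m = m) :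
    cast h h' (id 0 ⊠ f) = f := cast_empty_par f

theorem swap_one_zero : swap 1 0 = id 1 := cast_swap_zero 1

theorem source_par_one : (source ⊠ id 1 : Mor 1 2) = (id 1 ⊠ source : Mor 1 2) ⬝ swap₂ := by
  have := par_seq_swap (id 1) source
  rw [swap_one_zero] at this
  exact ((this.trans (id_seq _)).symm)

/-- Both sides equal `source ⊠ detector`: a fresh vacuum wire is crossed with the old wire, which is
then detected. This lets sources move ahead of detectors. -/
theorem detector_seq_source :
    detector ⬝ source = sourceAt 1 ⬝ swap₂ ⬝ detectorAt 1 := by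
  have h₁ : sourceAt 1 ⬝ swap₂ = source ⊠ id 1 := source_par_one.symm
  have h₂ : (source ⊠ id 1 : Mor 1 2) ⬝ detectorAt 1 = (source ⊠ detector : Mor 1 1) := by
    have := par_seq_par source (id 1) (id 1) detector
    rw [seq_id, id_seq] at this
    exact this
  have h₃ : (detector ⬝ source : Mor 1 1) = (source ⊠ detector : Mor 1 1) := by
    have := par_seq_par (id 0) detector source (id 0)
    rw [seq_id, id_seq, par_empty] at this
    have e : (id 0 ⊠ detector : Mor 1 0) = detector := id_zero_par detector rfl rfl
    erw [e] at this
    exact this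
  rw [h₁, h₂, h₃]

theorem detectorAt_seq_sourceAt (n : ℕ) :
    detectorAt n ⬝ sourceAt n = sourceAt (n + 1) ⬝ gateAt n swap₂ ⬝ detectorAt (n + 1) := by
  have h₁ : sourceAt (n + 1) = par (n := n) (m := n) (id n) (sourceAt 1) :=
    id_par_id_par n source rfl rfl
  have h₂ : detectorAt (n + 1) = par (n := n) (m := n) (id n) (detectorAt 1) :=
    id_par_id_par n detector rfl rfl
  have h₃ := id_par_seq n detector source
  rw [detector_seq_source, id_par_seq, id_par_seq] at h₃
  rw [h₁, h₂]
  exact h₃.symm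

/-- Circuits generated by passive circuits, sources and detectors. -/
inductive Active : {n m : ℕ} → Mor n m → Prop
  | passive {n : ℕ} {f : Mor n n} (hf : Passive n f) : Active f
  | source (n : ℕ) : Active (sourceAt n)
  | detector (n : ℕ) : Active (detectorAt n)
  | seq {n m k : ℕ} {f : Mor n m} {g : Mor m k} (hf : Active f) (hg : Active g) : Active (f ⬝ g)

/-- Layers of sources. -/
inductive Sources (n : ℕ) : (N : ℕ) → Mor n N → Prop
  | refl : Sources n n (id n)
  | step {N : ℕ} {x : Mor n N} (h : Sources n N x) : Sources n (N + 1) (x ⬝ sourceAt N)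

/-- Layers of detectors. -/
inductive Detectors (m : ℕ) : (N : ℕ) → Mor N m → Prop
  | refl : Detectors m m (id m)
  | step {N : ℕ} {y : Mor N m} (h : Detectors m N y) : Detectors m (N + 1) (detectorAt N ⬝ y)

/-- Sources, followed by a passive circuit on `N` wires, followed by detectors. -/
def HasNormalForm {n m : ℕ} (N : ℕ) (f : Mor n m) : Prop :=
  ∃ x u y, Sources n N x ∧ Passive N u ∧ Detectors m N y ∧ f = x ⬝ u ⬝ y

/-- An idle vacuum wire from a source to a detector can be added; this brings two normal forms to
the same number of wires. -/
theorem HasNormalForm.succ {n m N : ℕ} {f : Mor n m} (hf : HasNormalForm N f) :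
    HasNormalForm (N + 1) f := by
  obtain ⟨x, u, y, hx, hu, hy, rfl⟩ := hf
  refine ⟨_, _, _, hx.step, hu.pad, hy.step, ?_⟩
  rw [← seq_assoc, seq_assoc (x ⬝ sourceAt N), pad_seq_detectorAt, ← seq_assoc, seq_assoc x (sourceAt N),
    sourceAt_detectorAt, seq_id]

theorem HasNormalForm.add {n m N : ℕ} {f : Mor n m} (hf : HasNormalForm N f) (k : ℕ) :
    HasNormalForm (N + k) f := by
  induction k with
  | zero => exact hf
  | succ k ih => exact ih.succ

theorem Detectors.seq_passive {m N : ℕ} {y : Mor N m} (hy : Detectors m N y) {f : Mor m m}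
    (hf : Passive m f) : ∃ g, Passive N g ∧ y ⬝ f = g ⬝ y := by
  induction hy with
  | refl => exact ⟨f, hf, by simp⟩
  | step _ ih =>
    obtain ⟨g, hg, e⟩ := ih
    exact ⟨_, hg.pad, by rw [seq_assoc, e, ← seq_assoc, ← seq_assoc, pad_seq_detectorAt]⟩

/-- A source passes each detector at the cost of one swap gate, which is passive. -/
theorem Detectors.seq_sourceAt {m N : ℕ} {y : Mor N m} (hy : Detectors m N y) :
    ∃ g y', Passive (N + 1) g ∧ Detectors (m + 1) (N + 1) y' ∧
      y ⬝ sourceAt m = sourceAt N ⬝ g ⬝ y' := by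
  induction hy with
  | refl => exact ⟨_, _, .id _, .refl, by simp⟩
  | @step N y _ ih =>
    obtain ⟨g, y', hg, hy', e⟩ := ih
    refine ⟨_, _, (Passive.gate N .swap₂).seq hg.pad, hy'.step, ?_⟩
    rw [seq_assoc, e]
    simp only [← seq_assoc]
    rw [detectorAt_seq_sourceAt]
    simp only [seq_assoc]
    rw [← seq_assoc (detectorAt _) g, ← pad_seq_detectorAt]
    simp only [seq_assoc]

theorem Detectors.seq_detectorAt {m N : ℕ} {y : Mor N (m + 1)} (hy : Detectors (m + 1) N y) :
    Detectors m N (y ⬝ detectorAt m) := by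
  induction hy with
  | refl =>
    have := (Detectors.refl (m := m)).step
    rw [seq_id] at this
    rw [id_seq]; exact this
  | step _ ih => rw [seq_assoc]; exact ih.step

/-- Each generator is absorbed into a normal form on its left: passive circuits go back through the
detectors, sources go back through the detectors and the passive part, detectors join the detectors.
-/
theorem Active.normalForm {n m : ℕ} {f : Mor n m} (hf : Active f) : ∃ N, HasNormalForm N f := by
  suffices H : ∀ {k : ℕ} (g : Mor k n), (∃ N, HasNormalForm N g) → ∃ N, HasNormalForm N (g ⬝ f) by
    simpa using H (id n) ⟨n, _, _, _, .refl, .id n, .refl, by simp⟩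
  induction hf with
  | passive hf =>
    rintro k g ⟨N, x, u, y, hx, hu, hy, rfl⟩
    obtain ⟨v, hv, e⟩ := hy.seq_passive hf
    exact ⟨N, x, _, y, hx, hu.seq hv, hy, by rw [seq_assoc, e]; simp only [seq_assoc]⟩
  | source n =>
    rintro k g ⟨N, x, u, y, hx, hu, hy, rfl⟩
    obtain ⟨v, y', hv, hy', e⟩ := hy.seq_sourceAt
    refine ⟨N + 1, _, _, y', hx.step, hu.pad.seq hv, hy', ?_⟩
    rw [seq_assoc, e]
    simp only [← seq_assoc]
    rw [seq_assoc x u, Mor.seq_sourceAt]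
    simp only [seq_assoc]
  | detector n =>
    rintro k g ⟨N, x, u, y, hx, hu, hy, rfl⟩
    exact ⟨N, x, u, _, hx, hu, hy.seq_detectorAt, by simp only [seq_assoc]⟩
  | seq _ _ h₁ h₂ => intro k g h; rw [← seq_assoc]; exact h₂ _ (h₁ _ h)

theorem Sources.le {n N : ℕ} {x : Mor n N} (hx : Sources n N x) : n ≤ N := by
  induction hx with
  | refl => rfl
  | step _ ih => omega

theorem Detectors.le {m N : ℕ} {y : Mor N m} (hy : Detectors m N y) : m ≤ N := by
  induction hy with
  | refl => rfl
  | step _ ih => omega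

/-! ### Semantics of layers of sources and detectors -/

theorem sem_sourceAt (n : ℕ) : sem (sourceAt n) = spatial (inclMat n (n + 1)) := by
  have h : sem source = spatial (0 : Matrix (Fin 1) (Fin 0) ℂ) := spatial_zero.symm
  have := sem_par_spatial (sem_id_spatial n) h
  refine this.trans (congrArg spatial ?_)
  ext i j
  refine Fin.lastCases ?_ (fun i => ?_) i
  · have e := blockDiag_natAdd_castAdd (1 : Matrix (Fin n) (Fin n) ℂ) (0 : Matrix (Fin 1) (Fin 0) ℂ) 0 j
    refine e.trans ?_
    have hj : n ≠ j := j.isLt.ne'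
    simp [inclMat, hj]
  · have e := blockDiag_castAdd_castAdd (1 : Matrix (Fin n) (Fin n) ℂ) (0 : Matrix (Fin 1) (Fin 0) ℂ) i j
    refine e.trans ?_
    simp [inclMat, Matrix.one_apply, Fin.ext_iff]

theorem sem_detectorAt (n : ℕ) : sem (detectorAt n) = spatial (inclMat n (n + 1))ᴴ := by
  have h : sem detector = spatial (0 : Matrix (Fin 0) (Fin 1) ℂ) := spatial_zero.symm
  have := sem_par_spatial (sem_id_spatial n) h
  refine this.trans (congrArg spatial ?_)
  ext i j
  refine Fin.lastCases ?_ (fun j => ?_) j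
  · have e := blockDiag_castAdd_natAdd (1 : Matrix (Fin n) (Fin n) ℂ) (0 : Matrix (Fin 0) (Fin 1) ℂ) i 0
    refine e.trans ?_
    have hi : n ≠ i := i.isLt.ne'
    simp [inclMat, hi]
  · have e := blockDiag_castAdd_castAdd (1 : Matrix (Fin n) (Fin n) ℂ) (0 : Matrix (Fin 0) (Fin 1) ℂ) i j
    refine e.trans ?_
    simp [inclMat, Matrix.one_apply, Fin.ext_iff, eq_comm]

theorem Sources.sem {n N : ℕ} {x : Mor n N} (hx : Sources n N x) :
    Mor.sem x = spatial (inclMat n N) := by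
  induction hx with
  | refl => rw [inclMat_self, sem_id_spatial]
  | step h ih => rw [sem_seq_spatial ih (sem_sourceAt _), inclMat_mul_inclMat h.le]

theorem Detectors.sem {m N : ℕ} {y : Mor N m} (hy : Detectors m N y) :
    Mor.sem y = spatial (inclMat m N)ᴴ := by
  induction hy with
  | refl => rw [inclMat_self, sem_id_spatial, conjTranspose_one]
  | step h ih => rw [sem_seq_spatial (sem_detectorAt _) ih, ← conjTranspose_mul,
      inclMat_mul_inclMat h.le]

/-! ## Absorption of passive circuits by sources and detectors -/

/-- A morphism below `a` idle wires. -/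
def under (a : ℕ) {n m : ℕ} (f : Mor n m) : Mor (a + n) (a + m) := id a ⊠ f

theorem under_seq (a : ℕ) {n m k : ℕ} (f : Mor n m) (g : Mor m k) :
    under a (f ⬝ g) = under a f ⬝ under a g := id_par_seq a f g

@[simp] theorem under_id (a n : ℕ) : under a (id n) = id (a + n) := par_id a n

theorem under_pad (a : ℕ) {n m : ℕ} (f : Mor n m) : under a (pad f) = pad (under a f) :=
  par_par_one (id a) f (id 1)

theorem under_gateAt (a n : ℕ) (f : Mor 2 2) : under a (gateAt n f) = gateAt (a + n) f := by
  have := par_par_two (id a) (id n) f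
  rw [par_id] at this
  exact this

theorem under_sourceAt (a n : ℕ) : under a (sourceAt n) = sourceAt (a + n) := by
  have := par_par_source (id a) (id n) source
  rw [par_id] at this
  exact this

theorem under_detectorAt (a n : ℕ) : under a (detectorAt n) = detectorAt (a + n) := by
  have := par_par_detector (id a) (id n) detector
  rw [par_id] at this
  exact this

theorem Passive.under (a : ℕ) {n : ℕ} {f : Mor n n} (hf : Passive n f) :
    Passive (a + n) (under a f) := by
  induction n with
  | zero => obtain rfl := hf; rw [under_id]; exact .id _
  | succ n ih =>
    cases n with
    | zero =>
      obtain ⟨φ, rfl⟩ := hf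
      exact Passive.phase a φ
    | succ n =>
      change PassiveStep n (Passive (n + 1)) f at hf
      induction hf with
      | id => rw [under_id]; exact .id _
      | seq _ _ h₁ h₂ => rw [under_seq]; exact h₁.seq h₂
      | pad h => rw [under_pad]; exact (ih h).pad
      | gate h => rw [under_gateAt]; exact .gate _ h

theorem Gate₂.source_absorb {f : Mor 2 2} (hf : Gate₂ f) :
    (source ⊠ source) ⬝ f = source ⊠ source := by
  induction hf with
  | id => exact seq_id _
  | seq _ _ h₁ h₂ => rw [← seq_assoc, h₁, h₂]
  | bs θ => exact source_source_bs θ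
  | phases a b => rw [par_seq_par, source_phase, source_phase]

theorem Gate₂.absorb_detector {f : Mor 2 2} (hf : Gate₂ f) :
    f ⬝ (detector ⊠ detector) = detector ⊠ detector := by
  induction hf with
  | id => exact id_seq _
  | seq _ _ h₁ h₂ => rw [seq_assoc, h₂, h₁]
  | bs θ => exact bs_detector_detector θ
  | phases a b => rw [par_seq_par, phase_detector, phase_detector]

theorem sourceAt_sourceAt_gateAt (n : ℕ) {f : Mor 2 2} (hf : Gate₂ f) :
    sourceAt n ⬝ sourceAt (n + 1) ⬝ gateAt n f = sourceAt n ⬝ sourceAt (n + 1) := by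
  have h₁ : sourceAt (n + 1) = par (n := n) (m := n) (id n) (sourceAt 1) :=
    id_par_id_par n source rfl rfl
  have h₂ : sourceAt n ⬝ sourceAt (n + 1) = par (n := n) (m := n) (n' := 0) (m' := 2) (id n)
      (source ⊠ source) := by
    rw [h₁]
    refine (id_par_seq n source (sourceAt 1)).symm.trans ?_
    congr 1
    have := par_seq_par source (id 0) (id 1) source
    rwa [par_empty, seq_id, id_seq] at this
  rw [h₂]
  refine (id_par_seq n _ f).symm.trans ?_
  rw [hf.source_absorb]

theorem gateAt_detectorAt_detectorAt (n : ℕ) {f : Mor 2 2} (hf : Gate₂ f) :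
    gateAt n f ⬝ (detectorAt (n + 1) ⬝ detectorAt n) = detectorAt (n + 1) ⬝ detectorAt n := by
  have h₁ : detectorAt (n + 1) = par (n := n) (m := n) (id n) (detectorAt 1) :=
    id_par_id_par n detector rfl rfl
  have h₂ : detectorAt (n + 1) ⬝ detectorAt n = par (n := n) (m := n) (n' := 2) (m' := 0) (id n)
      (detector ⊠ detector) := by
    rw [h₁]
    refine (id_par_seq n (detectorAt 1) detector).symm.trans ?_
    congr 1
    have := par_seq_par (id 1) detector detector (id 0)
    rwa [par_empty, seq_id, id_seq] at this
  rw [h₂]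
  refine (id_par_seq n f _).symm.trans ?_
  rw [hf.absorb_detector]

theorem sourceAt_phaseAt (n : ℕ) (φ : ℝ) : sourceAt n ⬝ phaseAt n φ = sourceAt n :=
  (id_par_seq n source (phase φ)).symm.trans (by rw [source_phase]; rfl)

theorem phaseAt_detectorAt (n : ℕ) (φ : ℝ) : phaseAt n φ ⬝ detectorAt n = detectorAt n :=
  (id_par_seq n (phase φ) detector).symm.trans (by rw [phase_detector]; rfl)

/-- `k` sources below `n` wires. -/
def sources (n : ℕ) : (k : ℕ) → Mor n (n + k)
  | 0 => id n
  | k + 1 => sources n k ⬝ sourceAt (n + k)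

/-- `k` detectors below `n` wires. -/
def detectors (n : ℕ) : (k : ℕ) → Mor (n + k) n
  | 0 => id n
  | k + 1 => detectorAt (n + k) ⬝ detectors n k

/-- Puts `N` in the form `n + k`, so that circuits on the `k` fresh wires can be expressed by `under
n`. -/
theorem Sources.exists_eq {n N : ℕ} {x : Mor n N} (hx : Sources n N x) :
    ∃ k, ∃ h : n + k = N, x = cast rfl h (sources n k) := by
  induction hx with
  | refl => exact ⟨0, rfl, rfl⟩
  | step _ ih =>
    obtain ⟨k, rfl, rfl⟩ := ih
    exact ⟨k + 1, rfl, rfl⟩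

theorem Detectors.exists_eq {m N : ℕ} {y : Mor N m} (hy : Detectors m N y) :
    ∃ k, ∃ h : m + k = N, y = cast h rfl (detectors m k) := by
  induction hy with
  | refl => exact ⟨0, rfl, rfl⟩
  | step _ ih =>
    obtain ⟨k, rfl, rfl⟩ := ih
    exact ⟨k + 1, rfl, rfl⟩

/-- Generator by generator: a gate on the last two wires is absorbed by the last two sources, while
a padded circuit slides past the last source and is handled by induction. -/
theorem sources_under (n : ℕ) {k : ℕ} {f : Mor k k} (hf : Passive k f) :
    sources n k ⬝ under n f = sources n k := by
  induction k with
  | zero => obtain rfl := hf; rw [under_id]; exact seq_id _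
  | succ k ih =>
    cases k with
    | zero =>
      obtain ⟨φ, rfl⟩ := hf
      change id n ⬝ sourceAt n ⬝ phaseAt n φ = id n ⬝ sourceAt n
      rw [id_seq, sourceAt_phaseAt]
    | succ k =>
      change PassiveStep k (Passive (k + 1)) f at hf
      induction hf with
      | id => rw [under_id]; exact seq_id _
      | seq _ _ h₁ h₂ => rw [under_seq, ← seq_assoc, h₁, h₂]
      | @pad f h =>
        have := ih h
        change sources n (k + 1) ⬝ sourceAt (n + (k + 1)) ⬝ under n (Mor.pad f) =
          sources n (k + 1) ⬝ sourceAt (n + (k + 1))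
        rw [under_pad, seq_assoc, ← Mor.seq_sourceAt, ← seq_assoc, this]
      | @gate f h =>
        change sources n k ⬝ sourceAt (n + k) ⬝ sourceAt (n + k + 1) ⬝ under n (gateAt k f) =
          sources n k ⬝ sourceAt (n + k) ⬝ sourceAt (n + k + 1)
        have := sourceAt_sourceAt_gateAt (n + k) h
        rw [seq_assoc (sources n k), seq_assoc (sources n k)]
        refine congrArg (sources n k ⬝ ·) ?_
        rw [under_gateAt]; exact this

theorem under_detectors (n : ℕ) {k : ℕ} {f : Mor k k} (hf : Passive k f) :
    under n f ⬝ detectors n k = detectors n k := by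
  induction k with
  | zero => obtain rfl := hf; rw [under_id]; exact id_seq _
  | succ k ih =>
    cases k with
    | zero =>
      obtain ⟨φ, rfl⟩ := hf
      change phaseAt n φ ⬝ (detectorAt n ⬝ id n) = detectorAt n ⬝ id n
      rw [seq_id, phaseAt_detectorAt]
    | succ k =>
      change PassiveStep k (Passive (k + 1)) f at hf
      induction hf with
      | id => rw [under_id]; exact id_seq _
      | seq _ _ h₁ h₂ => rw [under_seq, seq_assoc, h₂, h₁]
      | @pad f h =>
        have := ih h
        change under n (Mor.pad f) ⬝ (detectorAt (n + (k + 1)) ⬝ detectors n (k + 1)) =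
          detectorAt (n + (k + 1)) ⬝ detectors n (k + 1)
        rw [under_pad, ← seq_assoc, pad_seq_detectorAt, seq_assoc, this]
      | @gate f h =>
        change under n (gateAt k f) ⬝ (detectorAt (n + k + 1) ⬝ (detectorAt (n + k) ⬝
          detectors n k)) = detectorAt (n + k + 1) ⬝ (detectorAt (n + k) ⬝ detectors n k)
        have := gateAt_detectorAt_detectorAt (n + k) h
        rw [← seq_assoc (detectorAt (n + k + 1)), ← seq_assoc]
        refine congrArg (· ⬝ detectors n k) ?_
        rw [under_gateAt]; exact this

/-- A passive circuit acting as `blockDiag 1 A` is a passive circuit below idle wires. -/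
theorem Passive.exists_eq_under {n k : ℕ} {f : Mor (n + k) (n + k)} (hf : Passive (n + k) f)
    {C : Matrix (Fin (n + k)) (Fin (n + k)) ℂ} (e : Mor.sem f = spatial C)
    (hC : C * inclMat n (n + k) = inclMat n (n + k)) : ∃ g, Passive k g ∧ f = Mor.under n g := by
  obtain ⟨C', hC', e'⟩ := hf.sem
  obtain rfl := spatial_injective (e.symm.trans e')
  obtain ⟨A, hA, rfl⟩ := exists_eq_blockDiag hC' hC
  obtain ⟨g, hg, eg⟩ := exists_passive_sem_eq hA
  -- Completeness for passive circuits: both sides are passive and have the same matrix.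
  refine ⟨g, hg, hf.ext (hg.under n) ?_⟩
  rw [e, Mor.under, sem_par_spatial (sem_id_spatial n) eg]

theorem Sources.seq_eq_self {n N : ℕ} {x : Mor n N} (hx : Sources n N x) {f : Mor N N}
    (hf : Passive N f) {C : Matrix (Fin N) (Fin N) ℂ} (e : Mor.sem f = spatial C)
    (hC : C * inclMat n N = inclMat n N) : x ⬝ f = x := by
  obtain ⟨k, rfl, rfl⟩ := hx.exists_eq
  obtain ⟨g, hg, rfl⟩ := hf.exists_eq_under e hC
  exact sources_under n hg

theorem Detectors.seq_eq_self {m N : ℕ} {y : Mor N m} (hy : Detectors m N y) {f : Mor N N}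
    (hf : Passive N f) {C : Matrix (Fin N) (Fin N) ℂ} (e : Mor.sem f = spatial C)
    (hC : C * inclMat m N = inclMat m N) : f ⬝ y = y := by
  obtain ⟨k, rfl, rfl⟩ := hy.exists_eq
  obtain ⟨g, hg, rfl⟩ := hf.exists_eq_under e hC
  exact under_detectors m hg

theorem Sources.unique {n N : ℕ} {x x' : Mor n N} (hx : Sources n N x) (hx' : Sources n N x') :
    x = x' := by
  obtain ⟨k, rfl, rfl⟩ := hx.exists_eq
  obtain ⟨k', h, rfl⟩ := hx'.exists_eq
  obtain rfl : k' = k := by omega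
  rfl

theorem Detectors.unique {m N : ℕ} {y y' : Mor N m} (hy : Detectors m N y)
    (hy' : Detectors m N y') : y = y' := by
  obtain ⟨k, rfl, rfl⟩ := hy.exists_eq
  obtain ⟨k', h, rfl⟩ := hy'.exists_eq
  obtain rfl : k' = k := by omega
  rfl

/-- The semantics is the corner of the unitary matrix in the middle. Equal corners give `V = B * U *
A`; realised as passive circuits, `A` is absorbed by the sources and `B` by the detectors. -/
theorem HasNormalForm.ext {n m N : ℕ} {f g : Mor n m} (hf : HasNormalForm N f)
    (hg : HasNormalForm N g) (h : Mor.sem f = Mor.sem g) : f = g := by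
  obtain ⟨x, u, y, hx, hu, hy, rfl⟩ := hf
  obtain ⟨x', v, y', hx', hv, hy', rfl⟩ := hg
  obtain rfl := hx.unique hx'
  obtain rfl := hy.unique hy'
  obtain ⟨U, hU, eU⟩ := hu.sem
  obtain ⟨V, hV, eV⟩ := hv.sem
  have hc : (inclMat m N)ᴴ * U * inclMat n N = (inclMat m N)ᴴ * V * inclMat n N := by
    apply spatial_injective
    rw [Matrix.mul_assoc, Matrix.mul_assoc,
      ← sem_seq_spatial (sem_seq_spatial hx.sem eU) hy.sem,
      ← sem_seq_spatial (sem_seq_spatial hx.sem eV) hy.sem, h]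
  obtain ⟨A, hA, B, hB, hAn, hBm, e⟩ := exists_unitary_of_corner_eq hx.le hU hV hc
  obtain ⟨a, ha, ea⟩ := exists_passive_sem_eq hA
  obtain ⟨b, hb, eb⟩ := exists_passive_sem_eq hB
  -- From fixed rows to fixed columns, by unitarity.
  have hBm' : B * inclMat m N = inclMat m N := by
    have := congrArg conjTranspose hBm
    rw [conjTranspose_mul, conjTranspose_conjTranspose] at this
    conv_lhs => rw [← this]
    rw [← Matrix.mul_assoc, ← star_eq_conjTranspose, Unitary.mul_star_self_of_mem hB,
      Matrix.one_mul]
  have hv' : v = a ⬝ u ⬝ b := hv.ext ((ha.seq hu).seq hb) (by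
    rw [eV, e, sem_seq_spatial (sem_seq_spatial ea eU) eb, Matrix.mul_assoc])
  have h₁ : x ⬝ a = x := hx.seq_eq_self ha ea hAn
  have h₂ : b ⬝ y = y := hy.seq_eq_self hb eb hBm'
  rw [hv', ← seq_assoc, ← seq_assoc, h₁, seq_assoc _ b, h₂]

/-- Circuits built from passive circuits, sources and detectors are equal when they have the same
semantics. -/
theorem Active.ext {n m : ℕ} {f g : Mor n m} (hf : Active f) (hg : Active g)
    (h : Mor.sem f = Mor.sem g) : f = g := by
  obtain ⟨N, hN⟩ := hf.normalForm
  obtain ⟨M, hM⟩ := hg.normalForm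
  have h₁ := hN.add M
  have h₂ := hM.add N
  rw [add_comm] at h₂
  exact h₁.ext h₂ h

theorem Active.sem {n m : ℕ} {f : Mor n m} (hf : Active f) : ∃ C, Mor.sem f = spatial C := by
  induction hf with
  | passive hf => obtain ⟨C, -, e⟩ := hf.sem; exact ⟨C, e⟩
  | source n => exact ⟨_, sem_sourceAt n⟩
  | detector n => exact ⟨_, sem_detectorAt n⟩
  | seq _ _ h₁ h₂ =>
    obtain ⟨C₁, e₁⟩ := h₁
    obtain ⟨C₂, e₂⟩ := h₂
    exact ⟨_, sem_seq_spatial e₁ e₂⟩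

end Mor

end Active

namespace Mor

/-! ## Stability properties of active circuits -/

theorem Active.cast {n m n' m' : ℕ} {hn : n = n'} {hm : m = m'} {f : Mor n m} (hf : Active f) :
    Active (cast hn hm f) := by
  subst hn hm; exact hf

theorem Active.of_cast {n m n' m' : ℕ} {hn : n = n'} {hm : m = m'} {f : Mor n m}
    (hf : Active (Mor.cast hn hm f)) : Active f := by
  subst hn hm; exact hf

theorem Active.id (n : ℕ) : Active (id n) := .passive (.id n)

theorem Active.under (a : ℕ) {n m : ℕ} {f : Mor n m} (hf : Active f) : Active (under a f) := by
  induction hf with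
  | passive h => exact .passive (h.under a)
  | source n => rw [under_sourceAt]; exact .source _
  | detector n => rw [under_detectorAt]; exact .detector _
  | seq _ _ h₁ h₂ => rw [under_seq]; exact h₁.seq h₂

theorem pad_sourceAt (n : ℕ) : pad (sourceAt n) = sourceAt (n + 1) ⬝ gateAt n swap₂ := by
  have h₁ : sourceAt (n + 1) = par (n := n) (m := n) (id n) (sourceAt 1) :=
    id_par_id_par n source rfl rfl
  have h₂ : pad (sourceAt n) = par (n := n) (m := n) (n' := 1) (m' := 2) (id n) (source ⊠ id 1) :=
    (par_par_one (id n) source (id 1)).symm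
  rw [h₁, h₂, source_par_one]
  exact id_par_seq n (sourceAt 1) swap₂

theorem swap_zero_one : swap 0 1 = id 1 := by
  have := swap_swap 0 1
  rw [swap_one_zero] at this
  exact (seq_id _).symm.trans this

theorem pad_detectorAt (n : ℕ) : pad (detectorAt n) = gateAt n swap₂ ⬝ detectorAt (n + 1) := by
  have h₁ : detectorAt (n + 1) = par (n := n) (m := n) (id n) (detectorAt 1) :=
    id_par_id_par n detector rfl rfl
  have h₂ : pad (detectorAt n) =
      par (n := n) (m := n) (n' := 2) (m' := 1) (id n) (detector ⊠ id 1) :=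
    (par_par_one (id n) detector (id 1)).symm
  have h₃ : (detector ⊠ id 1 : Mor 2 1) = swap₂ ⬝ detectorAt 1 := by
    have := par_seq_swap detector (id 1)
    rw [swap_zero_one] at this
    exact (seq_id _).symm.trans this
  rw [h₁, h₂, h₃]
  exact id_par_seq n swap₂ (detectorAt 1)

theorem Active.pad {n m : ℕ} {f : Mor n m} (hf : Active f) : Active (pad f) := by
  induction hf with
  | passive h => exact .passive h.pad
  | source n => rw [pad_sourceAt]; exact (Active.source _).seq (.passive (.gate n .swap₂))
  | detector n => rw [pad_detectorAt]; exact (Active.passive (.gate n .swap₂)).seq (.detector _)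
  | seq _ _ h₁ h₂ => rw [pad_seq]; exact h₁.seq h₂

theorem Active.par_id {n m : ℕ} {f : Mor n m} (hf : Active f) (b : ℕ) :
    Active (f ⊠ Mor.id b) := by
  induction b with
  | zero => rw [par_empty]; exact hf
  | succ b ih =>
    have := par_par_one f (Mor.id b) (Mor.id 1)
    rw [Mor.par_id] at this
    rw [this]
    exact ih.pad

theorem Active.par {n m n' m' : ℕ} {f : Mor n m} {g : Mor n' m'} (hf : Active f)
    (hg : Active g) : Active (f ⊠ g) := by
  have : f ⊠ g = (f ⊠ Mor.id n') ⬝ Mor.under m g := by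
    rw [Mor.under, par_seq_par, seq_id, id_seq]
  rw [this]
  exact (hf.par_id n').seq (hg.under m)

/-! ### Block symmetries as products of adjacent swaps -/

theorem swap_one_succ (n : ℕ) :
    (swap 1 (n + 1) : Mor (1 + n + 1) (n + 2)) = pad (swap 1 n) ⬝ gateAt n swap₂ :=
  cast_swap_add 1 n 1

/-- The PROP axiom decomposes only the second block; inverting that decomposition handles the first.
-/
theorem swap_succ_one (n : ℕ) :
    (swap (n + 1) 1 : Mor (n + 2) (1 + n + 1)) = gateAt n swap₂ ⬝ pad (swap n 1) := by
  have h : gateAt n swap₂ ⬝ pad (swap n 1) ⬝ (swap 1 (n + 1) : Mor (1 + n + 1) (n + 2)) =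
      id (n + 2) := by
    have e : swap n 1 ⬝ swap 1 n = id (n + 1) := swap_swap n 1
    have e' : (pad (swap n 1) : Mor (n + 2) (1 + n + 1)) ⬝ pad (swap 1 n) = id (n + 2) := by
      have := pad_seq (swap n 1) (swap 1 n)
      rw [e, pad_id] at this
      exact this.symm
    rw [swap_one_succ, seq_assoc, ← seq_assoc (pad (swap n 1)), e', id_seq, ← gateAt_seq,
      swap₂_swap₂, gateAt_id]
  have h' : (swap 1 (n + 1) : Mor (1 + n + 1) (n + 2)) ⬝ (swap (n + 1) 1 : Mor (n + 2) (1 + n + 1)) =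
      id (1 + n + 1) := swap_swap 1 (n + 1)
  rw [← id_seq (swap (n + 1) 1 : Mor (n + 2) (1 + n + 1)), ← h, seq_assoc, h', seq_id]

theorem Active.swap_one (n : ℕ) : Active (swap n 1) := by
  induction n with
  | zero => rw [swap_zero_one]; exact .id 1
  | succ n ih => rw [swap_succ_one]; exact (Active.passive (.gate n .swap₂)).seq ih.pad

theorem Active.swap (n m : ℕ) : Active (swap n m) := by
  induction m with
  | zero =>
    have := cast_swap_zero n
    exact .of_cast (hn := rfl) (hm := Nat.zero_add n) (this ▸ .id n)
  | succ m ih =>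
    have := cast_swap_add n m 1
    refine .of_cast (hn := (Nat.add_assoc n m 1).symm) (hm := Nat.add_assoc m 1 n) ?_
    rw [this]
    exact (Active.cast ih.pad).seq ((Active.swap_one n).under m)

/-! ## Splitting the two polarisations -/

/-- Split a wire into two wires carrying vertically polarised photons. -/
def split : Mor 1 2 := sourceAt 1 ⬝ pbs ⬝ par (n := 1) (m := 1) (id 1) neg

/-- Merge back the result of `split`. -/
def merge : Mor 2 1 := par (n := 1) (m := 1) (id 1) neg ⬝ pbs ⬝ detectorAt 1

theorem id_par_neg_sq :
    (par (n := 1) (m := 1) (id 1) neg : Mor 2 2) ⬝ par (n := 1) (m := 1) (id 1) neg = id 2 := by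
  have := par_seq_par (id 1) neg (id 1) neg
  rw [neg_neg, id_seq, par_id] at this
  exact this

theorem split_merge : split ⬝ merge = id 1 := by
  rw [split, merge]
  simp only [seq_assoc]
  rw [seq_cancel id_par_neg_sq, seq_cancel pbs_pbs, sourceAt_detectorAt]

theorem par_sourceAt_one {f g : Mor 1 1} (hg : source ⬝ g = source) :
    sourceAt 1 ⬝ par (n := 1) (m := 1) f g = f ⬝ sourceAt 1 := by
  have h₁ := par_seq_par (id 1) source f g
  rw [hg, id_seq] at h₁
  have h₂ := par_seq_par f (id 0) (id 1) source
  rw [seq_id, id_seq, par_empty] at h₂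
  exact h₁.trans h₂.symm

theorem phase_split (φ : ℝ) : phase φ ⬝ split = split ⬝ (phase φ ⊠ phase φ) := by
  have h := par_sourceAt_one (f := phase φ) (source_phase φ)
  rw [split, ← seq_assoc, ← seq_assoc, ← h, seq_assoc _ _ pbs]
  have h' := phase_pbs φ
  rw [h']
  simp only [seq_assoc]
  rw [phase_par_comm_id_par_neg]

/-- After splitting, polarisation is position, and mixing polarisations is mixing wires. The source
absorbs a second copy of the wave plate, and the rest is `bs_waveplate`. -/
theorem waveplate_split (θ : ℝ) : waveplate θ ⬝ split = split ⬝ bs θ := by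
  have h := par_sourceAt_one (f := waveplate θ) (source_waveplate θ)
  rw [split, bs_waveplate]
  simp only [seq_assoc]
  rw [seq_cancel id_par_neg_sq, seq_cancel pbs_pbs, ← seq_assoc, ← h]
  simp only [seq_assoc]

theorem source_split : source ⬝ split = sourceAt 0 ⬝ sourceAt 1 := by
  have h₀ : sourceAt 0 = source := id_zero_par source rfl rfl
  have h : source ⬝ sourceAt 1 = (source ⊠ source : Mor 0 2) := by
    have := par_seq_par source (id 0) (id 1) source
    rwa [par_empty, seq_id, id_seq] at this
  have h' := par_seq_par source source (id 1) neg
  rw [source_neg, seq_id] at h'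
  rw [split, ← seq_assoc, ← seq_assoc, h, h₀, h]
  erw [source_pbs]
  exact h'

theorem split_detector_detector : split ⬝ (detectorAt 1 ⬝ detectorAt 0) = detectorAt 0 := by
  have h₀ : detectorAt 0 = detector := id_zero_par detector rfl rfl
  have h : detectorAt 1 ⬝ detector = (detector ⊠ detector : Mor 2 0) := by
    have := par_seq_par (id 1) detector detector (id 0)
    rwa [par_empty, seq_id, id_seq] at this
  have h₁ : par (n := 1) (m := 1) (id 1) neg ⬝ (detector ⊠ detector : Mor 2 0) =
      (detector ⊠ detector : Mor 2 0) := by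
    have := par_seq_par (id 1) neg detector detector
    rw [neg_detector, id_seq] at this
    exact this
  have h₂ : pbs ⬝ (detector ⊠ detector : Mor 2 0) = (detector ⊠ detector : Mor 2 0) := pbs_detector
  rw [h₀, h, split]
  simp only [seq_assoc]
  rw [h₁, h₂, ← h, ← seq_assoc, sourceAt_detectorAt, id_seq]

/-! ## Polarising beam splitters on split wires -/

/-- Makes it possible to carry out the word computation of `pbs_word_eq` in an abstract monoid. -/
instance (n : ℕ) : Monoid (Mor n n) where
  mul := seq
  mul_assoc := seq_assoc
  one := id n
  one_mul := id_seq
  mul_one := seq_id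

/-- Both sides are a polarising beam splitter between the first and the third wire. -/
theorem onTop_pbs_conj : onBottom swap₂ ⬝ onTop pbs ⬝ onBottom swap₂ =
    onTop swap₂ ⬝ onBottom pbs ⬝ onTop swap₂ := by
  have h : onBottom pbs ⬝ swap 1 2 = swap 1 2 ⬝ onTop pbs := par_seq_swap (id 1) pbs
  rw [swap_one_two] at h
  have t : onTop swap₂ ⬝ onTop swap₂ = id 3 := by rw [← onTop_seq, swap₂_swap₂, onTop_id]
  have b : onBottom swap₂ ⬝ onBottom swap₂ = id 3 := by
    rw [← onBottom_seq, swap₂_swap₂, onBottom_id]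
  have := congrArg (fun x => onTop swap₂ ⬝ x ⬝ onBottom swap₂) h
  simp only [seq_assoc] at this
  rw [seq_cancel t, b, seq_id] at this
  simp only [seq_assoc]
  exact this.symm

/-- Mirror image of the axiom `pbs_pbs_pbs` under reversal of the three wires, under which `pbs` and
`swap₂` are symmetric. -/
theorem onBottom_pbs_onTop_onBottom : onBottom pbs ⬝ onTop pbs ⬝ onBottom pbs =
    onBottom swap₂ ⬝ onTop pbs ⬝ onBottom swap₂ := by
  have hp : swap₂ ⬝ pbs ⬝ swap₂ = pbs := by
    rw [← pbs_swap₂, seq_assoc, swap₂_swap₂, seq_id]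
  have hs : swap₂ ⬝ swap₂ ⬝ swap₂ = swap₂ := by rw [swap₂_swap₂, id_seq]
  have h₁ := onBottom_eq_reverse pbs
  have h₂ := onTop_eq_reverse pbs
  have h₃ := onBottom_eq_reverse swap₂
  rw [hp] at h₁ h₂
  rw [hs] at h₃
  have c (x y z : Mor 3 3) : reverse₃ ⬝ x ⬝ reverse₃ ⬝ (reverse₃ ⬝ y ⬝ reverse₃) ⬝
      (reverse₃ ⬝ z ⬝ reverse₃) = reverse₃ ⬝ (x ⬝ y ⬝ z) ⬝ reverse₃ := by
    simp only [seq_assoc]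
    rw [seq_cancel reverse₃_seq_reverse₃, seq_cancel reverse₃_seq_reverse₃]
  calc _ = reverse₃ ⬝ onTop pbs ⬝ reverse₃ ⬝ (reverse₃ ⬝ onBottom pbs ⬝ reverse₃) ⬝
        (reverse₃ ⬝ onTop pbs ⬝ reverse₃) := by rw [← h₁, ← h₂]
    _ = reverse₃ ⬝ onTop swap₂ ⬝ reverse₃ ⬝ (reverse₃ ⬝ onBottom pbs ⬝ reverse₃) ⬝
        (reverse₃ ⬝ onTop swap₂ ⬝ reverse₃) := by rw [c, c, pbs_pbs_pbs]
    _ = _ := by rw [← h₃, ← h₂]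

/-- On wires 0 to 3, `s₁` and `s₂` stand for the swaps of wires 1, 2 and of wires 2, 3, and `kᵢ` for
the polarising beam splitter on wires `i`, `i + 1`. Both words reduce to `k₁ * k₀ * k₁ * k₂ * k₁ *
s₁`. -/
theorem pbs_word_eq {M : Type*} [Monoid M] {s₁ s₂ k₀ k₁ k₂ : M} (hs₁ : s₁ * s₁ = 1)
    (hs₂ : s₂ * s₂ = 1) (hk₀ : k₀ * k₀ = 1) (hk₁ : k₁ * k₁ = 1) (hk₂ : k₂ * k₂ = 1)
    (hs : s₁ * s₂ * s₁ = s₂ * s₁ * s₂) (c₁ : s₁ * k₁ = k₁ * s₁) (c₂ : s₂ * k₂ = k₂ * s₂)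
    (c₃ : s₂ * k₀ = k₀ * s₂) (c₄ : k₂ * k₀ = k₀ * k₂) (a : s₁ * k₀ * s₁ = k₀ * k₁ * k₀)
    (a' : s₁ * k₀ * s₁ = k₁ * k₀ * k₁) (b : s₁ * k₂ * s₁ = k₁ * k₂ * k₁)
    (b' : s₂ * k₁ * s₂ = k₁ * k₂ * k₁) :
    k₀ * s₁ * k₀ * k₂ = s₂ * k₂ * s₁ * k₀ * k₂ * (s₁ * s₂ * s₁) := by
  have cancel {x : M} (h : x * x = 1) (y : M) : x * (x * y) = y := by rw [← mul_assoc, h, one_mul]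
  -- `s₁ * s₂ * s₁` exchanges wires 1 and 3, hence carries the pair 2, 3 to the pair 1, 2.
  have r : s₁ * s₂ * s₁ * k₂ = k₁ * (s₁ * s₂ * s₁) := by
    have e : s₂ * s₁ * k₂ = k₁ * s₂ * s₁ := by
      calc s₂ * s₁ * k₂ = s₂ * (s₁ * k₂ * s₁) * s₁ := by simp only [mul_assoc, hs₁, mul_one]
        _ = s₂ * (s₂ * k₁ * s₂) * s₁ := by rw [b, ← b']
        _ = k₁ * s₂ * s₁ := by simp only [mul_assoc, cancel hs₂]
    calc s₁ * s₂ * s₁ * k₂ = s₁ * (s₂ * s₁ * k₂) := by simp only [mul_assoc]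
      _ = s₁ * k₁ * (s₂ * s₁) := by rw [e]; simp only [mul_assoc]
      _ = _ := by rw [c₁]; simp only [mul_assoc]
  have left : k₀ * s₁ * k₀ * k₂ = k₁ * k₀ * k₁ * k₂ * k₁ * s₁ := by
    calc k₀ * s₁ * k₀ * k₂ = k₀ * (s₁ * k₀ * s₁) * (s₁ * k₂ * s₁) * s₁ := by
          simp only [mul_assoc, cancel hs₁, hs₁, mul_one]
      _ = _ := by rw [a, b]; simp only [mul_assoc, cancel hk₀]
  have right : s₂ * k₂ * s₁ * k₀ * k₂ * (s₁ * s₂ * s₁) = k₁ * k₀ * k₁ * k₂ * k₁ * s₁ := by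
    calc s₂ * k₂ * s₁ * k₀ * k₂ * (s₁ * s₂ * s₁)
        = (s₂ * k₂) * s₁ * k₀ * (k₂ * s₂) * s₁ * s₂ := by rw [hs]; simp only [mul_assoc]
      _ = k₂ * s₂ * s₁ * k₀ * s₂ * k₂ * s₁ * s₂ := by rw [c₂, ← c₂]; simp only [mul_assoc, c₂]
      _ = k₂ * s₂ * s₁ * s₂ * k₀ * k₂ * s₁ * s₂ := by
          have : k₂ * s₂ * s₁ * k₀ * s₂ * k₂ * s₁ * s₂ =
            k₂ * s₂ * s₁ * (k₀ * s₂) * k₂ * s₁ * s₂ := by simp only [mul_assoc]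
          rw [this, ← c₃]; simp only [mul_assoc]
      _ = k₂ * (s₁ * s₂ * s₁ * k₂) * k₀ * s₁ * s₂ := by
          rw [hs]
          have : k₂ * s₂ * s₁ * s₂ * k₀ * k₂ * s₁ * s₂ =
            k₂ * s₂ * s₁ * s₂ * (k₀ * k₂) * s₁ * s₂ := by simp only [mul_assoc]
          rw [this, ← c₄]; simp only [mul_assoc]
      _ = k₂ * k₁ * s₂ * s₁ * (s₂ * k₀) * s₁ * s₂ := by rw [r, hs]; simp only [mul_assoc]
      _ = k₂ * k₁ * s₂ * s₁ * k₀ * (s₁ * s₂ * s₁) := by rw [c₃, hs]; simp only [mul_assoc]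
      _ = k₂ * k₁ * s₂ * (s₁ * k₀ * s₁) * s₂ * s₁ := by simp only [mul_assoc]
      _ = k₂ * k₁ * (s₂ * k₁ * s₂) * (s₂ * k₀ * s₂) * (s₂ * k₁ * s₂) * s₁ := by
          rw [a']; simp only [mul_assoc, cancel hs₂]
      _ = k₂ * k₁ * (k₁ * k₂ * k₁) * k₀ * (k₁ * k₂ * k₁) * s₁ := by
          rw [b', c₃, mul_assoc k₀, hs₂, mul_one]
      _ = _ := by simp only [mul_assoc, cancel hk₁, cancel hk₂]
  rw [left, right]

/-- A two-wire morphism on the middle two of four wires. -/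
def onMiddle (f : Mor 2 2) : Mor 4 4 := pad (gateAt 1 f)

/-- The exchange of the second and the fourth of four wires. -/
def swap₂₄ : Mor 4 4 := onMiddle swap₂ ⬝ gateAt 2 swap₂ ⬝ onMiddle swap₂

theorem onMiddle_seq (f g : Mor 2 2) : onMiddle (f ⬝ g) = onMiddle f ⬝ onMiddle g := by
  rw [onMiddle, gateAt_seq, pad_seq]; rfl

theorem onMiddle_eq_pad_onBottom (f : Mor 2 2) : onMiddle f = pad (onBottom f) := rfl

theorem onMiddle_eq_threeAt (f : Mor 2 2) : onMiddle f = threeAt 1 (onTop f) :=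
  (threeAt_onTop 1 f).symm

/-- The braid relation for swaps is naturality of the block symmetry `swap 2 1` at a swap. -/
theorem onTop_onBottom_onTop_swap : onTop swap₂ ⬝ onBottom swap₂ ⬝ onTop swap₂ =
    onBottom swap₂ ⬝ onTop swap₂ ⬝ onBottom swap₂ := by
  have h : onTop swap₂ ⬝ swap 2 1 = swap 2 1 ⬝ onBottom swap₂ := par_seq_swap swap₂ (id 1)
  rw [swap_two_one] at h
  rw [seq_assoc, h]

/-- The form is chosen for `pbs_split`: the two leading gates on the right act on freshly created
vacuum wires, which absorb them, and only the exchange `swap₂₄` is new. -/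
theorem pbs_conj_swaps : pad (pad pbs) ⬝ onMiddle swap₂ ⬝ pad (pad pbs) ⬝ gateAt 2 pbs =
    gateAt 2 swap₂ ⬝ gateAt 2 pbs ⬝ onMiddle swap₂ ⬝ pad (pad pbs) ⬝ gateAt 2 pbs ⬝ swap₂₄ := by
  have sq {f : Mor 2 2} (h : f ⬝ f = id 2) : onMiddle f ⬝ onMiddle f = id 4 := by
    rw [← onMiddle_seq, h, onMiddle, gateAt_id, pad_id]
  have sq' {f : Mor 2 2} (h : f ⬝ f = id 2) : gateAt 2 f ⬝ gateAt 2 f = id 4 := by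
    rw [← gateAt_seq, h, gateAt_id]
  have p₁ := congrArg pad pbs_pbs_pbs
  have p₂ := congrArg pad onBottom_pbs_onTop_onBottom
  have p₃ := congrArg pad onTop_pbs_conj
  have q₁ := congrArg (threeAt 1) pbs_pbs_pbs
  have q₃ := congrArg (threeAt 1) onTop_pbs_conj
  have q₄ := congrArg (threeAt 1) onTop_onBottom_onTop_swap
  simp only [pad_seq, ← onMiddle_eq_pad_onBottom] at p₁ p₂ p₃
  simp only [threeAt_seq, threeAt_onBottom, ← onMiddle_eq_threeAt] at q₁ q₃ q₄
  exact pbs_word_eq (M := Mor 4 4) (s₁ := onMiddle swap₂) (s₂ := gateAt 2 swap₂)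
    (k₀ := pad (pad pbs)) (k₁ := onMiddle pbs) (k₂ := gateAt 2 pbs) (sq swap₂_swap₂)
    (sq' swap₂_swap₂)
    (show pad (pad pbs) ⬝ pad (pad pbs) = id 4 by rw [← pad_seq, ← pad_seq, pbs_pbs, pad_id, pad_id])
    (sq pbs_pbs) (sq' pbs_pbs) q₄
    (show onMiddle swap₂ ⬝ onMiddle pbs = onMiddle pbs ⬝ onMiddle swap₂ by
      rw [← onMiddle_seq, ← onMiddle_seq, pbs_swap₂])
    (show gateAt 2 swap₂ ⬝ gateAt 2 pbs = gateAt 2 pbs ⬝ gateAt 2 swap₂ by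
      rw [← gateAt_seq, ← gateAt_seq, pbs_swap₂])
    (gateAt_comm pbs swap₂) (gateAt_comm pbs pbs) (p₃.trans p₁.symm) p₂.symm q₁.symm
    (q₃.trans q₁.symm)

/-- Four one-wire morphisms in parallel. -/
def par₄ (a b c d : Mor 1 1) : Mor 4 4 := a ⊠ b ⊠ c ⊠ d

theorem par₄_onMiddle (a b c d : Mor 1 1) :
    par₄ a b c d ⬝ onMiddle swap₂ = onMiddle swap₂ ⬝ par₄ a c b d := by
  have h (a b c : Mor 1 1) : (a ⊠ b ⊠ c : Mor 3 3) = par (n := 1) (m := 1) (n' := 2) (m' := 2) a (b ⊠ c) :=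
    (par_par_one a b c).symm
  have h₁ : (a ⊠ b ⊠ c : Mor 3 3) ⬝ onBottom swap₂ = onBottom swap₂ ⬝ (a ⊠ c ⊠ b : Mor 3 3) := by
    rw [h, h, onBottom, par_seq_par, par_seq_par, seq_id, id_seq]
    congr 1
    exact swap₂_natural b c
  have h₂ := par_seq_par (a ⊠ b ⊠ c : Mor 3 3) d (onBottom swap₂) (id 1)
  have h₃ := par_seq_par (onBottom swap₂) (id 1) (a ⊠ c ⊠ b : Mor 3 3) d
  rw [h₁, seq_id] at h₂
  rw [id_seq] at h₃
  exact h₂.trans h₃.symm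

theorem par₄_gateAt (a b c d : Mor 1 1) :
    par₄ a b c d ⬝ gateAt 2 swap₂ = gateAt 2 swap₂ ⬝ par₄ a b d c := by
  have h (a b c d : Mor 1 1) : par₄ a b c d =
      par (n := 2) (m := 2) (n' := 2) (m' := 2) (a ⊠ b) (c ⊠ d) := (par_par_one (a ⊠ b) c d).symm
  have h' : (c ⊠ d : Mor 2 2) ⬝ swap₂ = swap₂ ⬝ (d ⊠ c : Mor 2 2) := swap₂_natural c d
  rw [h, h, gateAt]
  refine (par_seq_par _ _ _ _).trans (Eq.trans ?_ (par_seq_par _ _ _ _).symm)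
  rw [h', seq_id, id_seq]

theorem par₄_swap₂₄ (f g : Mor 1 1) : par₄ f g f g ⬝ swap₂₄ = swap₂₄ ⬝ par₄ f g f g := by
  rw [swap₂₄, ← seq_assoc, ← seq_assoc, par₄_onMiddle, seq_assoc _ (par₄ _ _ _ _), par₄_gateAt,
    ← seq_assoc, seq_assoc _ (par₄ _ _ _ _), par₄_onMiddle]
  simp only [seq_assoc]

theorem split_par_split : (split ⊠ split : Mor 2 4) = sourceAt 2 ⬝ sourceAt 3 ⬝ onMiddle swap₂ ⬝
    pad (pad pbs) ⬝ gateAt 2 pbs ⬝ par₄ (id 1) neg (id 1) neg := by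
  have h₁ : par₄ (id 1) neg (id 1) neg = par (n := 2) (m := 2) (n' := 2) (m' := 2)
      (id 1 ⊠ neg) (id 1 ⊠ neg) := (par_par_one (id 1 ⊠ neg) (id 1) neg).symm
  have h₂ : pad (pad pbs) ⬝ gateAt 2 pbs = par (n := 2) (m := 2) (n' := 2) (m' := 2) pbs pbs := by
    rw [pad_pad, gateAt]
    refine (par_seq_par _ _ _ _).trans ?_
    rw [seq_id, id_seq]
  have h₃ : sourceAt 2 ⬝ sourceAt 3 ⬝ onMiddle swap₂ =
      par (n := 1) (m := 2) (n' := 1) (m' := 2) (sourceAt 1) (sourceAt 1) := by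
    have e₁ : par (n := 1) (m := 2) (n' := 1) (m' := 2) (sourceAt 1) (sourceAt 1) =
        pad (sourceAt 1) ⬝ sourceAt 3 := by
      have := par_seq_par (sourceAt 1) (id 1) (id 2) (sourceAt 1)
      rw [seq_id, id_seq] at this
      refine this.symm.trans ?_
      have e : under 2 (sourceAt 1) = sourceAt 3 := under_sourceAt 2 1
      rw [← e]; rfl
    rw [e₁, pad_sourceAt]
    have := seq_sourceAt (gateAt 1 swap₂)
    rw [seq_assoc, seq_assoc, this]; rfl
  have h₄ := par_seq_par (sourceAt 1 ⬝ pbs) (sourceAt 1 ⬝ pbs)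
    (par (n := 1) (m := 1) (id 1) neg) (par (n := 1) (m := 1) (id 1) neg)
  have h₅ := par_seq_par (sourceAt 1) (sourceAt 1) pbs pbs
  rw [← h₅] at h₄
  rw [h₁, h₃, seq_assoc _ (pad (pad pbs)), h₂]
  exact h₄.symm

/-- A polarising beam splitter exchanges the horizontal photons of two wires; after splitting, these
travel on the second and fourth wires. -/
theorem pbs_split : pbs ⬝ (split ⊠ split : Mor 2 4) = (split ⊠ split : Mor 2 4) ⬝ swap₂₄ := by
  have h₁ : pbs ⬝ (sourceAt 2 ⬝ sourceAt 3) = sourceAt 2 ⬝ sourceAt 3 ⬝ pad (pad pbs) := by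
    rw [← seq_assoc, seq_sourceAt pbs, seq_assoc, seq_sourceAt (pad pbs), ← seq_assoc]
  have h₂ : sourceAt 2 ⬝ sourceAt 3 ⬝ gateAt 2 swap₂ = sourceAt 2 ⬝ sourceAt 3 :=
    sourceAt_sourceAt_gateAt 2 .swap₂
  have h₃ : sourceAt 2 ⬝ sourceAt 3 ⬝ gateAt 2 pbs = sourceAt 2 ⬝ sourceAt 3 := by
    have e₁ : sourceAt 3 = par (n := 2) (m := 2) (id 2) (sourceAt 1) :=
      id_par_id_par 2 source rfl rfl
    have e₂ : sourceAt 2 ⬝ sourceAt 3 = par (n := 2) (m := 2) (n' := 0) (m' := 2) (id 2)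
        (source ⊠ source) := by
      rw [e₁]
      refine (id_par_seq 2 source (sourceAt 1)).symm.trans ?_
      congr 1
      have := par_seq_par source (id 0) (id 1) source
      rwa [par_empty, seq_id, id_seq] at this
    rw [e₂]
    refine (id_par_seq 2 _ pbs).symm.trans ?_
    rw [source_pbs]
  rw [split_par_split]
  let N := par₄ (id 1) neg (id 1) neg
  calc _ = (pbs ⬝ (sourceAt 2 ⬝ sourceAt 3)) ⬝ onMiddle swap₂ ⬝ pad (pad pbs) ⬝ gateAt 2 pbs ⬝ N := by
        simp only [seq_assoc]; rfl
    _ = sourceAt 2 ⬝ sourceAt 3 ⬝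
        (pad (pad pbs) ⬝ onMiddle swap₂ ⬝ pad (pad pbs) ⬝ gateAt 2 pbs) ⬝ N := by
        rw [h₁]; simp only [seq_assoc]
    _ = (sourceAt 2 ⬝ sourceAt 3 ⬝ gateAt 2 swap₂ ⬝ gateAt 2 pbs) ⬝ onMiddle swap₂ ⬝
        pad (pad pbs) ⬝ gateAt 2 pbs ⬝ (swap₂₄ ⬝ N) := by
        rw [pbs_conj_swaps]; simp only [seq_assoc]
    _ = _ := by
        rw [h₂, h₃, ← par₄_swap₂₄]; simp only [seq_assoc]

/-! ## Encoding of circuits by active circuits -/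

/-- Split all the wires. -/
def splitAll : (n : ℕ) → Mor n (2 * n)
  | 0 => id 0
  | n + 1 => par (n := n) (m := 2 * n) (splitAll n) split

/-- Merge all the wires. -/
def mergeAll : (n : ℕ) → Mor (2 * n) n
  | 0 => id 0
  | n + 1 => par (n := 2 * n) (m := n) (mergeAll n) merge

theorem splitAll_mergeAll (n : ℕ) : splitAll n ⬝ mergeAll n = id n := by
  induction n with
  | zero => exact id_seq _
  | succ n ih =>
    refine (par_seq_par (splitAll n) split (mergeAll n) merge).trans ?_
    rw [ih, split_merge, par_id]

theorem cast_par {n m n' m' k l : ℕ} (hn : n = n') (hm : m = m') (f : Mor n m) (g : Mor k l) :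
    cast hn hm f ⊠ g = cast (congrArg (· + k) hn) (congrArg (· + l) hm) (f ⊠ g) := by
  subst hn hm; rfl

theorem seq_cast {n m k k' : ℕ} (h : k = k') (f : Mor n m) (g : Mor m k) :
    f ⬝ cast rfl h g = cast rfl h (f ⬝ g) := by
  subst h; rfl

theorem cast_seq_cast {n m m' k k' : ℕ} (h : m = m') (h' : k = k') (f : Mor n m) (g : Mor m k) :
    cast rfl h f ⬝ cast h h' g = cast rfl h' (f ⬝ g) := by
  subst h h'; rfl

theorem splitAll_add (n m : ℕ) :
    splitAll (n + m) = cast rfl (Nat.mul_add 2 n m).symm (splitAll n ⊠ splitAll m) := by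
  induction m with
  | zero => exact (par_empty (splitAll n)).symm
  | succ m ih =>
    change splitAll (n + m) ⊠ split = _
    rw [ih, cast_par]
    have h : splitAll n ⊠ (splitAll m ⊠ split) = splitAll n ⊠ splitAll m ⊠ split :=
      (cast_par_assoc (splitAll n) (splitAll m) split).symm
    rw [← h]
    rfl

/-- A morphism is encodable when it becomes an active circuit after splitting all wires. -/
def Encodable {n m : ℕ} (f : Mor n m) : Prop :=
  ∃ g, Active g ∧ f ⬝ splitAll m = splitAll n ⬝ g

theorem Encodable.seq {n m k : ℕ} {f : Mor n m} {g : Mor m k} (hf : Encodable f)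
    (hg : Encodable g) : Encodable (f ⬝ g) := by
  obtain ⟨f', hf', e⟩ := hf
  obtain ⟨g', hg', e'⟩ := hg
  exact ⟨_, hf'.seq hg', by rw [seq_assoc, e', ← seq_assoc, e, seq_assoc]⟩

theorem Encodable.par {n m n' m' : ℕ} {f : Mor n m} {g : Mor n' m'} (hf : Encodable f)
    (hg : Encodable g) : Encodable (f ⊠ g) := by
  obtain ⟨f', hf', e⟩ := hf
  obtain ⟨g', hg', e'⟩ := hg
  refine ⟨_, (hf'.par hg').cast (hn := (Nat.mul_add 2 n n').symm) (hm := (Nat.mul_add 2 m m').symm), ?_⟩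
  rw [splitAll_add, splitAll_add, seq_cast, cast_seq_cast, par_seq_par, par_seq_par, e, e']

theorem Encodable.id (n : ℕ) : Encodable (id n) := ⟨_, .id _, by rw [id_seq, seq_id]⟩

theorem Encodable.swap (n m : ℕ) : Encodable (swap n m) := by
  refine ⟨_, (Active.swap (2 * n) (2 * m)).cast (hn := (Nat.mul_add 2 n m).symm)
    (hm := (Nat.mul_add 2 m n).symm), ?_⟩
  rw [splitAll_add, splitAll_add, seq_cast, cast_seq_cast, par_seq_swap]

theorem splitAll_one : splitAll 1 = split := id_zero_par split rfl rfl

theorem splitAll_two : splitAll 2 = (split ⊠ split : Mor 2 4) := by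
  have h : splitAll 2 = Mor.par (n := 1) (m := 2) (splitAll 1) split := rfl
  rw [h, splitAll_one]

theorem Encodable.phase (φ : ℝ) : Encodable (phase φ) :=
  ⟨gateAt 0 (Mor.phase φ ⊠ Mor.phase φ), .passive (.gate 0 (.phases φ φ)), by
    rw [splitAll_one, gateAt_zero]; exact phase_split φ⟩

theorem Encodable.waveplate (θ : ℝ) : Encodable (waveplate θ) :=
  ⟨Mor.bs θ, .passive (by rw [← gateAt_zero (Mor.bs θ)]; exact .gate 0 (.bs θ)), by
    rw [splitAll_one]; exact waveplate_split θ⟩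

theorem Encodable.source : Encodable source :=
  ⟨_, (Active.source 0).seq (.source 1), by
    rw [splitAll_one, source_split]; exact (id_seq _).symm⟩

theorem Encodable.detector : Encodable detector :=
  ⟨_, (Active.detector 1).seq (.detector 0), by
    rw [splitAll_one, split_detector_detector]
    have : detectorAt 0 = Mor.detector := id_zero_par Mor.detector rfl rfl
    rw [this]; exact seq_id _⟩

theorem Encodable.pbs : Encodable pbs :=
  ⟨swap₂₄, by
    have h : Active (onMiddle swap₂) := .passive (Passive.gate 1 .swap₂).pad
    exact (h.seq (.passive (.gate 2 .swap₂))).seq h, by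
    rw [splitAll_two]; exact pbs_split⟩

theorem Encodable.mk {n m : ℕ} (D : Circuit n m) : Encodable (mk D) := by
  induction D with
  | source => exact .source
  | detector => exact .detector
  | phase φ => exact .phase φ
  | waveplate θ => exact .waveplate θ
  -- `bs_waveplate` reduces a beam splitter to generators already encoded.
  | bs θ =>
    have hn : Encodable (Mor.id 1 ⊠ neg) :=
      (Encodable.id 1).par ((Encodable.waveplate _).seq (.phase _))
    have h := (((hn.seq .pbs).seq ((Encodable.waveplate θ).par (.waveplate θ))).seq .pbs).seq hn
    rw [← bs_waveplate] at h
    exact h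
  | pbs => exact .pbs
  | id n => exact .id n
  | swap n m => exact .swap n m
  | seq _ _ h₁ h₂ => exact h₁.seq h₂
  | par _ _ h₁ h₂ => exact h₁.par h₂

/-! ### From encodings to completeness -/

theorem sem_split_ket (c : Pol) : sem split (ket c 0) =
    ket .V (match c with | .V => 0 | .H => 1) := by
  have h : sem (sourceAt 1) (ket c 0) = ket c (0 : Fin 2) := by
    rw [sem_sourceAt, spatial_ket]
    simp [inclMat]
  rw [split, sem_seq, sem_seq, LinearMap.comp_apply, LinearMap.comp_apply, h]
  change interp (Circuit.wire ⊕ᶜ Circuit.neg) (interp Circuit.pbs (ket c 0)) = _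
  cases c <;>
    simp [interp_pbs_ket, interp_par_ket_zero, interp_par_ket_one, interp_id, interp_neg, Pol.flip]

/-- The image of `splitAll` contains a vertical photon at every position, which is enough to test
maps of the form `spatial C`. -/
theorem exists_sem_splitAll_ket (n : ℕ) (q : Fin (2 * n)) :
    ∃ c p, sem (splitAll n) (ket c p) = ket .V q := by
  induction n with
  | zero => exact q.elim0
  | succ n ih =>
    change Fin (2 * n + 2) at q
    refine Fin.addCases (fun q => ?_) (fun q => ?_) q
    · obtain ⟨c, p, h⟩ := ih q
      refine ⟨c, Fin.castAdd 1 p, ?_⟩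
      have e := directSum_ket_castAdd (sem (splitAll n)) (sem split) c p
      rw [← sem_par, h, relabel_ket] at e
      exact e
    · have e (c : Pol) := directSum_ket_natAdd (sem (splitAll n)) (sem split) c 0
      simp only [← sem_par, sem_split_ket, relabel_ket] at e
      fin_cases q
      · exact ⟨.V, _, e .V⟩
      · exact ⟨.H, _, e .H⟩

/-- Circuits with the same semantics are equal modulo the equational theory. -/
theorem sem_injective {n m : ℕ} : Function.Injective (sem : Mor n m → _) := by
  intro f g
  induction f using ind with | h D₁
  induction g using ind with | h D₂
  intro h
  obtain ⟨f', hf, e⟩ := Encodable.mk D₁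
  obtain ⟨g', hg, e'⟩ := Encodable.mk D₂
  have hs : sem f' ∘ₗ sem (splitAll n) = sem g' ∘ₗ sem (splitAll n) := by
    rw [← sem_seq, ← sem_seq, ← e, ← e', sem_seq, sem_seq, h]
  obtain ⟨A, hA⟩ := hf.sem
  obtain ⟨B, hB⟩ := hg.sem
  -- Only vertical inputs are available after splitting, but the matrices do not depend on the
  -- polarisation.
  have hAB : A = B := by
    ext i j
    obtain ⟨c, p, hc⟩ := exists_sem_splitAll_ket n j
    have := congrFun (LinearMap.congr_fun hs (ket c p)) (.V, i)
    rw [LinearMap.comp_apply, LinearMap.comp_apply, hc, hA, hB, spatial_ket_apply,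
      spatial_ket_apply] at this
    simpa using this
  have hfg : f' = g' := hf.ext hg (by rw [hA, hB, hAB])
  have key : mk D₁ ⬝ splitAll m = mk D₂ ⬝ splitAll m := by rw [e, e', hfg]
  have := congrArg (· ⬝ mergeAll m) key
  simpa only [seq_assoc, splitAll_mergeAll, seq_id] using this

end Mor

end LOv

end

theorem theorem2 (n m : ℕ) (D₁ D₂ : LOv.Circuit n m) :
    LOv.interp D₁ = LOv.interp D₂ ↔ LOv.Derivable D₁ D₂ :=
  ⟨fun h => LOv.Mor.mk_eq_mk.1 (LOv.Mor.sem_injective h), LOv.interp_eq_of_derivable⟩
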